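/- Let $A$ be a Lie algebroid over a smooth (Hausdorff, second countable) manifold $M$, i.e. a smooth real vector bundle of constant finite rank with a smooth anchor $\rho:A\to TM$ and a Lie bracket on $\Gamma(A)$ satisfying the Leibniz rule and $\rho([\alpha,\beta])=[\rho(\alpha),\rho(\beta)]$. For a vector bundle $E$ of rank $r$ put $\mathcal V_E=\Lambda^{\mathrm{top}}E^*$, and let $\mathcal D_E=|\Lambda^{\mathrm{top}}E^*|$ be its density bundle: their fibres consist of the functions $\xi$ on frames with $\xi(e\cdot g)=\det(g)\,\xi(e)$, respectively $\xi(e\cdot g)=|\det g|\,\xi(e)$, for $g\in GL_r(\mathbb R)$. Consider the line bundles $$\mathcal D_A^{\mathrm{tr}}=\mathcal D_{A^*}\otimes\mathcal D_{TM},\qquad \mathcal V_A^{\mathrm{tr}}=\mathcal V_{A^*}\otimes\mathcal V_{TM}=\Lambda^{\mathrm{top}}A\otimes\Lambda^{\mathrm{top}}T^*M,\qquad Q_A=\mathcal V_{A^*}\otimes\mathcal D_{TM}=\Lambda^{\mathrm{top}}A\otimes|\Lambda^{\mathrm{top}}T^*M|,$$ each with the operation of $\Gamma(A)$ given by Lie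 derivatives, $\nabla_\alpha(\omega\otimes\mu)=L_\alpha\omega\otimes\mu+\omega\otimes L_{\rho(\alpha)}\mu$. For a representation $(L,\nabla)$ of $A$ on a line bundle (a flat $A$-connection), the characteristic class $\theta_A(L)\in H^1(A)$ is $\tfrac12[c_\sigma]$, where $\sigma$ is any nowhere vanishing section of $L\otimes L$ and $c_\sigma\in\Gamma(A^*)$ is the closed form with $\nabla_\alpha\sigma=c_\sigma(\alpha)\,\sigma$ for the induced representation on $L\otimes L$. The modular class is $\mathrm{mod}(A):=\theta_A(\mathcal D_A^{\mathrm{tr}})$. Then $Q_A$, $\mathcal D_A^{\mathrm{tr}}$ and $\mathcal V_A^{\mathrm{tr}}$ are representations of $A$, their characteristic classes are well defined (such $\sigma$ exist, and $[c_\sigma]$ does not depend on $\sigma$), and $$\theta_A(Q_A)=\theta_A(\mathcal D_A^{\mathrm{tr}})=\theta_A(\mathcal V_A^{\mathrm{tr}})=\mathrm{mod}(A).$$ -/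

import Mathlib

open Bundle Set Filter Topology Module
open scoped Manifold ContDiff TensorProduct

noncomputable section

/-! ### Real line bundles from local frames -/

/-- A cover of the base of a family of real lines by open sets with local frames and coframes,
such that the transition functions are continuous. -/
structure LineFrames (B : Type*) [TopologicalSpace B] (L : B → Type*)
    [∀ x, AddCommGroup (L x)] [∀ x, Module ℝ (L x)] where
  U : B → Set B
  isOpen_U : ∀ b, IsOpen (U b)
  mem_U : ∀ b, b ∈ U b
  coord : B → ∀ x, L x →ₗ[ℝ] ℝ
  frame : B → ∀ x, L x
  coord_frame : ∀ b, ∀ x ∈ U b, coord b x (frame b x) = 1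
  coord_smul_frame : ∀ b, ∀ x ∈ U b, ∀ v : L x, coord b x v • frame b x = v
  continuousOn : ∀ b b', ContinuousOn (fun x => coord b' x (frame b x)) (U b ∩ U b')

namespace LineFrames

variable {B : Type*} [TopologicalSpace B] {L : B → Type*}
  [∀ x, AddCommGroup (L x)] [∀ x, Module ℝ (L x)] (a : LineFrames B L)

open Classical in
/-- The local trivialization `v ↦ (x, coord b x v)` over `U b`. -/
def pretriv (b : B) : Pretrivialization ℝ (π ℝ L) where
  toFun p := (p.1, a.coord b p.1 p.2)
  invFun q := ⟨q.1, q.2 • a.frame b q.1⟩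
  source := π ℝ L ⁻¹' a.U b
  target := a.U b ×ˢ univ
  map_source' p hp := ⟨hp, mem_univ _⟩
  map_target' q hq := hq.1
  left_inv' := by
    rintro ⟨x, v⟩ hp
    simp only [a.coord_smul_frame b x hp v]
  right_inv' := by
    rintro ⟨x, t⟩ hq
    simp only [map_smul, a.coord_frame b x hq.1, smul_eq_mul, mul_one]
  open_target := (a.isOpen_U b).prod isOpen_univ
  baseSet := a.U b
  open_baseSet := a.isOpen_U b
  source_eq := rfl
  target_eq := rfl
  proj_toFun _ _ := rfl

lemma pretriv_symm (b x : B) (hx : x ∈ a.U b) (t : ℝ) :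
    (a.pretriv b).symm x t = t • a.frame b x := by
  have h : x ∈ (a.pretriv b).baseSet := hx
  rw [Pretrivialization.symm_apply _ h]
  rfl

lemma pretriv_change (b b' x : B) (hx : x ∈ a.U b) (t : ℝ) :
    ((a.pretriv b') ⟨x, (a.pretriv b).symm x t⟩).2 = a.coord b' x (a.frame b x) * t := by
  rw [a.pretriv_symm b x hx]
  change a.coord b' x (t • a.frame b x) = _
  rw [map_smul, smul_eq_mul, mul_comm]

variable [∀ x, TopologicalSpace (L x)] [∀ x, IsModuleTopology ℝ (L x)]

/-- The vector prebundle defined by a compatible family of local frames. -/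
def prebundle : VectorPrebundle ℝ ℝ L where
  pretrivializationAtlas := range a.pretriv
  pretrivialization_linear' := by
    rintro _ ⟨b, rfl⟩
    exact ⟨fun x _ => (a.coord b x).isLinear⟩
  pretrivializationAt := a.pretriv
  mem_base_pretrivializationAt := a.mem_U
  pretrivialization_mem_atlas b := mem_range_self b
  exists_coordChange := by
    rintro _ ⟨b, rfl⟩ _ ⟨b', rfl⟩
    refine ⟨fun x => ContinuousLinearMap.mul ℝ ℝ (a.coord b' x (a.frame b x)), ?_, ?_⟩
    · exact (ContinuousLinearMap.mul ℝ ℝ).continuous.comp_continuousOn (a.continuousOn b b')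
    · intro x hx v
      rw [a.pretriv_change b b' x hx.1]
      rfl
  totalSpaceMk_isInducing b := by
    have hc : Continuous (a.coord b b) := IsModuleTopology.continuous_of_linearMap _
    have := IsModuleTopology.toContinuousSMul ℝ (L b)
    have hs : Continuous (fun t : ℝ => t • a.frame b b) := by fun_prop
    have h1 : IsInducing (a.coord b b) :=
      IsInducing.of_comp hc hs (by
        have : (fun t : ℝ => t • a.frame b b) ∘ a.coord b b = id :=
          funext fun v => a.coord_smul_frame b b (a.mem_U b) v
        rw [this]
        exact IsInducing.id)
    have h2 : IsInducing (fun t : ℝ => (b, t)) := isInducing_prodMkRight b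
    exact h2.comp h1

lemma prebundle_isContMDiff {E : Type*} [NormedAddCommGroup E] [NormedSpace ℝ E]
    [ChartedSpace E B]
    (h : ∀ b b', ContMDiffOn 𝓘(ℝ, E) 𝓘(ℝ, ℝ) ∞ (fun x => a.coord b' x (a.frame b x))
      (a.U b ∩ a.U b')) :
    a.prebundle.IsContMDiff 𝓘(ℝ, E) ∞ where
  exists_contMDiffCoordChange := by
    rintro _ ⟨b, rfl⟩ _ ⟨b', rfl⟩
    refine ⟨fun x => ContinuousLinearMap.mul ℝ ℝ (a.coord b' x (a.frame b x)), ?_, ?_⟩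
    · exact (ContinuousLinearMap.mul ℝ ℝ).contDiff.contMDiff.comp_contMDiffOn (h b b')
    · intro x hx v
      rw [a.pretriv_change b b' x hx.1]
      rfl

end LineFrames

/-! ### The line `L_δ(V)` of a vector space -/

/-- A smooth homomorphism `χ : ℝ* → ℝ*`, extended by `χ 0 = 0`. -/
structure SmoothCharacter where
  toHom : ℝ →*₀ ℝ
  smooth : ContDiffOn ℝ ∞ toHom {0}ᶜ

/-- The derivative of a smooth character at `1`. -/
def SmoothCharacter.weight (χ : SmoothCharacter) : ℝ := deriv χ.toHom 1

/-- The character `t ↦ t`, so that `χ ∘ det = det`. -/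
def volChar : SmoothCharacter := ⟨MonoidWithZeroHom.id ℝ, contDiff_id.contDiffOn⟩

/-- The character `t ↦ |t|`, so that `χ ∘ det = |det|`. -/
def densChar : SmoothCharacter := ⟨absHom, fun _ hx => (contDiffAt_abs hx).contDiffWithinAt⟩

section Assoc

variable (χ : SmoothCharacter) (F : Type*) [NormedAddCommGroup F] [NormedSpace ℝ F]

/-- `L_δ(V)` for `δ = χ ∘ det`: the functions `ξ` on the frames `e : F ≃ V` with
`ξ (e ∘ g) = δ g * ξ e` for `g ∈ GL(F)`. -/
def assocLine (V : Type*) [AddCommGroup V] [Module ℝ V] : Submodule ℝ ((F ≃ₗ[ℝ] V) → ℝ) where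
  carrier := {ξ | ∀ (e : F ≃ₗ[ℝ] V) (g : F ≃ₗ[ℝ] F),
    ξ (g.trans e) = χ.toHom (LinearMap.det (g : F →ₗ[ℝ] F)) * ξ e}
  add_mem' := by
    intro ξ η hξ hη e g
    simp only [Pi.add_apply, hξ e g, hη e g, mul_add]
  zero_mem' := by
    intro e g
    simp
  smul_mem' := by
    intro c ξ hξ e g
    simp only [Pi.smul_apply, hξ e g, smul_eq_mul]
    ring

/-- The element of `L_δ(V)` with value `1` at the frame `e₀`. -/
def assocLineUnit {V : Type*} [AddCommGroup V] [Module ℝ V] (e₀ : F ≃ₗ[ℝ] V) :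
    assocLine χ F V :=
  ⟨fun e => χ.toHom (LinearMap.det ((e.trans e₀.symm : F ≃ₗ[ℝ] F) : F →ₗ[ℝ] F)), by
    intro e g
    have : (((g.trans e).trans e₀.symm : F ≃ₗ[ℝ] F) : F →ₗ[ℝ] F) =
        ((e.trans e₀.symm : F ≃ₗ[ℝ] F) : F →ₗ[ℝ] F) ∘ₗ (g : F →ₗ[ℝ] F) := rfl
    beta_reduce
    rw [this, LinearMap.det_comp, map_mul, mul_comm]⟩

/-- Evaluation at a frame. -/
def assocLineEval {V : Type*} [AddCommGroup V] [Module ℝ V] (e₀ : F ≃ₗ[ℝ] V) :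
    assocLine χ F V →ₗ[ℝ] ℝ where
  toFun ξ := ξ.1 e₀
  map_add' _ _ := rfl
  map_smul' _ _ := rfl

lemma assocLineEval_unit {V : Type*} [AddCommGroup V] [Module ℝ V] (e₀ e₁ : F ≃ₗ[ℝ] V) :
    assocLineEval χ F e₁ (assocLineUnit χ F e₀) =
      χ.toHom (LinearMap.det ((e₁.trans e₀.symm : F ≃ₗ[ℝ] F) : F →ₗ[ℝ] F)) := rfl

lemma assocLineEval_smul_unit {V : Type*} [AddCommGroup V] [Module ℝ V] (e₀ : F ≃ₗ[ℝ] V)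
    (ξ : assocLine χ F V) : assocLineEval χ F e₀ ξ • assocLineUnit χ F e₀ = ξ := by
  ext e
  have h := ξ.2 e₀ (e.trans e₀.symm)
  have h' : (e.trans e₀.symm).trans e₀ = e := by ext; simp
  rw [h'] at h
  rw [h, mul_comm]
  rfl

variable {B : Type*} [TopologicalSpace B] (E : B → Type*)
  [∀ x, AddCommGroup (E x)] [∀ x, Module ℝ (E x)]

/-- The family of lines `L_δ(E_x)`. -/
def AssocBundle (x : B) : Type _ := assocLine χ F (E x)

instance (x : B) : AddCommGroup (AssocBundle χ F E x) :=
  inferInstanceAs (AddCommGroup (assocLine χ F (E x)))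
instance (x : B) : Module ℝ (AssocBundle χ F E x) :=
  inferInstanceAs (Module ℝ (assocLine χ F (E x)))
instance (x : B) : TopologicalSpace (AssocBundle χ F E x) :=
  moduleTopology ℝ (AssocBundle χ F E x)
instance (x : B) : IsModuleTopology ℝ (AssocBundle χ F E x) := ⟨rfl⟩
instance (x : B) : IsTopologicalAddGroup (AssocBundle χ F E x) :=
  IsModuleTopology.topologicalAddGroup ℝ _
instance (x : B) : ContinuousSMul ℝ (AssocBundle χ F E x) :=
  IsModuleTopology.toContinuousSMul ℝ _

variable [∀ x, TopologicalSpace (E x)] [TopologicalSpace (TotalSpace F E)]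
  [FiberBundle F E] [VectorBundle ℝ F E]

/-- The frame `F ≃ E_x` given by the preferred trivialization of `E` around `b`. -/
def trivFrame (b x : B) (hx : x ∈ (trivializationAt F E b).baseSet) : F ≃ₗ[ℝ] E x :=
  ((trivializationAt F E b).linearEquivAt ℝ x hx).symm

/-- The element of `L_δ(E_x)` with value `1` at the frame `e₀`. -/
def AssocBundle.unit {x : B} (e₀ : F ≃ₗ[ℝ] E x) : AssocBundle χ F E x := assocLineUnit χ F e₀

/-- Evaluation of elements of `L_δ(E_x)` at the frame `e₀`. -/
def AssocBundle.eval {x : B} (e₀ : F ≃ₗ[ℝ] E x) : AssocBundle χ F E x →ₗ[ℝ] ℝ :=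
  assocLineEval χ F e₀

open Classical in
/-- The local section of `L_δ(E)` with value `1` on the frame of `E` given by the preferred
trivialization around `b`. -/
def AssocBundle.frame (b x : B) : AssocBundle χ F E x :=
  if hx : x ∈ (trivializationAt F E b).baseSet then AssocBundle.unit χ F E (trivFrame F E b x hx) else 0

open Classical in
/-- Evaluation on the frame of `E` given by the preferred trivialization around `b`. -/
def AssocBundle.coord (b x : B) : AssocBundle χ F E x →ₗ[ℝ] ℝ :=
  if hx : x ∈ (trivializationAt F E b).baseSet then AssocBundle.eval χ F E (trivFrame F E b x hx) else 0

lemma AssocBundle.coord_frame' (b b' x : B) (hx : x ∈ (trivializationAt F E b).baseSet)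
    (hx' : x ∈ (trivializationAt F E b').baseSet) :
    AssocBundle.coord χ F E b' x (AssocBundle.frame χ F E b x) =
      χ.toHom (((trivializationAt F E b').coordChangeL ℝ (trivializationAt F E b) x :
        F →L[ℝ] F).det) := by
  have h1 : AssocBundle.coord χ F E b' x = AssocBundle.eval χ F E (trivFrame F E b' x hx') := by
    unfold AssocBundle.coord; rw [dif_pos hx']
  have h2 : AssocBundle.frame χ F E b x = AssocBundle.unit χ F E (trivFrame F E b x hx) := by
    unfold AssocBundle.frame; rw [dif_pos hx]
  rw [h1, h2]
  refine (assocLineEval_unit χ F _ _).trans ?_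
  congr 2
  ext v
  rw [ContinuousLinearMap.coe_coe, ContinuousLinearEquiv.coe_coe,
    Trivialization.coordChangeL_apply _ _ ⟨hx', hx⟩]
  simp [trivFrame]

lemma coordChangeL_det_ne_zero (b b' x : B) :
    ((trivializationAt F E b').coordChangeL ℝ (trivializationAt F E b) x :
        F →L[ℝ] F).det ≠ 0 :=
  (LinearEquiv.isUnit_det'
    ((trivializationAt F E b').coordChangeL ℝ (trivializationAt F E b) x).toLinearEquiv).ne_zero

variable [FiniteDimensional ℝ F]

lemma contDiff_clm_det : ContDiff ℝ ∞ (fun f : F →L[ℝ] F => f.det) := by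
  let b := Module.finBasis ℝ F
  have h : (fun f : F →L[ℝ] F => f.det) =
      fun f : F →L[ℝ] F => (LinearMap.toMatrix b b (f : F →ₗ[ℝ] F)).det := by
    ext f
    rw [LinearMap.det_toMatrix]
  rw [h]
  simp only [Matrix.det_apply]
  refine ContDiff.sum fun σ _ => ContDiff.const_smul _ (contDiff_prod fun i _ => ?_)
  simp only [LinearMap.toMatrix_apply]
  let φ : F →L[ℝ] ℝ := (b.coord (σ i)).toContinuousLinearMap
  exact (φ.contDiff (n := ∞)).comp (contDiff_id.clm_apply contDiff_const)

/-- The defining local frames of the line bundle `L_δ(E)`. -/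
def AssocBundle.lineFrames : LineFrames B (AssocBundle χ F E) where
  U b := (trivializationAt F E b).baseSet
  isOpen_U b := (trivializationAt F E b).open_baseSet
  mem_U b := FiberBundle.mem_baseSet_trivializationAt F E b
  coord := AssocBundle.coord χ F E
  frame := AssocBundle.frame χ F E
  coord_frame b x hx := by
    rw [AssocBundle.coord_frame' χ F E b b x hx hx]
    have : ((trivializationAt F E b).coordChangeL ℝ (trivializationAt F E b) x : F →L[ℝ] F) =
        ContinuousLinearMap.id ℝ F := by
      ext v
      rw [ContinuousLinearEquiv.coe_coe, Trivialization.coordChangeL_apply _ _ ⟨hx, hx⟩]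
      simp [hx]
    rw [this]
    simp [ContinuousLinearMap.det]
  coord_smul_frame b x hx v := by
    unfold AssocBundle.coord AssocBundle.frame
    rw [dif_pos hx, dif_pos hx]
    exact assocLineEval_smul_unit χ F _ v
  continuousOn b b' := by
    have h : ContinuousOn (fun x => χ.toHom
        (((trivializationAt F E b').coordChangeL ℝ (trivializationAt F E b) x :
          F →L[ℝ] F).det))
        ((trivializationAt F E b).baseSet ∩ (trivializationAt F E b').baseSet) := by
      refine χ.smooth.continuousOn.comp (t := {0}ᶜ) ?_
        (fun x _ => coordChangeL_det_ne_zero F E b b' x)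
      refine ((contDiff_clm_det F).continuous).comp_continuousOn ?_
      rw [inter_comm]
      exact continuousOn_coordChange ℝ _ _
    exact h.congr fun x hx => AssocBundle.coord_frame' χ F E b b' x hx.1 hx.2

instance : TopologicalSpace (TotalSpace ℝ (AssocBundle χ F E)) :=
  (AssocBundle.lineFrames χ F E).prebundle.totalSpaceTopology
instance : FiberBundle ℝ (AssocBundle χ F E) :=
  (AssocBundle.lineFrames χ F E).prebundle.toFiberBundle
instance : VectorBundle ℝ ℝ (AssocBundle χ F E) :=
  (AssocBundle.lineFrames χ F E).prebundle.toVectorBundle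

instance {EB : Type*} [NormedAddCommGroup EB] [NormedSpace ℝ EB] [ChartedSpace EB B]
    [ContMDiffVectorBundle ∞ F E 𝓘(ℝ, EB)] :
    ContMDiffVectorBundle ∞ ℝ (AssocBundle χ F E) 𝓘(ℝ, EB) := by
  have : (AssocBundle.lineFrames χ F E).prebundle.IsContMDiff 𝓘(ℝ, EB) ∞ := by
    refine LineFrames.prebundle_isContMDiff _ fun b b' => ?_
    have h : ContMDiffOn 𝓘(ℝ, EB) 𝓘(ℝ, ℝ) ∞ (fun x => χ.toHom
        (((trivializationAt F E b').coordChangeL ℝ (trivializationAt F E b) x :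
          F →L[ℝ] F).det))
        ((trivializationAt F E b).baseSet ∩ (trivializationAt F E b').baseSet) := by
      refine χ.smooth.contMDiffOn.comp (t := {0}ᶜ) ?_
        (fun x _ => coordChangeL_det_ne_zero F E b b' x)
      refine ((contDiff_clm_det F).contMDiff).comp_contMDiffOn ?_
      rw [inter_comm]
      exact contMDiffOn_coordChangeL _ _
    exact h.congr fun x hx => AssocBundle.coord_frame' χ F E b b' x hx.1 hx.2
  exact (AssocBundle.lineFrames χ F E).prebundle.contMDiffVectorBundle 𝓘(ℝ, EB)

end Assoc

/-! ### Tensor products of line bundles -/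

section Tensor

variable {B : Type*} [TopologicalSpace B] (L₁ L₂ : B → Type*)
  [∀ x, AddCommGroup (L₁ x)] [∀ x, Module ℝ (L₁ x)]
  [∀ x, AddCommGroup (L₂ x)] [∀ x, Module ℝ (L₂ x)]

/-- The family of lines `L₁ ⊗ L₂`. -/
def TensorBundle (x : B) : Type _ := L₁ x ⊗[ℝ] L₂ x

instance (x : B) : AddCommGroup (TensorBundle L₁ L₂ x) :=
  inferInstanceAs (AddCommGroup (L₁ x ⊗[ℝ] L₂ x))
instance (x : B) : Module ℝ (TensorBundle L₁ L₂ x) :=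
  inferInstanceAs (Module ℝ (L₁ x ⊗[ℝ] L₂ x))
instance (x : B) : TopologicalSpace (TensorBundle L₁ L₂ x) :=
  moduleTopology ℝ (TensorBundle L₁ L₂ x)
instance (x : B) : IsModuleTopology ℝ (TensorBundle L₁ L₂ x) := ⟨rfl⟩
instance (x : B) : IsTopologicalAddGroup (TensorBundle L₁ L₂ x) :=
  IsModuleTopology.topologicalAddGroup ℝ _
instance (x : B) : ContinuousSMul ℝ (TensorBundle L₁ L₂ x) :=
  IsModuleTopology.toContinuousSMul ℝ _

variable {L₁ L₂} in
/-- The pure tensor `u ⊗ v` in the fibre of `L₁ ⊗ L₂` at `x`. -/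
def TensorBundle.tmul {x : B} (u : L₁ x) (v : L₂ x) : TensorBundle L₁ L₂ x := u ⊗ₜ[ℝ] v

variable [∀ x, TopologicalSpace (L₁ x)] [TopologicalSpace (TotalSpace ℝ L₁)]
  [FiberBundle ℝ L₁] [VectorBundle ℝ ℝ L₁]
  [∀ x, TopologicalSpace (L₂ x)] [TopologicalSpace (TotalSpace ℝ L₂)]
  [FiberBundle ℝ L₂] [VectorBundle ℝ ℝ L₂]

/-- The local frame of a line bundle given by the preferred trivialization around `b`. -/
def lineFrame (L : B → Type*) [∀ x, AddCommGroup (L x)] [∀ x, Module ℝ (L x)]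
    [∀ x, TopologicalSpace (L x)] [TopologicalSpace (TotalSpace ℝ L)]
    [FiberBundle ℝ L] [VectorBundle ℝ ℝ L] (b x : B) : L x :=
  (trivializationAt ℝ L b).symm x 1

/-- The coordinate with respect to `lineFrame`. -/
def lineCoord (L : B → Type*) [∀ x, AddCommGroup (L x)] [∀ x, Module ℝ (L x)]
    [∀ x, TopologicalSpace (L x)] [TopologicalSpace (TotalSpace ℝ L)]
    [FiberBundle ℝ L] [VectorBundle ℝ ℝ L] (b x : B) : L x →ₗ[ℝ] ℝ :=
  (trivializationAt ℝ L b).linearMapAt ℝ x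

section

variable (L : B → Type*) [∀ x, AddCommGroup (L x)] [∀ x, Module ℝ (L x)]
    [∀ x, TopologicalSpace (L x)] [TopologicalSpace (TotalSpace ℝ L)]
    [FiberBundle ℝ L] [VectorBundle ℝ ℝ L]

lemma lineCoord_lineFrame' (b b' x : B) (hx : x ∈ (trivializationAt ℝ L b).baseSet)
    (hx' : x ∈ (trivializationAt ℝ L b').baseSet) :
    lineCoord L b' x (lineFrame L b x) =
      ((trivializationAt ℝ L b).coordChangeL ℝ (trivializationAt ℝ L b') x : ℝ →L[ℝ] ℝ) 1 := by
  rw [ContinuousLinearEquiv.coe_coe, Trivialization.coordChangeL_apply _ _ ⟨hx, hx'⟩]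
  unfold lineCoord lineFrame
  rw [Trivialization.coe_linearMapAt_of_mem _ hx']

lemma lineCoord_lineFrame (b x : B) (hx : x ∈ (trivializationAt ℝ L b).baseSet) :
    lineCoord L b x (lineFrame L b x) = 1 := by
  unfold lineCoord lineFrame
  rw [Trivialization.coe_linearMapAt_of_mem _ hx]
  simp [hx]

lemma lineCoord_smul_lineFrame (b x : B) (hx : x ∈ (trivializationAt ℝ L b).baseSet) (v : L x) :
    lineCoord L b x v • lineFrame L b x = v := by
  unfold lineCoord lineFrame
  rw [← Trivialization.symmₗ_apply (R := ℝ) _ hx, ← map_smul, smul_eq_mul, mul_one,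
    Trivialization.symmₗ_linearMapAt _ hx]

end

/-- The coordinate on `L₁ ⊗ L₂` with respect to the tensor product of local frames. -/
def TensorBundle.coord (b x : B) : TensorBundle L₁ L₂ x →ₗ[ℝ] ℝ :=
  LinearMap.mul' ℝ ℝ ∘ₗ TensorProduct.map (lineCoord L₁ b x) (lineCoord L₂ b x)

lemma TensorBundle.coord_tmul (b x : B) (u : L₁ x) (v : L₂ x) :
    TensorBundle.coord L₁ L₂ b x (TensorBundle.tmul u v) =
      lineCoord L₁ b x u * lineCoord L₂ b x v := rfl

/-- The defining local frames of the line bundle `L₁ ⊗ L₂`. -/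
def TensorBundle.lineFrames : LineFrames B (TensorBundle L₁ L₂) where
  U b := (trivializationAt ℝ L₁ b).baseSet ∩ (trivializationAt ℝ L₂ b).baseSet
  isOpen_U b := (trivializationAt ℝ L₁ b).open_baseSet.inter (trivializationAt ℝ L₂ b).open_baseSet
  mem_U b := ⟨FiberBundle.mem_baseSet_trivializationAt ℝ L₁ b,
    FiberBundle.mem_baseSet_trivializationAt ℝ L₂ b⟩
  coord := TensorBundle.coord L₁ L₂
  frame b x := TensorBundle.tmul (lineFrame L₁ b x) (lineFrame L₂ b x)
  coord_frame b x hx := by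
    rw [TensorBundle.coord_tmul, lineCoord_lineFrame L₁ b x hx.1, lineCoord_lineFrame L₂ b x hx.2,
      mul_one]
  coord_smul_frame b x hx v := by
    induction v using TensorProduct.induction_on with
    | zero => exact (congrArg (· • _) (map_zero (TensorBundle.coord L₁ L₂ b x))).trans (zero_smul ℝ _)
    | tmul u w =>
      change (lineCoord L₁ b x u * lineCoord L₂ b x w) •
        (lineFrame L₁ b x ⊗ₜ[ℝ] lineFrame L₂ b x) = u ⊗ₜ[ℝ] w
      rw [← TensorProduct.smul_tmul_smul, lineCoord_smul_lineFrame L₁ b x hx.1,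
        lineCoord_smul_lineFrame L₂ b x hx.2]
    | add y z hy hz =>
      refine (congrArg (· • _) (map_add (TensorBundle.coord L₁ L₂ b x) y z)).trans ?_
      refine (add_smul _ _ _).trans ?_
      exact congrArg₂ (· + ·) hy hz
  continuousOn b b' := by
    have h₁ : ContinuousOn (fun x => lineCoord L₁ b' x (lineFrame L₁ b x))
        ((trivializationAt ℝ L₁ b).baseSet ∩ (trivializationAt ℝ L₁ b').baseSet) := by
      refine ContinuousOn.congr ?_ fun x hx => lineCoord_lineFrame' L₁ b b' x hx.1 hx.2
      exact (continuousOn_coordChange ℝ _ _).clm_apply continuousOn_const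
    have h₂ : ContinuousOn (fun x => lineCoord L₂ b' x (lineFrame L₂ b x))
        ((trivializationAt ℝ L₂ b).baseSet ∩ (trivializationAt ℝ L₂ b').baseSet) := by
      refine ContinuousOn.congr ?_ fun x hx => lineCoord_lineFrame' L₂ b b' x hx.1 hx.2
      exact (continuousOn_coordChange ℝ _ _).clm_apply continuousOn_const
    exact (h₁.mono fun x hx => ⟨hx.1.1, hx.2.1⟩).mul (h₂.mono fun x hx => ⟨hx.1.2, hx.2.2⟩)

instance : TopologicalSpace (TotalSpace ℝ (TensorBundle L₁ L₂)) :=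
  (TensorBundle.lineFrames L₁ L₂).prebundle.totalSpaceTopology
instance : FiberBundle ℝ (TensorBundle L₁ L₂) :=
  (TensorBundle.lineFrames L₁ L₂).prebundle.toFiberBundle
instance : VectorBundle ℝ ℝ (TensorBundle L₁ L₂) :=
  (TensorBundle.lineFrames L₁ L₂).prebundle.toVectorBundle

lemma contMDiffOn_lineCoord_lineFrame (L : B → Type*)
    [∀ x, AddCommGroup (L x)] [∀ x, Module ℝ (L x)]
    [∀ x, TopologicalSpace (L x)] [TopologicalSpace (TotalSpace ℝ L)]
    [FiberBundle ℝ L] [VectorBundle ℝ ℝ L]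
    {EB : Type*} [NormedAddCommGroup EB] [NormedSpace ℝ EB] [ChartedSpace EB B]
    [ContMDiffVectorBundle ∞ ℝ L 𝓘(ℝ, EB)] (b b' : B) :
    ContMDiffOn 𝓘(ℝ, EB) 𝓘(ℝ, ℝ) ∞ (fun x => lineCoord L b' x (lineFrame L b x))
      ((trivializationAt ℝ L b).baseSet ∩ (trivializationAt ℝ L b').baseSet) := by
  refine ContMDiffOn.congr ?_ fun x hx => lineCoord_lineFrame' L b b' x hx.1 hx.2
  exact (contMDiffOn_coordChangeL _ _).clm_apply contMDiffOn_const

instance {EB : Type*} [NormedAddCommGroup EB] [NormedSpace ℝ EB] [ChartedSpace EB B]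
    [ContMDiffVectorBundle ∞ ℝ L₁ 𝓘(ℝ, EB)] [ContMDiffVectorBundle ∞ ℝ L₂ 𝓘(ℝ, EB)] :
    ContMDiffVectorBundle ∞ ℝ (TensorBundle L₁ L₂) 𝓘(ℝ, EB) := by
  have : (TensorBundle.lineFrames L₁ L₂).prebundle.IsContMDiff 𝓘(ℝ, EB) ∞ := by
    refine LineFrames.prebundle_isContMDiff _ fun b b' => ?_
    exact ((contMDiffOn_lineCoord_lineFrame L₁ b b').mono fun x hx => ⟨hx.1.1, hx.2.1⟩).mul
      ((contMDiffOn_lineCoord_lineFrame L₂ b b').mono fun x hx => ⟨hx.1.2, hx.2.2⟩)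
  exact (TensorBundle.lineFrames L₁ L₂).prebundle.contMDiffVectorBundle 𝓘(ℝ, EB)

end Tensor

/-! ### Smooth sections, directional derivatives, the dual bundle -/

section Basics

variable {E : Type*} [NormedAddCommGroup E] [NormedSpace ℝ E]
  {M : Type*} [TopologicalSpace M] [ChartedSpace E M]

/-- The derivative `X f` of a function along a vector field. -/
def dirDeriv (X : ∀ x : M, TangentSpace 𝓘(ℝ, E) x) (f : M → ℝ) (x : M) : ℝ :=
  mvfderiv 𝓘(ℝ, E) f x (X x)

/-- The section `σ` is smooth on the set `U`. -/
def SmoothSectionOn (E : Type*) [NormedAddCommGroup E] [NormedSpace ℝ E] [ChartedSpace E M]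
    (F : Type*) [NormedAddCommGroup F] [NormedSpace ℝ F]
    {V : M → Type*} [TopologicalSpace (TotalSpace F V)] [∀ x, TopologicalSpace (V x)]
    [FiberBundle F V] (σ : ∀ x, V x) (U : Set M) : Prop :=
  ContMDiffOn 𝓘(ℝ, E) (𝓘(ℝ, E).prod 𝓘(ℝ, F)) ∞ (fun x => TotalSpace.mk' F x (σ x)) U

variable {F : Type*} [NormedAddCommGroup F] [NormedSpace ℝ F]
  {A : M → Type*} [TopologicalSpace (TotalSpace F A)] [∀ x, AddCommGroup (A x)]
  [∀ x, Module ℝ (A x)] [∀ x, TopologicalSpace (A x)] [FiberBundle F A] [VectorBundle ℝ F A]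

lemma mvfderiv_constMul (t : ℝ) {f : M → ℝ} {x : M}
    (hf : MDifferentiableAt 𝓘(ℝ, E) 𝓘(ℝ, ℝ) f x) :
    mvfderiv 𝓘(ℝ, E) (fun y => t * f y) x = t • mvfderiv 𝓘(ℝ, E) f x := by
  have h := mvfderiv_mul (I := 𝓘(ℝ, E)) (f := fun _ : M => t) (g := f) (x := x)
    mdifferentiableAt_const hf
  rw [mvfderiv_const, smul_zero, add_zero] at h
  exact h

/-- The product of a smooth function and a smooth section. -/
def smulSection (f : C^∞⟮𝓘(ℝ, E), M; 𝓘(ℝ, ℝ), ℝ⟯) (α : Cₛ^∞⟮𝓘(ℝ, E); F, A⟯) :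
    Cₛ^∞⟮𝓘(ℝ, E); F, A⟯ :=
  ⟨fun x => f x • α x, f.contMDiff.smul_section α.contMDiff⟩

/-- The dual bundle `A*`, with model fibre `F →L[ℝ] ℝ`. -/
abbrev DualBundle (A : M → Type*) [∀ x, AddCommGroup (A x)]
    [∀ x, Module ℝ (A x)] [∀ x, TopologicalSpace (A x)] : M → Type _ :=
  fun x => A x →L[ℝ] Bundle.Trivial M ℝ x

end Basics

/-! ### Lie algebroids and their first cohomology -/

section Algebroid

variable (E : Type*) [NormedAddCommGroup E] [NormedSpace ℝ E]
  {M : Type*} [TopologicalSpace M] [ChartedSpace E M] [IsManifold 𝓘(ℝ, E) ∞ M]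
  (F : Type*) [NormedAddCommGroup F] [NormedSpace ℝ F]
  (A : M → Type*) [TopologicalSpace (TotalSpace F A)] [∀ x, AddCommGroup (A x)]
  [∀ x, Module ℝ (A x)] [∀ x, TopologicalSpace (A x)] [FiberBundle F A] [VectorBundle ℝ F A]

/-- A Lie algebroid structure on the smooth vector bundle `A` over `M`: a smooth bundle map
`A → TM` and a real Lie bracket on `Γ(A)`, satisfying the Leibniz rule. -/
structure LieAlgebroid where
  anchor : Cₛ^∞⟮𝓘(ℝ, E); F →L[ℝ] E, fun x : M => A x →L[ℝ] TangentSpace 𝓘(ℝ, E) x⟯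
  bracket : Cₛ^∞⟮𝓘(ℝ, E); F, A⟯ → Cₛ^∞⟮𝓘(ℝ, E); F, A⟯ → Cₛ^∞⟮𝓘(ℝ, E); F, A⟯
  add_bracket : ∀ α β γ, bracket (α + β) γ = bracket α γ + bracket β γ
  smul_bracket : ∀ (t : ℝ) α β, bracket (t • α) β = t • bracket α β
  bracket_self : ∀ α, bracket α α = 0
  bracket_add : ∀ α β γ, bracket α (β + γ) = bracket α β + bracket α γ
  jacobi : ∀ α β γ,
    bracket α (bracket β γ) = bracket (bracket α β) γ + bracket β (bracket α γ)
  anchor_bracket : ∀ α β x, anchor x (bracket α β x) =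
    VectorField.mlieBracket 𝓘(ℝ, E) (fun y => anchor y (α y)) (fun y => anchor y (β y)) x
  leibniz : ∀ (f : C^∞⟮𝓘(ℝ, E), M; 𝓘(ℝ, ℝ), ℝ⟯) α β x,
    bracket α (smulSection f β) x =
      f x • bracket α β x + dirDeriv (fun y => anchor y (α y)) f x • β x

namespace LieAlgebroid

variable {E F A} (𝔸 : LieAlgebroid E F A)

/-- The vector field `ρ(α)`, where `ρ` is the anchor. -/
def rho (α : Cₛ^∞⟮𝓘(ℝ, E); F, A⟯) (x : M) : TangentSpace 𝓘(ℝ, E) x := 𝔸.anchor x (α x)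

/-- `A`-forms of degree one, i.e. smooth sections of `A*`. -/
abbrev Form1 (_ : LieAlgebroid E F A) : Type _ :=
  Cₛ^∞⟮𝓘(ℝ, E); F →L[ℝ] ℝ, DualBundle A⟯

lemma mdifferentiableAt_pairing (c : 𝔸.Form1) (α : Cₛ^∞⟮𝓘(ℝ, E); F, A⟯) (x : M) :
    MDifferentiableAt 𝓘(ℝ, E) 𝓘(ℝ, ℝ) (fun y => (c y (α y) : ℝ)) x := by
  have h := ContMDiff.clm_bundle_apply (b := fun y : M => y) (ϕ := fun y => c y)
    (v := fun y => α y) c.contMDiff α.contMDiff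
  have h2 : ContMDiff 𝓘(ℝ, E) 𝓘(ℝ, ℝ) ∞ (fun y => (c y (α y) : ℝ)) := by
    intro y
    exact ((contMDiffAt_section y).1 (h y))
  exact (h2 x).mdifferentiableAt (by simp)

/-- The closed one-forms: `ρ(α)(c(β)) - ρ(β)(c(α)) - c([α, β]) = 0`. -/
def closedForms : Submodule ℝ 𝔸.Form1 where
  carrier := {c | ∀ (α β : Cₛ^∞⟮𝓘(ℝ, E); F, A⟯) (x : M),
    dirDeriv (𝔸.rho α) (fun y => (c y (β y) : ℝ)) x
      - dirDeriv (𝔸.rho β) (fun y => (c y (α y) : ℝ)) x - c x (𝔸.bracket α β x) = 0}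
  add_mem' := by
    intro c d hc hd α β x
    have key : ∀ (γ δ : Cₛ^∞⟮𝓘(ℝ, E); F, A⟯),
        dirDeriv (𝔸.rho γ) (fun y => ((c + d) y (δ y) : ℝ)) x =
        dirDeriv (𝔸.rho γ) (fun y => (c y (δ y) : ℝ)) x +
        dirDeriv (𝔸.rho γ) (fun y => (d y (δ y) : ℝ)) x := by
      intro γ δ
      have := mvfderiv_add (𝔸.mdifferentiableAt_pairing c δ x)
        (𝔸.mdifferentiableAt_pairing d δ x)
      exact DFunLike.congr_fun this (𝔸.rho γ x)
    have e : ((c + d) x (𝔸.bracket α β x) : ℝ) = c x (𝔸.bracket α β x) + d x (𝔸.bracket α β x) :=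
      rfl
    have h1 := hc α β x
    have h2 := hd α β x
    rw [key, key]
    linarith
  zero_mem' := by
    intro α β x
    have key : ∀ (γ δ : Cₛ^∞⟮𝓘(ℝ, E); F, A⟯),
        dirDeriv (𝔸.rho γ) (fun y => ((0 : 𝔸.Form1) y (δ y) : ℝ)) x = 0 := by
      intro γ δ
      exact DFunLike.congr_fun (mvfderiv_const (I := 𝓘(ℝ, E)) (0 : ℝ) (x := x)) (𝔸.rho γ x)
    have e : ((0 : 𝔸.Form1) x (𝔸.bracket α β x) : ℝ) = 0 := rfl
    rw [key, key]
    linarith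
  smul_mem' := by
    intro t c hc α β x
    have key : ∀ (γ δ : Cₛ^∞⟮𝓘(ℝ, E); F, A⟯),
        dirDeriv (𝔸.rho γ) (fun y => ((t • c) y (δ y) : ℝ)) x =
        t * dirDeriv (𝔸.rho γ) (fun y => (c y (δ y) : ℝ)) x := by
      intro γ δ
      have := mvfderiv_constMul t (𝔸.mdifferentiableAt_pairing c δ x)
      exact DFunLike.congr_fun this (𝔸.rho γ x)
    have e : ((t • c) x (𝔸.bracket α β x) : ℝ) = t * c x (𝔸.bracket α β x) := rfl
    have h1 := hc α β x
    rw [key, key]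
    rw [e]
    linear_combination t * h1

/-- The exact one-forms `d_A f`, where `(d_A f)(α) = ρ(α)(f)`. -/
def exactForms : Submodule ℝ 𝔸.Form1 where
  carrier := {c | ∃ f : C^∞⟮𝓘(ℝ, E), M; 𝓘(ℝ, ℝ), ℝ⟯, ∀ (x : M) (v : A x),
    c x v = mvfderiv 𝓘(ℝ, E) f x (𝔸.anchor x v)}
  add_mem' := by
    rintro c d ⟨f, hf⟩ ⟨g, hg⟩
    refine ⟨f + g, fun x v => ?_⟩
    have := mvfderiv_add ((f.contMDiff x).mdifferentiableAt (by simp))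
      ((g.contMDiff x).mdifferentiableAt (by simp))
    refine Eq.trans ?_ (DFunLike.congr_fun this (𝔸.anchor x v)).symm
    exact congrArg₂ (· + ·) (hf x v) (hg x v)
  zero_mem' := by
    refine ⟨0, fun x v => ?_⟩
    exact (DFunLike.congr_fun (mvfderiv_const (I := 𝓘(ℝ, E)) (0 : ℝ) (x := x))
      (𝔸.anchor x v)).symm
  smul_mem' := by
    rintro t c ⟨f, hf⟩
    refine ⟨t • f, fun x v => ?_⟩
    have := mvfderiv_constMul t ((f.contMDiff x).mdifferentiableAt (by simp))
    refine Eq.trans ?_ (DFunLike.congr_fun this (𝔸.anchor x v)).symm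
    exact congrArg (t * ·) (hf x v)

/-- The Lie algebroid cohomology `H¹(A)`. -/
abbrev H1 : Type _ := 𝔸.closedForms ⧸ 𝔸.exactForms.submoduleOf 𝔸.closedForms

/-! ### Representations on line bundles and their characteristic classes -/

section Rep

variable (L : M → Type*) [∀ x, AddCommGroup (L x)] [∀ x, Module ℝ (L x)]
  [∀ x, TopologicalSpace (L x)] [TopologicalSpace (TotalSpace ℝ L)]
  [FiberBundle ℝ L] [VectorBundle ℝ ℝ L]

/-- An infinitesimal operation `(α, σ) ↦ ∇_α σ` of `Γ(A)` on sections of `L`. To be able to apply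
it to local sections, it is given on arbitrary functions `σ`; only its values at points near which
`σ` is smooth are meaningful. -/
abbrev Operation (_ : LieAlgebroid E F A) : Type _ :=
  Cₛ^∞⟮𝓘(ℝ, E); F, A⟯ → (∀ x, L x) → ∀ x, L x

variable {L}

/-- The operation `∇` is a representation of `A` on `L`, i.e. a flat `A`-connection. -/
structure IsRepresentation (nabla : 𝔸.Operation L) : Prop where
  smooth : ∀ α σ (U : Set M), IsOpen U → SmoothSectionOn E ℝ σ U →
    SmoothSectionOn E ℝ (nabla α σ) U
  add_left : ∀ α β σ (U : Set M), IsOpen U → SmoothSectionOn E ℝ σ U →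
    ∀ x ∈ U, nabla (α + β) σ x = nabla α σ x + nabla β σ x
  smul_left : ∀ (f : C^∞⟮𝓘(ℝ, E), M; 𝓘(ℝ, ℝ), ℝ⟯) α σ (U : Set M), IsOpen U →
    SmoothSectionOn E ℝ σ U → ∀ x ∈ U, nabla (smulSection f α) σ x = f x • nabla α σ x
  add_right : ∀ α σ τ (U : Set M), IsOpen U → SmoothSectionOn E ℝ σ U →
    SmoothSectionOn E ℝ τ U → ∀ x ∈ U, nabla α (σ + τ) x = nabla α σ x + nabla α τ x
  leibniz : ∀ α σ (f : M → ℝ) (U : Set M), IsOpen U → SmoothSectionOn E ℝ σ U →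
    ContMDiffOn 𝓘(ℝ, E) 𝓘(ℝ, ℝ) ∞ f U → ∀ x ∈ U,
      nabla α (fun y => f y • σ y) x = f x • nabla α σ x + dirDeriv (𝔸.rho α) f x • σ x
  flat : ∀ α β σ (U : Set M), IsOpen U → SmoothSectionOn E ℝ σ U → ∀ x ∈ U,
    nabla (𝔸.bracket α β) σ x = nabla α (nabla β σ) x - nabla β (nabla α σ) x

/-- `c` is the connection form of the section `σ`: `∇_α σ = c(α) σ` for all `α`. -/
def IsConnectionForm (nabla : 𝔸.Operation L) (σ : Cₛ^∞⟮𝓘(ℝ, E); ℝ, L⟯) (c : 𝔸.Form1) : Prop :=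
  ∀ (α : Cₛ^∞⟮𝓘(ℝ, E); F, A⟯) (x : M), nabla α σ x = (c x (α x) : ℝ) • σ x

/-- `L` is trivializable and, for every nowhere vanishing section `σ` of `L`, the form `c_σ` with
`∇_α σ = c_σ(α) σ` exists, is closed, and has class `θ`. -/
def IsTrivializedClass (nabla : 𝔸.Operation L) (θ : 𝔸.H1) : Prop :=
  (∃ σ : Cₛ^∞⟮𝓘(ℝ, E); ℝ, L⟯, ∀ x, σ x ≠ 0) ∧
  ∀ σ : Cₛ^∞⟮𝓘(ℝ, E); ℝ, L⟯, (∀ x, σ x ≠ 0) →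
    (∃ c : 𝔸.closedForms, 𝔸.IsConnectionForm nabla σ c) ∧
    ∀ c : 𝔸.closedForms, 𝔸.IsConnectionForm nabla σ c → Submodule.Quotient.mk c = θ

end Rep

section TensorRep

variable {L₁ L₂ : M → Type*}
  [∀ x, AddCommGroup (L₁ x)] [∀ x, Module ℝ (L₁ x)]
  [∀ x, AddCommGroup (L₂ x)] [∀ x, Module ℝ (L₂ x)]
  [∀ x, TopologicalSpace (L₁ x)] [TopologicalSpace (TotalSpace ℝ L₁)]
  [FiberBundle ℝ L₁] [VectorBundle ℝ ℝ L₁]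
  [∀ x, TopologicalSpace (L₂ x)] [TopologicalSpace (TotalSpace ℝ L₂)]
  [FiberBundle ℝ L₂] [VectorBundle ℝ ℝ L₂]

/-- The operation `D_α ⊗ 1 + 1 ⊗ D'_α` on `L₁ ⊗ L₂`: if `ζ = f s₁ ⊗ s₂` near `x` for the preferred
local frames `s₁`, `s₂` around `x`, then its value on `ζ` at `x` is
`ρ(α)(f) s₁ ⊗ s₂ + f (D_α s₁ ⊗ s₂ + s₁ ⊗ D'_α s₂)`. -/
def tensorOp (D : 𝔸.Operation L₁) (D' : 𝔸.Operation L₂) : 𝔸.Operation (TensorBundle L₁ L₂) :=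
  fun α ζ x =>
    dirDeriv (𝔸.rho α) (fun y => TensorBundle.coord L₁ L₂ x y (ζ y)) x •
        TensorBundle.tmul (lineFrame L₁ x x) (lineFrame L₂ x x) +
      TensorBundle.coord L₁ L₂ x x (ζ x) •
        (TensorBundle.tmul (D α (lineFrame L₁ x) x) (lineFrame L₂ x x) +
          TensorBundle.tmul (lineFrame L₁ x x) (D' α (lineFrame L₂ x) x))

end TensorRep

section CharClass

variable {L : M → Type*} [∀ x, AddCommGroup (L x)] [∀ x, Module ℝ (L x)]
  [∀ x, TopologicalSpace (L x)] [TopologicalSpace (TotalSpace ℝ L)]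
  [FiberBundle ℝ L] [VectorBundle ℝ ℝ L]

/-- `θ` is the characteristic class of the representation `∇` on `L`: half of the class of the
(trivializable) representation on `L ⊗ L`. -/
def IsCharClass (nabla : 𝔸.Operation L) (θ : 𝔸.H1) : Prop :=
  ∃ θ' : 𝔸.H1, 𝔸.IsTrivializedClass (𝔸.tensorOp nabla nabla) θ' ∧ θ = (1 / 2 : ℝ) • θ'

lemma IsCharClass.unique {nabla : 𝔸.Operation L} {θ₁ θ₂ : 𝔸.H1}
    (h₁ : 𝔸.IsCharClass nabla θ₁) (h₂ : 𝔸.IsCharClass nabla θ₂) : θ₁ = θ₂ := by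
  obtain ⟨η₁, ⟨⟨σ, hσ⟩, k₁⟩, rfl⟩ := h₁
  obtain ⟨η₂, ⟨-, k₂⟩, rfl⟩ := h₂
  obtain ⟨⟨c, hc⟩, hc₁⟩ := k₁ σ hσ
  rw [← hc₁ c hc, ← (k₂ σ hσ).2 c hc]

open Classical in
/-- The characteristic class `θ_A(L)` of a representation of `A` on `L`: the unique `θ` with
`IsCharClass`, and `0` if there is none. -/
def charClass (nabla : 𝔸.Operation L) : 𝔸.H1 :=
  if h : ∃ θ, 𝔸.IsCharClass nabla θ then h.choose else 0

lemma IsCharClass.charClass_eq {nabla : 𝔸.Operation L} {θ : 𝔸.H1}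
    (h : 𝔸.IsCharClass nabla θ) : 𝔸.charClass nabla = θ := by
  have h' : ∃ θ, 𝔸.IsCharClass nabla θ := ⟨θ, h⟩
  unfold charClass
  rw [dif_pos h']
  exact IsCharClass.unique 𝔸 h'.choose_spec h

end CharClass

/-! ### Lie derivatives on the associated line bundles -/

open Classical in
/-- The bracket `[α, s]` with a local section `s`: its value at `x` is `[α, β](x)` for any global
section `β` that agrees with `s` near `x`. -/
def localBracket (α : Cₛ^∞⟮𝓘(ℝ, E); F, A⟯) (s : ∀ x, A x) (x : M) : A x :=
  if h : ∃ β : Cₛ^∞⟮𝓘(ℝ, E); F, A⟯, ∀ᶠ y in 𝓝 x, β y = s y then 𝔸.bracket α h.choose x else 0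

variable [FiniteDimensional ℝ F]

/-- The Lie derivative on sections of `A*`, `(L_α φ)(s) = ρ(α)(φ(s)) - φ([α, s])`, computed at `x`
by letting `s` run through a local frame of `A` around `x`. -/
def lieDual (α : Cₛ^∞⟮𝓘(ℝ, E); F, A⟯) (φ : ∀ x, DualBundle A x) (x : M) : DualBundle A x :=
  ∑ i, (dirDeriv (𝔸.rho α)
        (fun y => (φ y ((trivializationAt F A x).localFrame (Module.finBasis ℝ F) i y) : ℝ)) x
      - (φ x (𝔸.localBracket α
          ((trivializationAt F A x).localFrame (Module.finBasis ℝ F) i) x) : ℝ)) •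
    ((Module.finBasis ℝ F).coord i).toContinuousLinearMap.comp
      ((trivializationAt F A x).continuousLinearMapAt ℝ x)

end LieAlgebroid

/-- The operator on sections of `L_δ(V)`, `δ = χ ∘ det`, induced by an operator `D` on sections of
`V` with `D (f s) = X(f) s + f D s`. If `e` is a local frame of `V` and `D e = e a`, then
`(L ξ)(e) = X(ξ(e)) - (dδ)₁(a) ξ(e)`, where `(dδ)₁(a) = χ'(1) tr a`; at `x` this is used for the
frame given by the preferred trivialization of `V` around `x`. -/
def lieAssoc {E : Type*} [NormedAddCommGroup E] [NormedSpace ℝ E]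
    {M : Type*} [TopologicalSpace M] [ChartedSpace E M] (χ : SmoothCharacter)
    {F : Type*} [NormedAddCommGroup F] [NormedSpace ℝ F] [FiniteDimensional ℝ F]
    {V : M → Type*} [TopologicalSpace (TotalSpace F V)] [∀ x, AddCommGroup (V x)]
    [∀ x, Module ℝ (V x)] [∀ x, TopologicalSpace (V x)] [FiberBundle F V] [VectorBundle ℝ F V]
    (X : ∀ x : M, TangentSpace 𝓘(ℝ, E) x) (D : (∀ x, V x) → ∀ x, V x)
    (ξ : ∀ x, AssocBundle χ F V x) (x : M) : AssocBundle χ F V x :=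
  (dirDeriv X (fun y => AssocBundle.coord χ F V x y (ξ y)) x
    - χ.weight *
      (∑ i, (Module.finBasis ℝ F).coord i ((trivializationAt F V x).linearMapAt ℝ x
        (D ((trivializationAt F V x).localFrame (Module.finBasis ℝ F) i) x))) *
      AssocBundle.coord χ F V x x (ξ x)) • AssocBundle.frame χ F V x x

namespace LieAlgebroid

variable {E F A} [FiniteDimensional ℝ E] [FiniteDimensional ℝ F] (𝔸 : LieAlgebroid E F A)

/-- The line bundle `L_δ(A*) ⊗ L_δ'(TM)`, where `δ = χ ∘ det` and `δ' = χ' ∘ det`. -/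
abbrev TransverseBundle (_ : LieAlgebroid E F A) (χ χ' : SmoothCharacter) : M → Type _ :=
  TensorBundle (AssocBundle χ (F →L[ℝ] ℝ) (DualBundle A))
    (AssocBundle χ' E (fun x : M => TangentSpace 𝓘(ℝ, E) x))

/-- The operation `∇_α (ω ⊗ μ) = L_α ω ⊗ μ + ω ⊗ L_{ρ(α)} μ` of `A` on `L_δ(A*) ⊗ L_δ'(TM)`. -/
def transverseOp (χ χ' : SmoothCharacter) : 𝔸.Operation (𝔸.TransverseBundle χ χ') :=
  𝔸.tensorOp (fun α => lieAssoc χ (𝔸.rho α) (𝔸.lieDual α))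
    (fun α => lieAssoc χ' (𝔸.rho α) (VectorField.mlieBracket 𝓘(ℝ, E) (𝔸.rho α)))

/-- The transverse density representation, on `D_{A*} ⊗ D_{TM}`. -/
def densOp : 𝔸.Operation (𝔸.TransverseBundle densChar densChar) :=
  𝔸.transverseOp densChar densChar

/-- The transverse volume representation, on `V_{A*} ⊗ V_{TM} = Λ^top A ⊗ Λ^top T*M`. -/
def volOp : 𝔸.Operation (𝔸.TransverseBundle volChar volChar) :=
  𝔸.transverseOp volChar volChar

/-- The canonical representation `Q_A`, on `V_{A*} ⊗ D_{TM} = Λ^top A ⊗ |Λ^top T*M|`. -/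
def canOp : 𝔸.Operation (𝔸.TransverseBundle volChar densChar) :=
  𝔸.transverseOp volChar densChar

/-- The modular class of `A`. -/
def modularClass : 𝔸.H1 := 𝔸.charClass 𝔸.densOp

end LieAlgebroid

end Algebroid

end

/-!
In the frame of a line bundle `L` around `b`, the operations considered here have the form
`ρ(α) + w_b(α)`. Such an operation is a representation as soon as every `w_b` is a closed
`A`-one-form, its square on `L ⊗ L` has local form `ρ(α) + 2 w_b(α)`, and the class of the square is
determined by the `w_b` and the squares of the transition functions of `L`, because `L ⊗ L` is
trivialized by a partition of unity.

If `D` is a derivation of sections of `V` over `X`, the operator that it induces on `L_δ(V)`,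
`δ = χ ∘ det`, has local form `X - χ'(1) tr D`, by Jacobi's formula for the derivative of a
determinant. For `V = A*` and `D = L_α` the trace is `-tr [α, ·]`. Both characters `χ(t) = t` and
`χ(t) = |t|` satisfy `χ(t)² = t²`, hence `χ'(1) = 1`: all three transverse bundles have the local
form `ρ(α) + tr [α, ·] - tr [ρ(α), ·]`. This form is `C^∞(M)`-linear in `α`, since the two traces
fail to be so by the same amount `ρ(α)(f)`, and closed, since each trace is a cocycle by the Jacobi
identity. The squares of the transition functions are products of squared determinants in all three
cases, so the classes agree.
-/

/-! ### Germs of smooth functions and sections -/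

section Germs

variable (E : Type*) [NormedAddCommGroup E] [NormedSpace ℝ E]
  {M : Type*} [TopologicalSpace M] [ChartedSpace E M]

/-- The function `f` is smooth on a neighbourhood of `x`. The quantifier `∀ᶠ` is needed: since `∞`
is not the largest differentiability exponent, `ContMDiffAt … ∞ f x` is not an open condition
in `x`. -/
def SmoothFnNear (f : M → ℝ) (x : M) : Prop :=
  ∀ᶠ y in 𝓝 x, ContMDiffAt 𝓘(ℝ, E) 𝓘(ℝ, ℝ) ∞ f y

variable (F : Type*) [NormedAddCommGroup F] [NormedSpace ℝ F]
  {V : M → Type*} [TopologicalSpace (TotalSpace F V)]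
  [∀ x, TopologicalSpace (V x)] [FiberBundle F V]

/-- The section `σ` of a fibre bundle is smooth on a neighbourhood of `x`. -/
def SmoothNear (σ : ∀ x, V x) (x : M) : Prop :=
  ∀ᶠ y in 𝓝 x, ContMDiffAt 𝓘(ℝ, E) (𝓘(ℝ, E).prod 𝓘(ℝ, F)) ∞ (fun z => TotalSpace.mk' F z (σ z)) y

variable {E F}

namespace SmoothFnNear

variable {f g : M → ℝ} {x : M}

lemma contMDiffAt (h : SmoothFnNear E f x) : ContMDiffAt 𝓘(ℝ, E) 𝓘(ℝ, ℝ) ∞ f x :=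
  h.self_of_nhds

lemma mdifferentiableAt (h : SmoothFnNear E f x) : MDifferentiableAt 𝓘(ℝ, E) 𝓘(ℝ, ℝ) f x :=
  h.contMDiffAt.mdifferentiableAt (by simp)

lemma of_contMDiff (h : ContMDiff 𝓘(ℝ, E) 𝓘(ℝ, ℝ) ∞ f) : SmoothFnNear E f x :=
  Eventually.of_forall h

lemma of_contMDiffOn {U : Set M} (hU : IsOpen U) (h : ContMDiffOn 𝓘(ℝ, E) 𝓘(ℝ, ℝ) ∞ f U)
    (hx : x ∈ U) : SmoothFnNear E f x := by
  filter_upwards [hU.mem_nhds hx] with y hy using h.contMDiffAt (hU.mem_nhds hy)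

lemma const (c : ℝ) : SmoothFnNear E (fun _ : M => c) x := of_contMDiff contMDiff_const

lemma congr (h : SmoothFnNear E f x) (hfg : g =ᶠ[𝓝 x] f) : SmoothFnNear E g x := by
  filter_upwards [h, hfg.eventuallyEq_nhds] with y hy hy' using hy.congr_of_eventuallyEq hy'

lemma add (hf : SmoothFnNear E f x) (hg : SmoothFnNear E g x) :
    SmoothFnNear E (fun y => f y + g y) x := by
  filter_upwards [hf, hg] with y h h' using h.add h'

lemma sub (hf : SmoothFnNear E f x) (hg : SmoothFnNear E g x) :
    SmoothFnNear E (fun y => f y - g y) x := by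
  filter_upwards [hf, hg] with y h h' using h.sub h'

lemma mul (hf : SmoothFnNear E f x) (hg : SmoothFnNear E g x) :
    SmoothFnNear E (fun y => f y * g y) x := by
  filter_upwards [hf, hg] with y h h' using h.mul h'

lemma sum {ι : Type*} (s : Finset ι) {f : ι → M → ℝ} (hf : ∀ i ∈ s, SmoothFnNear E (f i) x) :
    SmoothFnNear E (fun y => ∑ i ∈ s, f i y) x := by
  filter_upwards [(Finset.eventually_all s).2 hf] with y hy using contMDiffAt_finsetSum hy

lemma prod {ι : Type*} (s : Finset ι) {f : ι → M → ℝ} (hf : ∀ i ∈ s, SmoothFnNear E (f i) x) :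
    SmoothFnNear E (fun y => ∏ i ∈ s, f i y) x := by
  filter_upwards [(Finset.eventually_all s).2 hf] with y hy using contMDiffAt_finsetProd hy

lemma comp_of_contDiffOn {φ : ℝ → ℝ} {s : Set ℝ} (hs : IsOpen s) (hφ : ContDiffOn ℝ ∞ φ s)
    (hf : SmoothFnNear E f x) (hx : f x ∈ s) : SmoothFnNear E (fun y => φ (f y)) x := by
  filter_upwards [hf, hf.contMDiffAt.continuousAt.preimage_mem_nhds (hs.mem_nhds hx)] with y h h'
  exact (hφ.contDiffAt (hs.mem_nhds h')).contMDiffAt.comp y h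

lemma inv (hf : SmoothFnNear E f x) (hx : f x ≠ 0) : SmoothFnNear E (fun y => (f y)⁻¹) x :=
  hf.comp_of_contDiffOn (φ := fun t => t⁻¹) isOpen_compl_singleton
    (fun _ ht => (contDiffAt_inv ℝ ht).contDiffWithinAt) hx

end SmoothFnNear

namespace SmoothNear

variable {σ τ : ∀ x, V x} {f : M → ℝ} {x : M}

lemma contMDiffAt (h : SmoothNear E F σ x) : ContMDiffAt 𝓘(ℝ, E) (𝓘(ℝ, E).prod 𝓘(ℝ, F)) ∞
    (fun z => TotalSpace.mk' F z (σ z)) x :=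
  h.self_of_nhds

lemma of_smoothSectionOn {U : Set M} (hU : IsOpen U) (h : SmoothSectionOn E F σ U) (hx : x ∈ U) :
    SmoothNear E F σ x := by
  filter_upwards [hU.mem_nhds hx] with y hy using ContMDiffOn.contMDiffAt h (hU.mem_nhds hy)

lemma of_section (s : Cₛ^∞⟮𝓘(ℝ, E); F, V⟯) : SmoothNear E F s x :=
  Eventually.of_forall s.contMDiff

lemma congr (h : SmoothNear E F σ x) (hτ : ∀ᶠ y in 𝓝 x, τ y = σ y) : SmoothNear E F τ x := by
  filter_upwards [h, hτ.eventually_nhds] with y hy hy'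
  refine hy.congr_of_eventuallyEq ?_
  filter_upwards [hy'] with z hz using by rw [hz]

variable [∀ x, AddCommGroup (V x)] [∀ x, Module ℝ (V x)] [VectorBundle ℝ F V]

lemma add (hσ : SmoothNear E F σ x) (hτ : SmoothNear E F τ x) : SmoothNear E F (σ + τ) x := by
  filter_upwards [hσ, hτ] with y h h' using h.add_section h'

lemma smul (hf : SmoothFnNear E f x) (hσ : SmoothNear E F σ x) :
    SmoothNear E F (fun y => f y • σ y) x := by
  filter_upwards [hf, hσ] with y h h' using h.smul_section h'

lemma zero : SmoothNear E F (fun y => (0 : V y)) x :=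
  Eventually.of_forall fun y => contMDiff_zeroSection ℝ V y

lemma sum {ι : Type*} (s : Finset ι) {σ : ι → ∀ x, V x} (h : ∀ i ∈ s, SmoothNear E F (σ i) x) :
    SmoothNear E F (fun y => ∑ i ∈ s, σ i y) x := by
  filter_upwards [(Finset.eventually_all s).2 h] with y hy using ContMDiffAt.sum_section hy

end SmoothNear

lemma smoothSectionOn_of_smoothNear {σ : ∀ x, V x} {U : Set M} (h : ∀ x ∈ U, SmoothNear E F σ x) :
    SmoothSectionOn E F σ U :=
  fun x hx => (h x hx).contMDiffAt.contMDiffWithinAt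

end Germs

/-! ### Directional derivatives -/

section DirDeriv

variable {E : Type*} [NormedAddCommGroup E] [NormedSpace ℝ E]
  {M : Type*} [TopologicalSpace M] [ChartedSpace E M]
  {X : ∀ x : M, TangentSpace 𝓘(ℝ, E) x} {f g : M → ℝ} {x : M}

lemma dirDeriv_congr (h : f =ᶠ[𝓝 x] g) : dirDeriv X f x = dirDeriv X g x := by
  unfold dirDeriv
  rw [mvfderiv, mvfderiv, h.mfderiv_eq, h.self_of_nhds]

lemma dirDeriv_const (c : ℝ) : dirDeriv X (fun _ => c) x = 0 :=
  DFunLike.congr_fun (mvfderiv_const (I := 𝓘(ℝ, E)) c (x := x)) (X x)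

lemma dirDeriv_add (hf : SmoothFnNear E f x) (hg : SmoothFnNear E g x) :
    dirDeriv X (fun y => f y + g y) x = dirDeriv X f x + dirDeriv X g x :=
  DFunLike.congr_fun (mvfderiv_add hf.mdifferentiableAt hg.mdifferentiableAt) (X x)

lemma dirDeriv_sub (hf : SmoothFnNear E f x) (hg : SmoothFnNear E g x) :
    dirDeriv X (fun y => f y - g y) x = dirDeriv X f x - dirDeriv X g x :=
  DFunLike.congr_fun (mvfderiv_sub hf.mdifferentiableAt hg.mdifferentiableAt) (X x)

lemma dirDeriv_mul (hf : SmoothFnNear E f x) (hg : SmoothFnNear E g x) :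
    dirDeriv X (fun y => f y * g y) x = f x * dirDeriv X g x + g x * dirDeriv X f x :=
  DFunLike.congr_fun (mvfderiv_mul hf.mdifferentiableAt hg.mdifferentiableAt) (X x)

lemma dirDeriv_sum {ι : Type*} (s : Finset ι) {f : ι → M → ℝ}
    (hf : ∀ i ∈ s, SmoothFnNear E (f i) x) :
    dirDeriv X (fun y => ∑ i ∈ s, f i y) x = ∑ i ∈ s, dirDeriv X (f i) x := by
  classical
  induction s using Finset.induction_on with
  | empty => simpa using dirDeriv_const 0
  | insert a s ha ih =>
    simp only [Finset.sum_insert ha]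
    rw [dirDeriv_add (hf a (by simp)) (.sum s fun i hi => hf i (by simp [hi])),
      ih fun i hi => hf i (by simp [hi])]

lemma dirDeriv_prod {ι : Type*} [DecidableEq ι] (s : Finset ι) {f : ι → M → ℝ}
    (hf : ∀ i ∈ s, SmoothFnNear E (f i) x) :
    dirDeriv X (fun y => ∏ i ∈ s, f i y) x =
      ∑ i ∈ s, dirDeriv X (f i) x * ∏ j ∈ s.erase i, f j x := by
  induction s using Finset.induction_on with
  | empty => simpa using dirDeriv_const 1
  | insert a s ha ih =>
    simp only [Finset.prod_insert ha, Finset.sum_insert ha, Finset.erase_insert ha]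
    rw [dirDeriv_mul (hf a (by simp)) (.prod s fun i hi => hf i (by simp [hi])),
      ih fun i hi => hf i (by simp [hi]), Finset.mul_sum, add_comm, mul_comm]
    congr 1
    refine Finset.sum_congr rfl fun i hi => ?_
    have hia : i ≠ a := fun h => ha (h ▸ hi)
    rw [Finset.erase_insert_of_ne hia.symm, Finset.prod_insert (by simp [ha])]
    ring

lemma dirDeriv_comp {φ : ℝ → ℝ} {φ' : ℝ} (hf : SmoothFnNear E f x) (hφ : HasDerivAt φ φ' (f x)) :
    dirDeriv X (fun y => φ (f y)) x = φ' * dirDeriv X f x := by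
  have h := mvfderiv_comp_apply (I := 𝓘(ℝ, ℝ)) (I' := 𝓘(ℝ, E)) (g := φ) (f := f) x
    hφ.differentiableAt.mdifferentiableAt hf.mdifferentiableAt (X x)
  refine h.trans ?_
  rw [mvfderiv, mfderiv_eq_fderiv, hφ.hasFDerivAt.fderiv]
  exact mul_comm _ _

lemma smoothFnNear_dirDeriv [IsManifold 𝓘(ℝ, E) ∞ M] (hf : SmoothFnNear E f x)
    (hX : SmoothNear E E X x) : SmoothFnNear E (dirDeriv X f) x := by
  filter_upwards [hf, hX] with y h h'
  have hdf := h.mfderiv_const (m := ∞) (by simp)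
  have hXf := ContMDiffAt.clm_apply_of_inCoordinates (b₁ := fun z : M => z) (b₂ := f)
    (E₁ := fun z : M => TangentSpace 𝓘(ℝ, E) z) (E₂ := fun t : ℝ => TangentSpace 𝓘(ℝ, ℝ) t)
    (ϕ := fun z => mfderiv 𝓘(ℝ, E) 𝓘(ℝ, ℝ) f z) hdf h' h
  exact (contMDiff_snd_tangentBundle_modelSpace ℝ 𝓘(ℝ, ℝ)).contMDiffAt.comp y hXf

end DirDeriv

/-! ### Matrices of functions and Jacobi's formula -/

section Jacobi

variable {E : Type*} [NormedAddCommGroup E] [NormedSpace ℝ E]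
  {M : Type*} [TopologicalSpace M] [ChartedSpace E M]
  {X : ∀ x : M, TangentSpace 𝓘(ℝ, E) x} {m n : Type*} {x : M}

/-- The entrywise derivative of a matrix of functions along a vector field. -/
noncomputable def dirDerivMatrix (X : ∀ x : M, TangentSpace 𝓘(ℝ, E) x) (g : M → Matrix m n ℝ)
    (x : M) : Matrix m n ℝ :=
  .of fun i j => dirDeriv X (fun y => g y i j) x

variable [Fintype n] {g : M → Matrix n n ℝ}

lemma trace_dirDerivMatrix (hg : ∀ i j, SmoothFnNear E (fun y => g y i j) x) :
    (dirDerivMatrix X g x).trace = dirDeriv X (fun y => (g y).trace) x :=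
  (dirDeriv_sum _ fun i _ => hg i i).symm

variable [DecidableEq n]

lemma smoothFnNear_det (hg : ∀ i j, SmoothFnNear E (fun y => g y i j) x) :
    SmoothFnNear E (fun y => (g y).det) x := by
  simp only [Matrix.det_apply']
  exact .sum _ fun τ _ => .mul (.const _) (.prod _ fun i _ => hg _ _)

lemma dirDeriv_det (hg : ∀ i j, SmoothFnNear E (fun y => g y i j) x) :
    dirDeriv X (fun y => (g y).det) x = ((g x).adjugate * dirDerivMatrix X g x).trace := by
  have hprod (τ : Equiv.Perm n) : SmoothFnNear E (fun y => ∏ i, g y (τ i) i) x :=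
    .prod _ fun i _ => hg _ _
  have hsign (τ : Equiv.Perm n) :
      dirDeriv X (fun y => (τ.sign : ℤ) * ∏ i, g y (τ i) i) x =
        ∑ i, (τ.sign : ℤ) * ∏ j, (g x).updateCol i ((dirDerivMatrix X g x).col i) (τ j) j := by
    rw [dirDeriv_mul (.const _) (hprod τ), dirDeriv_const, mul_zero, add_zero,
      dirDeriv_prod _ fun i _ => hg _ _, Finset.mul_sum]
    refine Finset.sum_congr rfl fun i _ => ?_
    rw [← Finset.mul_prod_erase _ _ (Finset.mem_univ i), Matrix.updateCol_self]
    congr 2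
    exact Finset.prod_congr rfl fun j hj => (Matrix.updateCol_ne (Finset.ne_of_mem_erase hj)).symm
  have htrace (i : n) : ((g x).adjugate * dirDerivMatrix X g x) i i =
      ((g x).updateCol i ((dirDerivMatrix X g x).col i)).det := by
    rw [← Matrix.cramer_apply, Matrix.cramer_eq_adjugate_mulVec]
    rfl
  simp only [Matrix.trace, Matrix.diag_apply, htrace, Matrix.det_apply']
  rw [dirDeriv_sum _ fun τ _ => .mul (.const _) (hprod τ), Finset.sum_comm]
  exact Finset.sum_congr rfl fun τ _ => hsign τ

lemma dirDeriv_det_of_mul_eq_one (hg : ∀ i j, SmoothFnNear E (fun y => g y i j) x)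
    {h : Matrix n n ℝ} (hgh : h * g x = 1) :
    dirDeriv X (fun y => (g y).det) x = (g x).det * (h * dirDerivMatrix X g x).trace := by
  have hadj : (g x).adjugate = (g x).det • h := by
    rw [← one_mul (g x).adjugate, ← hgh, mul_assoc, Matrix.mul_adjugate, Matrix.mul_smul, mul_one]
  rw [dirDeriv_det hg, hadj, Matrix.smul_mul, Matrix.trace_smul, smul_eq_mul]

end Jacobi

/-! ### Local frames and coframes -/

section Frames

variable {M : Type*} [TopologicalSpace M]
  {F : Type*} [NormedAddCommGroup F] [NormedSpace ℝ F]
  {V : M → Type*} [TopologicalSpace (TotalSpace F V)]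
  [∀ x, AddCommGroup (V x)] [∀ x, Module ℝ (V x)]
  [∀ x, TopologicalSpace (V x)] [FiberBundle F V] [VectorBundle ℝ F V]
  (e : Trivialization F (π F V)) [MemTrivializationAtlas e]
  (e' : Trivialization F (π F V)) [MemTrivializationAtlas e']
  (e'' : Trivialization F (π F V)) [MemTrivializationAtlas e'']
  {ι ι' ι'' : Type*} (v : Basis ι ℝ F) (v' : Basis ι' ℝ F) (v'' : Basis ι'' ℝ F)

/-- The coframe dual to `e.localFrame v`. It agrees with `Trivialization.localFrameCoeff`, but does
not depend on a model with corners for the base. -/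
noncomputable def localCoframe (i : ι) (x : M) : V x →ₗ[ℝ] ℝ :=
  v.coord i ∘ₗ e.linearMapAt ℝ x

/-- The matrix `g` with `s'_j = ∑ i, g i j • s_i` for two local frames `s`, `s'`. -/
noncomputable def transitionMatrix (x : M) : Matrix ι ι' ℝ :=
  .of fun i j => localCoframe e v i x (e'.localFrame v' j x)

variable {e e' e''} {x : M}

lemma localCoframe_of_mem (hx : x ∈ e.baseSet) (i : ι) :
    localCoframe e v i x = (e.basisAt v hx).coord i := by
  ext u
  simp [localCoframe, Trivialization.basisAt, Trivialization.coe_linearMapAt_of_mem e hx,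
    Trivialization.linearEquivAt_apply]

lemma localCoframe_localFrame [DecidableEq ι] (hx : x ∈ e.baseSet) (i j : ι) :
    localCoframe e v i x (e.localFrame v j x) = (1 : Matrix ι ι ℝ) i j := by
  rw [localCoframe_of_mem v hx, e.localFrame_apply_of_mem_baseSet v hx, Basis.coord_apply,
    Basis.repr_self, Finsupp.single_apply, Matrix.one_apply]
  simp only [eq_comm]

lemma sum_localCoframe_smul_localFrame [Fintype ι] (hx : x ∈ e.baseSet) (u : V x) :
    ∑ i, localCoframe e v i x u • e.localFrame v i x = u := by
  simp only [localCoframe_of_mem v hx, e.localFrame_apply_of_mem_baseSet v hx]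
  exact (e.basisAt v hx).sum_repr u

lemma transitionMatrix_self [DecidableEq ι] (hx : x ∈ e.baseSet) :
    transitionMatrix e e v v x = 1 := by
  ext i j
  exact localCoframe_localFrame v hx i j

lemma transitionMatrix_mul [Fintype ι'] (hx : x ∈ e'.baseSet) :
    transitionMatrix e e' v v' x * transitionMatrix e' e'' v' v'' x =
      transitionMatrix e e'' v v'' x := by
  ext i j
  have h := congrArg (localCoframe e v i x)
    (sum_localCoframe_smul_localFrame v' hx (e''.localFrame v'' j x))
  simpa [transitionMatrix, Matrix.mul_apply, mul_comm] using h

lemma transitionMatrix_mul_symm [DecidableEq ι] [Fintype ι'] (hx : x ∈ e.baseSet)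
    (hx' : x ∈ e'.baseSet) :
    transitionMatrix e e' v v' x * transitionMatrix e' e v' v x = 1 := by
  rw [transitionMatrix_mul v v' v hx', transitionMatrix_self v hx]

lemma transitionMatrix_of_mem (hx : x ∈ e.baseSet) :
    transitionMatrix e e v v' x = v.toMatrix v' := by
  ext i j
  simp [transitionMatrix, localCoframe_of_mem v hx, e.localFrame_apply_of_mem_baseSet v' hx,
    Trivialization.basisAt, Basis.toMatrix_apply, e.apply_mk_symm hx]

lemma det_transitionMatrix [Fintype ι] [DecidableEq ι] (hx : x ∈ e.baseSet)
    (hx' : x ∈ e'.baseSet) :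
    (transitionMatrix e e' v v x).det = (e'.coordChangeL ℝ e x : F →L[ℝ] F).det := by
  have hmatrix : transitionMatrix e e' v v x =
      LinearMap.toMatrix v v (e'.coordChangeL ℝ e x : F →L[ℝ] F).toLinearMap := by
    ext i j
    rw [LinearMap.toMatrix_apply, transitionMatrix, Matrix.of_apply, localCoframe,
      LinearMap.comp_apply, Trivialization.coe_linearMapAt_of_mem e hx,
      e'.localFrame_apply_of_mem_baseSet v hx']
    exact congrArg (v.coord i) (e'.coordChangeL_apply e ⟨hx', hx⟩ (v j)).symm
  rw [hmatrix, LinearMap.det_toMatrix]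

variable {E : Type*} [NormedAddCommGroup E] [NormedSpace ℝ E] [ChartedSpace E M]
  [ContMDiffVectorBundle ∞ F V 𝓘(ℝ, E)]

lemma smoothNear_localFrame (hx : x ∈ e.baseSet) (i : ι) :
    SmoothNear E F (e.localFrame v i) x :=
  .of_smoothSectionOn e.open_baseSet (e.contMDiffOn_localFrame_baseSet ∞ v i) hx

variable [FiniteDimensional ℝ F]

lemma SmoothNear.localCoframe {σ : ∀ x, V x} (h : SmoothNear E F σ x) (hx : x ∈ e.baseSet) (i : ι) :
    SmoothFnNear E (fun y => localCoframe e v i y (σ y)) x := by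
  filter_upwards [h, e.open_baseSet.mem_nhds hx] with y hy hye
  refine (((v.coord i).toContinuousLinearMap.contMDiff (n := ∞)).contMDiffAt.comp y
    ((e.contMDiffAt_section_iff hye).1 hy)).congr_of_eventuallyEq ?_
  filter_upwards [e.open_baseSet.mem_nhds hye] with z hz
  rw [_root_.localCoframe, LinearMap.comp_apply, Trivialization.coe_linearMapAt_of_mem _ hz]
  rfl

variable (E F) in
lemma exists_smoothNear_apply_eq (u : V x) : ∃ s : ∀ y, V y, SmoothNear E F s x ∧ s x = u := by
  let v := finBasis ℝ F
  have hx : x ∈ (trivializationAt F V x).baseSet := FiberBundle.mem_baseSet_trivializationAt F V x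
  exact ⟨_, .sum _ fun i _ => .smul (.const (localCoframe (trivializationAt F V x) v i x u))
    (smoothNear_localFrame v hx i), sum_localCoframe_smul_localFrame v hx u⟩

lemma smoothFnNear_transitionMatrix (hx : x ∈ e.baseSet) (hx' : x ∈ e'.baseSet) (i : ι) (j : ι') :
    SmoothFnNear E (fun y => transitionMatrix e e' v v' y i j) x :=
  (smoothNear_localFrame v' hx' j).localCoframe v hx i

end Frames

/-! ### Derivations of sections and their connection matrices -/

section Derivations

variable {E : Type*} [NormedAddCommGroup E] [NormedSpace ℝ E]
  {M : Type*} [TopologicalSpace M] [ChartedSpace E M]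
  (F : Type*) [NormedAddCommGroup F] [NormedSpace ℝ F]
  {V : M → Type*} [TopologicalSpace (TotalSpace F V)]
  [∀ x, AddCommGroup (V x)] [∀ x, Module ℝ (V x)]
  [∀ x, TopologicalSpace (V x)] [FiberBundle F V]

/-- `D` is a derivation of the sections of `V` over the vector field `X`:
`D (f s) = X(f) s + f D s`. The laws are imposed on germs of smooth sections only. -/
structure IsDerivation (X : ∀ x : M, TangentSpace 𝓘(ℝ, E) x) (D : (∀ x, V x) → ∀ x, V x) :
    Prop where
  add : ∀ {σ τ : ∀ x, V x} {x : M}, SmoothNear E F σ x → SmoothNear E F τ x →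
    D (σ + τ) x = D σ x + D τ x
  leibniz : ∀ {f : M → ℝ} {σ : ∀ x, V x} {x : M}, SmoothFnNear E f x → SmoothNear E F σ x →
    D (fun y => f y • σ y) x = f x • D σ x + dirDeriv X f x • σ x

/-- `D` maps smooth germs of sections to smooth germs. -/
def PreservesSmooth (E : Type*) [NormedAddCommGroup E] [NormedSpace ℝ E] [ChartedSpace E M]
    (D : (∀ x, V x) → ∀ x, V x) : Prop :=
  ∀ {σ : ∀ x, V x} {x : M}, SmoothNear E F σ x → SmoothNear E F (D σ) x

variable {F} {X Y : ∀ x : M, TangentSpace 𝓘(ℝ, E) x} {D D₁ D₂ D₃ : (∀ x, V x) → ∀ x, V x}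

namespace IsDerivation

/-- The law of Leibniz for the indicator function of the set where two sections agree shows that a
derivation is local. -/
lemma congr (hD : IsDerivation F X D) {σ τ : ∀ x, V x} {x : M} (hσ : SmoothNear E F σ x)
    (h : ∀ᶠ y in 𝓝 x, τ y = σ y) : D τ x = D σ x := by
  classical
  let ψ (y : M) : ℝ := if τ y = σ y then 1 else 0
  have hψ1 : ψ =ᶠ[𝓝 x] fun _ => 1 := by
    filter_upwards [h] with y hy using by simp [ψ, hy]
  have hψ : SmoothFnNear E ψ x := (SmoothFnNear.const 1).congr hψ1
  have hψx : ψ x = 1 := hψ1.self_of_nhds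
  have hdψ : dirDeriv X ψ x = 0 := by rw [dirDeriv_congr hψ1, dirDeriv_const]
  have hψτ : (fun y => ψ y • τ y) = fun y => ψ y • σ y := by
    funext y
    by_cases hy : τ y = σ y <;> simp [ψ, hy]
  have hτ := hD.leibniz hψ (hσ.congr h)
  rw [hψτ, hD.leibniz hψ hσ, hψx, hdψ] at hτ
  simpa using hτ.symm

variable [VectorBundle ℝ F V]

lemma zero (hD : IsDerivation F X D) (x : M) : D (fun _ => 0) x = 0 := by
  have h := hD.leibniz (SmoothFnNear.const (x := x) 0) (SmoothNear.zero (E := E) (F := F) (V := V))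
  simpa [dirDeriv_const] using h

lemma sum (hD : IsDerivation F X D) {ι : Type*} (s : Finset ι) {σ : ι → ∀ x, V x} {x : M}
    (h : ∀ i ∈ s, SmoothNear E F (σ i) x) :
    D (fun y => ∑ i ∈ s, σ i y) x = ∑ i ∈ s, D (σ i) x := by
  classical
  induction s using Finset.induction_on with
  | empty => simpa using hD.zero x
  | insert a s ha ih =>
    simp only [Finset.sum_insert ha]
    rw [← ih fun i hi => h i (by simp [hi])]
    exact hD.add (h a (by simp)) (.sum s fun i hi => h i (by simp [hi]))

end IsDerivation

variable [VectorBundle ℝ F V] {e : Trivialization F (π F V)} [MemTrivializationAtlas e]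
  {e' : Trivialization F (π F V)} [MemTrivializationAtlas e']
  {ι ι' : Type*} (v : Basis ι ℝ F) (v' : Basis ι' ℝ F) {x : M}

variable (e) in
/-- The matrix `ω` with `D s_j = ∑ i, ω i j • s_i` for the local frame `s = e.localFrame v`. -/
noncomputable def connectionMatrix (D : (∀ x, V x) → ∀ x, V x) (x : M) : Matrix ι ι ℝ :=
  .of fun i j => localCoframe e v i x (D (e.localFrame v j) x)

variable [FiniteDimensional ℝ F] [ContMDiffVectorBundle ∞ F V 𝓘(ℝ, E)]

lemma smoothFnNear_connectionMatrix (hD : PreservesSmooth F E D) (hx : x ∈ e.baseSet) (i j : ι) :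
    SmoothFnNear E (fun y => connectionMatrix e v D y i j) x :=
  (hD (smoothNear_localFrame v hx j)).localCoframe v hx i

variable [Fintype ι] [Fintype ι']

namespace IsDerivation

lemma apply_eq_sum (hD : IsDerivation F X D) {σ : ∀ x, V x} (hx : x ∈ e.baseSet)
    (hσ : SmoothNear E F σ x) :
    D σ x = ∑ j, (localCoframe e v j x (σ x) • D (e.localFrame v j) x +
      dirDeriv X (fun y => localCoframe e v j y (σ y)) x • e.localFrame v j x) := by
  have hc : ∀ j, SmoothFnNear E (fun y => localCoframe e v j y (σ y)) x := hσ.localCoframe v hx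
  have hs : ∀ j, SmoothNear E F (e.localFrame v j) x := smoothNear_localFrame v hx
  have hexp : ∀ᶠ y in 𝓝 x, σ y = ∑ j, localCoframe e v j y (σ y) • e.localFrame v j y := by
    filter_upwards [e.open_baseSet.mem_nhds hx] with y hy
    exact (sum_localCoframe_smul_localFrame v hy _).symm
  rw [hD.congr (.sum _ fun j _ => .smul (hc j) (hs j)) hexp,
    hD.sum _ fun j _ => .smul (hc j) (hs j)]
  exact Finset.sum_congr rfl fun j _ => hD.leibniz (hc j) (hs j)

lemma localCoframe_apply (hD : IsDerivation F X D) {σ : ∀ x, V x} (hx : x ∈ e.baseSet)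
    (hσ : SmoothNear E F σ x) (i : ι) :
    localCoframe e v i x (D σ x) =
      ∑ j, connectionMatrix e v D x i j * localCoframe e v j x (σ x) +
        dirDeriv X (fun y => localCoframe e v i y (σ y)) x := by
  classical
  simp only [hD.apply_eq_sum v hx hσ, map_sum, map_add, map_smul, smul_eq_mul,
    localCoframe_localFrame v hx, Finset.sum_add_distrib, Matrix.one_apply, mul_ite, mul_one,
    mul_zero, Finset.sum_ite_eq, Finset.mem_univ, if_true]
  simp only [connectionMatrix, Matrix.of_apply, mul_comm]

lemma transitionMatrix_mul_connectionMatrix (hD : IsDerivation F X D) (hx : x ∈ e.baseSet)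
    (hx' : x ∈ e'.baseSet) :
    transitionMatrix e e' v v' x * connectionMatrix e' v' D x =
      connectionMatrix e v D x * transitionMatrix e e' v v' x +
        dirDerivMatrix X (transitionMatrix e e' v v') x := by
  ext i j
  have hexp := congrArg (localCoframe e v i x)
    (sum_localCoframe_smul_localFrame v' hx' (D (e'.localFrame v' j) x))
  rw [hD.localCoframe_apply v hx (smoothNear_localFrame v' hx' j)] at hexp
  simpa [Matrix.mul_apply, transitionMatrix, connectionMatrix, dirDerivMatrix, mul_comm] using hexp

lemma trace_connectionMatrix_change (hD : IsDerivation F X D) (hx : x ∈ e.baseSet)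
    (hx' : x ∈ e'.baseSet) :
    (connectionMatrix e' v' D x).trace = (connectionMatrix e v D x).trace +
      (transitionMatrix e' e v' v x * dirDerivMatrix X (transitionMatrix e e' v v') x).trace := by
  classical
  have hgauge := congrArg (fun A => (transitionMatrix e' e v' v x * A).trace)
    (hD.transitionMatrix_mul_connectionMatrix v v' hx hx')
  rwa [← Matrix.mul_assoc, transitionMatrix_mul_symm v' v hx' hx, Matrix.one_mul, Matrix.mul_add,
    Matrix.trace_add, Matrix.trace_mul_comm _ (_ * _), Matrix.mul_assoc,
    transitionMatrix_mul_symm v v' hx hx', Matrix.mul_one] at hgauge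

lemma trace_connectionMatrix_basis (hD : IsDerivation F X D) (hx : x ∈ e.baseSet) :
    (connectionMatrix e v' D x).trace = (connectionMatrix e v D x).trace := by
  have hconst : dirDerivMatrix X (transitionMatrix e e v v') x = 0 := by
    ext i j
    have h : (fun y => transitionMatrix e e v v' y i j) =ᶠ[𝓝 x] fun _ => v.toMatrix v' i j := by
      filter_upwards [e.open_baseSet.mem_nhds hx] with y hy
      rw [transitionMatrix_of_mem v v' hy]
    exact (dirDeriv_congr h).trans (dirDeriv_const _)
  rw [hD.trace_connectionMatrix_change v v' hx hx, hconst, Matrix.mul_zero, Matrix.trace_zero,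
    add_zero]

lemma connectionMatrix_comp (hD₁ : IsDerivation F X D₁) (hD₂ : PreservesSmooth F E D₂)
    (hx : x ∈ e.baseSet) :
    connectionMatrix e v (D₁ ∘ D₂) x =
      connectionMatrix e v D₁ x * connectionMatrix e v D₂ x +
        dirDerivMatrix X (connectionMatrix e v D₂) x := by
  ext i j
  exact hD₁.localCoframe_apply v hx (hD₂ (smoothNear_localFrame v hx j)) i

end IsDerivation

/-- The commutator of the connection matrices has trace zero, so only their derivatives remain. -/
lemma trace_connectionMatrix_commutator (hD₁ : IsDerivation F X D₁) (hD₂ : IsDerivation F Y D₂)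
    (hs₁ : PreservesSmooth F E D₁) (hs₂ : PreservesSmooth F E D₂)
    (hD₃ : ∀ {σ : ∀ x, V x} {x : M}, SmoothNear E F σ x → D₃ σ x = D₁ (D₂ σ) x - D₂ (D₁ σ) x)
    (hx : x ∈ e.baseSet) :
    (connectionMatrix e v D₃ x).trace =
      dirDeriv X (fun y => (connectionMatrix e v D₂ y).trace) x -
        dirDeriv Y (fun y => (connectionMatrix e v D₁ y).trace) x := by
  have hsub : connectionMatrix e v D₃ x =
      connectionMatrix e v (D₁ ∘ D₂) x - connectionMatrix e v (D₂ ∘ D₁) x := by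
    ext i j
    exact (congrArg (localCoframe e v i x) (hD₃ (smoothNear_localFrame v hx j))).trans
      (map_sub _ _ _)
  rw [hsub, hD₁.connectionMatrix_comp v hs₂ hx, hD₂.connectionMatrix_comp v hs₁ hx,
    Matrix.trace_sub, Matrix.trace_add, Matrix.trace_add, Matrix.trace_mul_comm,
    trace_dirDerivMatrix (smoothFnNear_connectionMatrix v hs₁ hx),
    trace_dirDerivMatrix (smoothFnNear_connectionMatrix v hs₂ hx)]
  ring

variable (F) in
/-- The trace of the connection matrix of `D` in the standard frame of the preferred trivialization
around `b`. -/
noncomputable def frameTrace (D : (∀ x, V x) → ∀ x, V x) (b x : M) : ℝ :=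
  (connectionMatrix (trivializationAt F V b) (finBasis ℝ F) D x).trace

lemma smoothFnNear_frameTrace {b : M} (hD : PreservesSmooth F E D)
    (hx : x ∈ (trivializationAt F V b).baseSet) : SmoothFnNear E (frameTrace F D b) x :=
  SmoothFnNear.sum Finset.univ fun i _ =>
    smoothFnNear_connectionMatrix (finBasis ℝ F) hD hx i i

end Derivations

section Extension

variable {E : Type*} [NormedAddCommGroup E] [NormedSpace ℝ E] [FiniteDimensional ℝ E]
  {M : Type*} [TopologicalSpace M] [ChartedSpace E M] [IsManifold 𝓘(ℝ, E) ∞ M] [T2Space M]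

lemma exists_smooth_bump {x : M} {U : Set M} (hU : U ∈ 𝓝 x) :
    ∃ f : C^∞⟮𝓘(ℝ, E), M; 𝓘(ℝ, ℝ), ℝ⟯, tsupport f ⊆ U ∧ ∀ᶠ y in 𝓝 x, f y = 1 := by
  obtain ⟨f, -, hf⟩ := (SmoothBumpFunction.nhds_basis_tsupport (I := 𝓘(ℝ, E)) x).mem_iff.1 hU
  exact ⟨⟨f, f.contMDiff⟩, hf, f.eventuallyEq_one⟩

variable {F : Type*} [NormedAddCommGroup F] [NormedSpace ℝ F]
  {V : M → Type*} [TopologicalSpace (TotalSpace F V)]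
  [∀ x, AddCommGroup (V x)] [∀ x, Module ℝ (V x)]
  [∀ x, TopologicalSpace (V x)] [FiberBundle F V] [VectorBundle ℝ F V]

lemma SmoothNear.exists_section {σ : ∀ x, V x} {x : M} (h : SmoothNear E F σ x) :
    ∃ s : Cₛ^∞⟮𝓘(ℝ, E); F, V⟯, ∀ᶠ y in 𝓝 x, s y = σ y := by
  obtain ⟨U, hU, hUo, hxU⟩ := eventually_nhds_iff.1 h
  obtain ⟨f, hf, hf1⟩ := exists_smooth_bump (E := E) (hUo.mem_nhds hxU)
  refine ⟨⟨_, ContMDiffOn.smul_section_of_tsupport f.contMDiff.contMDiffOn hUo hf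
    fun y hy => (hU y hy).contMDiffWithinAt⟩, ?_⟩
  filter_upwards [hf1] with y hy
  change f y • σ y = σ y
  rw [hy, one_smul]

lemma SmoothFnNear.exists_contMDiff {f : M → ℝ} {x : M} (h : SmoothFnNear E f x) :
    ∃ g : C^∞⟮𝓘(ℝ, E), M; 𝓘(ℝ, ℝ), ℝ⟯, ∀ᶠ y in 𝓝 x, g y = f y := by
  obtain ⟨U, hU, hUo, hxU⟩ := eventually_nhds_iff.1 h
  obtain ⟨f', hf, hf1⟩ := exists_smooth_bump (E := E) (hUo.mem_nhds hxU)
  have hs : ContMDiff 𝓘(ℝ, E) 𝓘(ℝ, ℝ) ∞ fun y => f' y • f y := by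
    refine contMDiff_of_tsupport fun y hy => ?_
    exact f'.contMDiff.contMDiffAt.smul (hU y (hf (tsupport_smul_subset_left f' f hy)))
  refine ⟨⟨_, hs⟩, ?_⟩
  filter_upwards [hf1] with y hy
  change f' y • f y = f y
  rw [hy, one_smul]

end Extension

/-! ### The Lie derivatives on `A`, `TM` and `A*` -/

namespace LieAlgebroid

section Derivatives

variable {E : Type*} [NormedAddCommGroup E] [NormedSpace ℝ E]
  {M : Type*} [TopologicalSpace M] [ChartedSpace E M] [IsManifold 𝓘(ℝ, E) ∞ M]
  {F : Type*} [NormedAddCommGroup F] [NormedSpace ℝ F]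
  {A : M → Type*} [TopologicalSpace (TotalSpace F A)] [∀ x, AddCommGroup (A x)]
  [∀ x, Module ℝ (A x)] [∀ x, TopologicalSpace (A x)] [FiberBundle F A] [VectorBundle ℝ F A]
  (𝔸 : LieAlgebroid E F A)

lemma smoothNear_rho (α : Cₛ^∞⟮𝓘(ℝ, E); F, A⟯) (x : M) : SmoothNear E E (𝔸.rho α) x :=
  Eventually.of_forall <| ContMDiff.clm_bundle_apply (b := fun y : M => y)
    (ϕ := fun y => 𝔸.anchor y) (v := fun y => α y) 𝔸.anchor.contMDiff α.contMDiff

lemma rho_bracket (α β : Cₛ^∞⟮𝓘(ℝ, E); F, A⟯) : 𝔸.rho (𝔸.bracket α β) =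
    VectorField.mlieBracket 𝓘(ℝ, E) (𝔸.rho α) (𝔸.rho β) :=
  funext fun x => 𝔸.anchor_bracket α β x

lemma rho_smulSection (f : C^∞⟮𝓘(ℝ, E), M; 𝓘(ℝ, ℝ), ℝ⟯) (α : Cₛ^∞⟮𝓘(ℝ, E); F, A⟯) :
    𝔸.rho (smulSection f α) = fun x => f x • 𝔸.rho α x :=
  funext fun x => map_smul (𝔸.anchor x) (f x) (α x)

lemma rho_add (α β : Cₛ^∞⟮𝓘(ℝ, E); F, A⟯) : 𝔸.rho (α + β) = 𝔸.rho α + 𝔸.rho β :=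
  funext fun x => map_add (𝔸.anchor x) (α x) (β x)

lemma bracket_zero (α : Cₛ^∞⟮𝓘(ℝ, E); F, A⟯) : 𝔸.bracket α 0 = 0 := by
  have h := 𝔸.bracket_add α 0 0
  simpa using h

lemma bracket_sub (α β γ : Cₛ^∞⟮𝓘(ℝ, E); F, A⟯) :
    𝔸.bracket α (β - γ) = 𝔸.bracket α β - 𝔸.bracket α γ := by
  rw [eq_sub_iff_add_eq, ← 𝔸.bracket_add, sub_add_cancel]

lemma bracket_skew (α β : Cₛ^∞⟮𝓘(ℝ, E); F, A⟯) : 𝔸.bracket α β = -𝔸.bracket β α := by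
  have h := 𝔸.bracket_self (α + β)
  rw [𝔸.add_bracket, 𝔸.bracket_add, 𝔸.bracket_add, 𝔸.bracket_self, 𝔸.bracket_self, zero_add,
    add_zero] at h
  exact eq_neg_of_add_eq_zero_left h

lemma smulSection_bracket (f : C^∞⟮𝓘(ℝ, E), M; 𝓘(ℝ, ℝ), ℝ⟯) (α β : Cₛ^∞⟮𝓘(ℝ, E); F, A⟯) (x : M) :
    𝔸.bracket (smulSection f α) β x =
      f x • 𝔸.bracket α β x - dirDeriv (𝔸.rho β) f x • α x := by
  rw [𝔸.bracket_skew, 𝔸.bracket_skew α β]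
  change -(𝔸.bracket β (smulSection f α) x) = f x • -(𝔸.bracket β α x) - _
  rw [𝔸.leibniz, smul_neg, neg_add, ← sub_eq_add_neg]
  rfl

variable [FiniteDimensional ℝ E] [T2Space M]

lemma bracket_congr_right {α β γ : Cₛ^∞⟮𝓘(ℝ, E); F, A⟯} {x : M} (h : ∀ᶠ y in 𝓝 x, β y = γ y) :
    𝔸.bracket α β x = 𝔸.bracket α γ x := by
  obtain ⟨f, hf, hf1⟩ := exists_smooth_bump (E := E) h
  have h0 : smulSection f (β - γ) = 0 := by
    ext y
    change f y • (β y - γ y) = 0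
    by_cases hy : y ∈ tsupport f
    · rw [show β y = γ y from hf hy, sub_self, smul_zero]
    · rw [image_eq_zero_of_notMem_tsupport hy, zero_smul]
  have h1 := 𝔸.leibniz f α (β - γ) x
  have h2 : (β - γ : Cₛ^∞⟮𝓘(ℝ, E); F, A⟯) x = 0 := sub_eq_zero.2 h.self_of_nhds
  rw [h0, 𝔸.bracket_zero, h2, smul_zero, add_zero, hf1.self_of_nhds, one_smul,
    𝔸.bracket_sub] at h1
  exact sub_eq_zero.1 h1.symm

lemma localBracket_eq {α β : Cₛ^∞⟮𝓘(ℝ, E); F, A⟯} {s : ∀ x, A x} {x : M}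
    (h : ∀ᶠ y in 𝓝 x, β y = s y) : 𝔸.localBracket α s x = 𝔸.bracket α β x := by
  have hex : ∃ β : Cₛ^∞⟮𝓘(ℝ, E); F, A⟯, ∀ᶠ y in 𝓝 x, β y = s y := ⟨β, h⟩
  unfold localBracket
  rw [dif_pos hex]
  refine 𝔸.bracket_congr_right ?_
  filter_upwards [h, hex.choose_spec] with y h1 h2 using h2.trans h1.symm

lemma eventually_localBracket_eq {α β : Cₛ^∞⟮𝓘(ℝ, E); F, A⟯} {s : ∀ x, A x} {x : M}
    (h : ∀ᶠ y in 𝓝 x, β y = s y) : ∀ᶠ y in 𝓝 x, 𝔸.bracket α β y = 𝔸.localBracket α s y := by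
  filter_upwards [h.eventually_nhds] with y hy using (𝔸.localBracket_eq hy).symm

lemma isDerivation_localBracket (α : Cₛ^∞⟮𝓘(ℝ, E); F, A⟯) :
    IsDerivation (F := F) (𝔸.rho α) (𝔸.localBracket α) where
  add {σ τ x} hσ hτ := by
    obtain ⟨s, hs⟩ := hσ.exists_section
    obtain ⟨t, ht⟩ := hτ.exists_section
    have hst : ∀ᶠ y in 𝓝 x, (s + t) y = (σ + τ) y := by
      filter_upwards [hs, ht] with y h h' using congrArg₂ (· + ·) h h'
    rw [𝔸.localBracket_eq hst, 𝔸.localBracket_eq hs, 𝔸.localBracket_eq ht, 𝔸.bracket_add]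
    rfl
  leibniz {f σ x} hf hσ := by
    obtain ⟨s, hs⟩ := hσ.exists_section
    obtain ⟨g, hg⟩ := hf.exists_contMDiff
    have hst : ∀ᶠ y in 𝓝 x, smulSection g s y = f y • σ y := by
      filter_upwards [hs, hg] with y h h' using congrArg₂ (· • ·) h' h
    rw [𝔸.localBracket_eq hst, 𝔸.localBracket_eq hs, 𝔸.leibniz, hs.self_of_nhds, hg.self_of_nhds]
    exact congrArg (_ + · • _) (dirDeriv_congr hg)

lemma preservesSmooth_localBracket (α : Cₛ^∞⟮𝓘(ℝ, E); F, A⟯) :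
    PreservesSmooth F E (𝔸.localBracket α) := fun {σ x} hσ => by
  obtain ⟨s, hs⟩ := hσ.exists_section
  refine (SmoothNear.of_section (𝔸.bracket α s)).congr ?_
  filter_upwards [𝔸.eventually_localBracket_eq hs] with y hy using hy.symm

lemma localBracket_bracket (α β : Cₛ^∞⟮𝓘(ℝ, E); F, A⟯) {σ : ∀ x, A x} {x : M}
    (hσ : SmoothNear E F σ x) : 𝔸.localBracket (𝔸.bracket α β) σ x =
      𝔸.localBracket α (𝔸.localBracket β σ) x - 𝔸.localBracket β (𝔸.localBracket α σ) x := by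
  obtain ⟨s, hs⟩ := hσ.exists_section
  rw [𝔸.localBracket_eq hs, 𝔸.localBracket_eq (𝔸.eventually_localBracket_eq hs),
    𝔸.localBracket_eq (𝔸.eventually_localBracket_eq hs), 𝔸.jacobi α β s]
  exact (add_sub_cancel_right _ _).symm

lemma localBracket_add_left (α β : Cₛ^∞⟮𝓘(ℝ, E); F, A⟯) {σ : ∀ x, A x} {x : M}
    (hσ : SmoothNear E F σ x) :
    𝔸.localBracket (α + β) σ x = 𝔸.localBracket α σ x + 𝔸.localBracket β σ x := by
  obtain ⟨s, hs⟩ := hσ.exists_section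
  rw [𝔸.localBracket_eq hs, 𝔸.localBracket_eq hs, 𝔸.localBracket_eq hs, 𝔸.add_bracket]
  rfl

lemma localBracket_smul_left (f : C^∞⟮𝓘(ℝ, E), M; 𝓘(ℝ, ℝ), ℝ⟯) (α : Cₛ^∞⟮𝓘(ℝ, E); F, A⟯)
    {σ : ∀ x, A x} {x : M} (hσ : SmoothNear E F σ x) :
    𝔸.localBracket (smulSection f α) σ x =
      f x • 𝔸.localBracket α σ x - mvfderiv 𝓘(ℝ, E) f x (𝔸.anchor x (σ x)) • α x := by
  obtain ⟨s, hs⟩ := hσ.exists_section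
  rw [𝔸.localBracket_eq hs, 𝔸.localBracket_eq hs, 𝔸.smulSection_bracket, ← hs.self_of_nhds]
  rfl

end Derivatives

end LieAlgebroid

section VectorFields

lemma minSmoothness_le_infty (k : ℕ∞) : minSmoothness ℝ (k : ℕ∞ω) ≤ ∞ := by
  rw [minSmoothness_of_isRCLikeNormedField]
  exact_mod_cast le_top

variable {E : Type*} [NormedAddCommGroup E] [NormedSpace ℝ E]
  {M : Type*} [TopologicalSpace M] [ChartedSpace E M] [IsManifold 𝓘(ℝ, E) ∞ M]
  {X Y : ∀ x : M, TangentSpace 𝓘(ℝ, E) x}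

lemma SmoothNear.mdifferentiableAt {x : M} (hX : SmoothNear E E X x) :
    MDifferentiableAt 𝓘(ℝ, E) 𝓘(ℝ, E).tangent
      (fun y => (⟨y, X y⟩ : TangentBundle 𝓘(ℝ, E) M)) x :=
  ContMDiffAt.mdifferentiableAt (n := ∞) hX.contMDiffAt (by simp)

variable [FiniteDimensional ℝ E]

lemma isDerivation_mlieBracket : IsDerivation (F := E) X
    (VectorField.mlieBracket 𝓘(ℝ, E) X) where
  add hσ hτ := VectorField.mlieBracket_add_right hσ.mdifferentiableAt hτ.mdifferentiableAt
  leibniz hf hσ := (VectorField.mlieBracket_smul_right hf.mdifferentiableAt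
    hσ.mdifferentiableAt).trans (add_comm _ _)

lemma preservesSmooth_mlieBracket (hX : ∀ x, SmoothNear E E X x) :
    PreservesSmooth E E (VectorField.mlieBracket 𝓘(ℝ, E) X) := fun {σ x} hσ => by
  have := IsManifold.of_le (I := 𝓘(ℝ, E)) (M := M) (m := minSmoothness ℝ 2) (n := ∞)
    (minSmoothness_le_infty 2)
  have : IsManifold 𝓘(ℝ, E) ((⊤ : ℕ∞) + 1) M := ‹IsManifold 𝓘(ℝ, E) ∞ M›
  filter_upwards [hσ] with y hy
  exact ContMDiffAt.mlieBracket_vectorField (m := ⊤) (n := ⊤) (hX y).contMDiffAt hy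
    (minSmoothness_le_infty ⊤)

lemma mlieBracket_mlieBracket (hX : ∀ x, SmoothNear E E X x) (hY : ∀ x, SmoothNear E E Y x)
    {σ : ∀ x : M, TangentSpace 𝓘(ℝ, E) x} {x : M} (hσ : SmoothNear E E σ x) :
    VectorField.mlieBracket 𝓘(ℝ, E) (VectorField.mlieBracket 𝓘(ℝ, E) X Y) σ x =
      VectorField.mlieBracket 𝓘(ℝ, E) X (VectorField.mlieBracket 𝓘(ℝ, E) Y σ) x -
      VectorField.mlieBracket 𝓘(ℝ, E) Y (VectorField.mlieBracket 𝓘(ℝ, E) X σ) x := by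
  have h2 := minSmoothness_le_infty 2
  have := IsManifold.of_le (I := 𝓘(ℝ, E)) (M := M) (m := minSmoothness ℝ 3) (n := ∞)
    (minSmoothness_le_infty 3)
  rw [VectorField.leibniz_identity_mlieBracket_apply ((hX x).contMDiffAt.of_le h2)
    ((hY x).contMDiffAt.of_le h2) (hσ.contMDiffAt.of_le h2), add_sub_cancel_right]

end VectorFields

/-! ### The dual bundle -/

section Dual

variable {E : Type*} [NormedAddCommGroup E] [NormedSpace ℝ E]
  {M : Type*} [TopologicalSpace M] [ChartedSpace E M]
  (F : Type*) [NormedAddCommGroup F] [NormedSpace ℝ F]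
  (A : M → Type*) [TopologicalSpace (TotalSpace F A)] [∀ x, AddCommGroup (A x)]
  [∀ x, Module ℝ (A x)] [∀ x, TopologicalSpace (A x)] [FiberBundle F A] [VectorBundle ℝ F A]

variable {b x : M}

lemma baseSet_dualBundle (b : M) :
    (trivializationAt (F →L[ℝ] ℝ) (DualBundle A) b).baseSet = (trivializationAt F A b).baseSet := by
  rw [hom_trivializationAt_baseSet]
  exact inter_univ _

lemma linearMapAt_dualBundle (hx : x ∈ (trivializationAt F A b).baseSet) (ψ : DualBundle A x)
    (w : F) : (trivializationAt (F →L[ℝ] ℝ) (DualBundle A) b).linearMapAt ℝ x ψ w =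
      (ψ ((trivializationAt F A b).symm x w) : ℝ) := by
  have hx' := hx
  rw [← baseSet_dualBundle] at hx'
  rw [Trivialization.coe_linearMapAt_of_mem (R := ℝ) _ hx']
  beta_reduce
  rw [hom_trivializationAt_apply]
  change (trivializationAt ℝ (Bundle.Trivial M ℝ) b).continuousLinearMapAt ℝ x
    (ψ ((trivializationAt F A b).symmL ℝ x w)) = _
  rw [Trivialization.continuousLinearMapAt_apply, Trivialization.coe_linearMapAt_of_mem (R := ℝ) _
    (show x ∈ (trivializationAt ℝ (Bundle.Trivial M ℝ) b).baseSet from mem_univ x)]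
  change (ψ ((trivializationAt F A b).symmL ℝ x w) : ℝ) = _
  rw [Trivialization.symmL_apply (R := ℝ) _ hx]

variable {A F}

lemma SmoothNear.pairing {φ : ∀ x, DualBundle A x} {s : ∀ x, A x}
    (hφ : SmoothNear E (F →L[ℝ] ℝ) φ x) (hs : SmoothNear E F s x) :
    SmoothFnNear E (fun y => (φ y (s y) : ℝ)) x := by
  filter_upwards [hφ, hs] with y h h'
  exact (contMDiffAt_section y).1
    (ContMDiffAt.clm_bundle_apply (b := fun y : M => y) (ϕ := φ) (v := s) h h')

section Frame

variable {ι : Type*} (v : Basis ι ℝ F)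

lemma pairing_eq_sum [Fintype ι] {e : Trivialization F (π F A)} [MemTrivializationAtlas e]
    (hx : x ∈ e.baseSet) (ψ : DualBundle A x) (u : A x) :
    (ψ u : ℝ) = ∑ i, localCoframe e v i x u * (ψ (e.localFrame v i x) : ℝ) := by
  conv_lhs => rw [← sum_localCoframe_smul_localFrame v hx u]
  exact (map_sum ψ _ _).trans (Finset.sum_congr rfl fun i _ => map_smul ψ _ _)

variable [FiniteDimensional ℝ F] [Finite ι] [DecidableEq ι]

lemma localCoframe_dualBundle (hx : x ∈ (trivializationAt F A b).baseSet) (i : ι)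
    (ψ : DualBundle A x) :
    localCoframe (trivializationAt (F →L[ℝ] ℝ) (DualBundle A) b)
        (v.dualBasis.map LinearMap.toContinuousLinearMap) i x ψ =
      (ψ ((trivializationAt F A b).localFrame v i x) : ℝ) := by
  have hcoord (χ : F →L[ℝ] ℝ) :
      (v.dualBasis.map LinearMap.toContinuousLinearMap).coord i χ = χ (v i) := by
    simp [Basis.coord_apply]
  rw [localCoframe, LinearMap.comp_apply, hcoord, linearMapAt_dualBundle F A hx,
    Trivialization.localFrame_apply_of_mem_baseSet _ v hx]
  rfl

lemma localFrame_dualBundle (hx : x ∈ (trivializationAt F A b).baseSet) (i : ι) (u : A x) :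
    ((trivializationAt (F →L[ℝ] ℝ) (DualBundle A) b).localFrame
        (v.dualBasis.map LinearMap.toContinuousLinearMap) i x u : ℝ) =
      localCoframe (trivializationAt F A b) v i x u := by
  cases nonempty_fintype ι
  have hx' : x ∈ (trivializationAt (F →L[ℝ] ℝ) (DualBundle A) b).baseSet := by
    rwa [baseSet_dualBundle]
  rw [pairing_eq_sum v hx]
  simp only [← localCoframe_dualBundle v hx, localCoframe_localFrame _ hx', Matrix.one_apply,
    mul_ite, mul_one, mul_zero, Finset.sum_ite_eq', Finset.mem_univ, if_true]

end Frame

/-- `D'` is the operator on sections of `A*` dual to an operator `D` on sections of `A` over the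
vector field `X`: `(D' φ)(s) = X(φ(s)) - φ(D s)`, for germs of smooth sections only. -/
def IsDualOperator (F : Type*) [NormedAddCommGroup F] [NormedSpace ℝ F]
    {A : M → Type*} [TopologicalSpace (TotalSpace F A)] [∀ x, AddCommGroup (A x)]
    [∀ x, Module ℝ (A x)] [∀ x, TopologicalSpace (A x)] [FiberBundle F A] [VectorBundle ℝ F A]
    (X : ∀ x : M, TangentSpace 𝓘(ℝ, E) x) (D : (∀ x, A x) → ∀ x, A x)
    (D' : (∀ x, DualBundle A x) → ∀ x, DualBundle A x) : Prop :=
  ∀ ⦃φ : ∀ x, DualBundle A x⦄ ⦃s : ∀ x, A x⦄ ⦃x : M⦄, SmoothNear E (F →L[ℝ] ℝ) φ x →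
    SmoothNear E F s x →
    (D' φ x (s x) : ℝ) = dirDeriv X (fun y => (φ y (s y) : ℝ)) x - (φ x (D s x) : ℝ)

namespace IsDualOperator

variable {X : ∀ x : M, TangentSpace 𝓘(ℝ, E) x} {D : (∀ x, A x) → ∀ x, A x}
  {D' : (∀ x, DualBundle A x) → ∀ x, DualBundle A x}
  [FiniteDimensional ℝ F] [ContMDiffVectorBundle ∞ F A 𝓘(ℝ, E)]

lemma isDerivation (h : IsDualOperator F X D D') : IsDerivation (F →L[ℝ] ℝ) X D' where
  add {φ ψ x} hφ hψ := by
    refine ContinuousLinearMap.ext fun u => ?_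
    obtain ⟨s, hs, rfl⟩ := exists_smoothNear_apply_eq F E u
    have hadd := dirDeriv_add (X := X) (hφ.pairing hs) (hψ.pairing hs)
    change (D' (φ + ψ) x (s x) : ℝ) = D' φ x (s x) + D' ψ x (s x)
    rw [h (hφ.add hψ) hs, h hφ hs, h hψ hs]
    change dirDeriv X (fun y => (φ y (s y) : ℝ) + ψ y (s y)) x - (φ x (D s x) + ψ x (D s x)) = _
    rw [hadd]
    ring
  leibniz {f φ x} hf hφ := by
    refine ContinuousLinearMap.ext fun u => ?_
    obtain ⟨s, hs, rfl⟩ := exists_smoothNear_apply_eq F E u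
    change (D' (fun y => f y • φ y) x (s x) : ℝ) =
      f x * D' φ x (s x) + dirDeriv X f x * φ x (s x)
    rw [h (.smul hf hφ) hs, h hφ hs]
    change dirDeriv X (fun y => f y * (φ y (s y) : ℝ)) x - f x * φ x (D s x) = _
    rw [dirDeriv_mul hf (hφ.pairing hs)]
    ring

lemma connectionMatrix_eq (h : IsDualOperator F X D D') {ι : Type*} [Finite ι] [DecidableEq ι]
    (v : Basis ι ℝ F) (hx : x ∈ (trivializationAt F A b).baseSet) :
    connectionMatrix (trivializationAt (F →L[ℝ] ℝ) (DualBundle A) b)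
        (v.dualBasis.map LinearMap.toContinuousLinearMap) D' x =
      -(connectionMatrix (trivializationAt F A b) v D x).transpose := by
  ext i j
  have hx' : x ∈ (trivializationAt (F →L[ℝ] ℝ) (DualBundle A) b).baseSet := by
    rwa [baseSet_dualBundle]
  have hconst : (fun y => ((trivializationAt (F →L[ℝ] ℝ) (DualBundle A) b).localFrame
      (v.dualBasis.map LinearMap.toContinuousLinearMap) j y
        ((trivializationAt F A b).localFrame v i y) : ℝ)) =ᶠ[𝓝 x]
      fun _ => (1 : Matrix ι ι ℝ) j i := by
    filter_upwards [(trivializationAt F A b).open_baseSet.mem_nhds hx] with y hy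
    rw [localFrame_dualBundle v hy, localCoframe_localFrame v hy]
  rw [connectionMatrix, Matrix.of_apply, localCoframe_dualBundle v hx,
    h (smoothNear_localFrame _ hx' j) (smoothNear_localFrame v hx i), dirDeriv_congr hconst,
    dirDeriv_const, zero_sub, localFrame_dualBundle v hx]
  rfl

lemma frameTrace_eq (h : IsDualOperator F X D D')
    (hx : x ∈ (trivializationAt F A b).baseSet) :
    frameTrace (F →L[ℝ] ℝ) D' b x = -frameTrace F D b x := by
  classical
  have hx' : x ∈ (trivializationAt (F →L[ℝ] ℝ) (DualBundle A) b).baseSet := by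
    rwa [baseSet_dualBundle]
  rw [frameTrace, h.isDerivation.trace_connectionMatrix_basis
    ((finBasis ℝ F).dualBasis.map LinearMap.toContinuousLinearMap) _ hx',
    h.connectionMatrix_eq _ hx, Matrix.trace_neg, Matrix.trace_transpose, frameTrace]

end IsDualOperator

end Dual

namespace LieAlgebroid

section LieDual

variable {E : Type*} [NormedAddCommGroup E] [NormedSpace ℝ E] [FiniteDimensional ℝ E]
  {M : Type*} [TopologicalSpace M] [ChartedSpace E M] [IsManifold 𝓘(ℝ, E) ∞ M] [T2Space M]
  {F : Type*} [NormedAddCommGroup F] [NormedSpace ℝ F] [FiniteDimensional ℝ F]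
  {A : M → Type*} [TopologicalSpace (TotalSpace F A)] [∀ x, AddCommGroup (A x)]
  [∀ x, Module ℝ (A x)] [∀ x, TopologicalSpace (A x)] [FiberBundle F A] [VectorBundle ℝ F A]
  [ContMDiffVectorBundle ∞ F A 𝓘(ℝ, E)] (𝔸 : LieAlgebroid E F A)

/-- The right-hand side `u ↦ ρ(α)(φ(s)) - φ([α, s])` is `C^∞`-linear in `s`, so it may be computed
in the frame by which `lieDual` is defined. -/
lemma isDualOperator_lieDual (α : Cₛ^∞⟮𝓘(ℝ, E); F, A⟯) :
    IsDualOperator F (𝔸.rho α) (𝔸.localBracket α) (𝔸.lieDual α) := fun φ s x hφ hs => by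
  let v := finBasis ℝ F
  let e := trivializationAt F A x
  have hx : x ∈ e.baseSet := FiberBundle.mem_baseSet_trivializationAt F A x
  have hc (i) : SmoothFnNear E (fun y => localCoframe e v i y (s y)) x := hs.localCoframe v hx i
  have hp (i) : SmoothFnNear E (fun y => (φ y (e.localFrame v i y) : ℝ)) x :=
    hφ.pairing (smoothNear_localFrame v hx i)
  have hlie : (𝔸.lieDual α φ x (s x) : ℝ) =
      ∑ i, (dirDeriv (𝔸.rho α) (fun y => (φ y (e.localFrame v i y) : ℝ)) x -
        (φ x (𝔸.localBracket α (e.localFrame v i) x) : ℝ)) * localCoframe e v i x (s x) :=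
    _root_.sum_apply _ _ (s x)
  have hderiv : dirDeriv (𝔸.rho α) (fun y => (φ y (s y) : ℝ)) x =
      ∑ i, dirDeriv (𝔸.rho α) (fun y => localCoframe e v i y (s y) *
        (φ y (e.localFrame v i y) : ℝ)) x := by
    rw [← dirDeriv_sum _ fun i _ => (hc i).mul (hp i)]
    refine dirDeriv_congr ?_
    filter_upwards [e.open_baseSet.mem_nhds hx] with y hy using pairing_eq_sum v hy _ _
  have hbracket : (φ x (𝔸.localBracket α s x) : ℝ) =
      ∑ i, (localCoframe e v i x (s x) * (φ x (𝔸.localBracket α (e.localFrame v i) x) : ℝ) +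
        dirDeriv (𝔸.rho α) (fun y => localCoframe e v i y (s y)) x *
          (φ x (e.localFrame v i x) : ℝ)) := by
    rw [(𝔸.isDerivation_localBracket α).apply_eq_sum v hx hs]
    refine (map_sum (φ x) _ _).trans (Finset.sum_congr rfl fun i _ => ?_)
    exact (map_add (φ x) _ _).trans (congrArg₂ (· + ·) (map_smul (φ x) _ _) (map_smul (φ x) _ _))
  rw [hlie, hderiv, hbracket, ← Finset.sum_sub_distrib]
  refine Finset.sum_congr rfl fun i _ => ?_
  rw [dirDeriv_mul (hc i) (hp i)]
  ring

end LieDual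

end LieAlgebroid

/-! ### Characters and line bundles -/

lemma SmoothCharacter.hasDerivAt (χ : SmoothCharacter) {t : ℝ} (ht : t ≠ 0) :
    HasDerivAt χ.toHom (χ.weight * χ.toHom t / t) t := by
  have h1 : HasDerivAt χ.toHom χ.weight (t / t) := by
    rw [div_self ht]
    exact ((χ.smooth.contDiffAt (isOpen_compl_singleton.mem_nhds one_ne_zero)).differentiableAt
      (by simp)).hasDerivAt
  have h2 := (HasDerivAt.comp (h₂ := χ.toHom) (h := fun s => id s / t) t h1
    ((hasDerivAt_id t).div_const t)).const_mul (χ.toHom t)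
  have h3 : (fun s => χ.toHom t * (χ.toHom ∘ fun s => id s / t) s) = χ.toHom := by
    funext s
    simp only [Function.comp_apply, id, map_div₀]
    field_simp [(map_ne_zero χ.toHom).2 ht]
  rw [h3] at h2
  refine h2.congr_deriv ?_
  rw [mul_one_div, mul_div_assoc', mul_comm]

lemma SmoothCharacter.weight_eq_one {χ : SmoothCharacter}
    (hχ : ∀ t, χ.toHom t * χ.toHom t = t * t) : χ.weight = 1 := by
  have hderiv : HasDerivAt χ.toHom χ.weight 1 := by simpa using χ.hasDerivAt one_ne_zero
  have hsq := (hderiv.mul hderiv).unique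
    (((hasDerivAt_id (1 : ℝ)).mul (hasDerivAt_id 1)).congr_of_eventuallyEq (.of_forall hχ))
  simp only [map_one, id] at hsq
  linarith

lemma volChar_mul_self (t : ℝ) : volChar.toHom t * volChar.toHom t = t * t := rfl

lemma densChar_mul_self (t : ℝ) : densChar.toHom t * densChar.toHom t = t * t :=
  abs_mul_abs_self t

section LineBundles

variable {E : Type*} [NormedAddCommGroup E] [NormedSpace ℝ E]
  {M : Type*} [TopologicalSpace M] [ChartedSpace E M]
  {L : M → Type*} [∀ x, AddCommGroup (L x)] [∀ x, Module ℝ (L x)]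
  [∀ x, TopologicalSpace (L x)] [TopologicalSpace (TotalSpace ℝ L)]
  [FiberBundle ℝ L] [VectorBundle ℝ ℝ L]

lemma lineCoord_injective {b y : M} (hy : y ∈ (trivializationAt ℝ L b).baseSet) :
    Function.Injective (lineCoord L b y) := fun u v h => by
  rw [← lineCoord_smul_lineFrame L b y hy u, h, lineCoord_smul_lineFrame L b y hy v]

lemma lineCoord_eq_mul {b b' y : M} (hy : y ∈ (trivializationAt ℝ L b).baseSet) (v : L y) :
    lineCoord L b' y v = lineCoord L b' y (lineFrame L b y) * lineCoord L b y v := by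
  conv_lhs => rw [← lineCoord_smul_lineFrame L b y hy v, map_smul, smul_eq_mul, mul_comm]

lemma lineCoord_lineFrame_ne_zero {b b' y : M} (hy : y ∈ (trivializationAt ℝ L b).baseSet)
    (hy' : y ∈ (trivializationAt ℝ L b').baseSet) : lineCoord L b' y (lineFrame L b y) ≠ 0 := by
  have h := lineCoord_eq_mul (L := L) (b' := b') hy (lineFrame L b' y)
  rw [lineCoord_lineFrame L b' y hy'] at h
  exact left_ne_zero_of_mul_eq_one h.symm

lemma lineCoord_ne_zero {b y : M} (hy : y ∈ (trivializationAt ℝ L b).baseSet) {v : L y}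
    (hv : v ≠ 0) : lineCoord L b y v ≠ 0 := fun h =>
  hv (lineCoord_injective hy (h.trans (map_zero _).symm))

variable [ContMDiffVectorBundle ∞ ℝ L 𝓘(ℝ, E)]

lemma SmoothNear.lineCoord {σ : ∀ x, L x} {b x : M} (h : SmoothNear E ℝ σ x)
    (hx : x ∈ (trivializationAt ℝ L b).baseSet) :
    SmoothFnNear E (fun y => lineCoord L b y (σ y)) x := by
  have hb := (trivializationAt ℝ L b).open_baseSet
  filter_upwards [h, hb.mem_nhds hx] with y hy hyb
  refine (((trivializationAt ℝ L b).contMDiffAt_section_iff hyb).1 hy).congr_of_eventuallyEq ?_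
  filter_upwards [hb.mem_nhds hyb] with z hz
  rw [_root_.lineCoord, Trivialization.coe_linearMapAt_of_mem _ hz]

lemma smoothNear_of_lineCoord {σ : ∀ x, L x} {b x : M}
    (hx : x ∈ (trivializationAt ℝ L b).baseSet)
    (h : SmoothFnNear E (fun y => lineCoord L b y (σ y)) x) : SmoothNear E ℝ σ x := by
  have hb := (trivializationAt ℝ L b).open_baseSet
  filter_upwards [h, hb.mem_nhds hx] with y hy hyb
  refine ((trivializationAt ℝ L b).contMDiffAt_section_iff hyb).2 (hy.congr_of_eventuallyEq ?_)
  filter_upwards [hb.mem_nhds hyb] with z hz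
  rw [_root_.lineCoord, Trivialization.coe_linearMapAt_of_mem _ hz]

lemma smoothNear_lineFrame {b x : M} (hx : x ∈ (trivializationAt ℝ L b).baseSet) :
    SmoothNear E ℝ (lineFrame L b) x := by
  refine smoothNear_of_lineCoord hx ((SmoothFnNear.const 1).congr ?_)
  filter_upwards [(trivializationAt ℝ L b).open_baseSet.mem_nhds hx] with y hy
  exact lineCoord_lineFrame L b y hy

/-- In the coordinate given by the frame around `b`, the operator `P` is `X + w b`. -/
def HasLocalForm (X : ∀ x : M, TangentSpace 𝓘(ℝ, E) x) (P : (∀ x, L x) → ∀ x, L x)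
    (w : M → M → ℝ) : Prop :=
  ∀ ⦃b x : M⦄ ⦃σ : ∀ x, L x⦄, x ∈ (trivializationAt ℝ L b).baseSet → SmoothNear E ℝ σ x →
    lineCoord L b x (P σ x) =
      dirDeriv X (fun y => lineCoord L b y (σ y)) x + w b x * lineCoord L b x (σ x)

variable {X : ∀ x : M, TangentSpace 𝓘(ℝ, E) x} {P : (∀ x, L x) → ∀ x, L x} {w : M → M → ℝ}

lemma HasLocalForm.lineCoord_apply_lineFrame (h : HasLocalForm X P w) {b x : M}
    (hx : x ∈ (trivializationAt ℝ L b).baseSet) :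
    lineCoord L b x (P (lineFrame L b) x) = w b x := by
  have hone : (fun y => lineCoord L b y (lineFrame L b y)) =ᶠ[𝓝 x] fun _ => 1 := by
    filter_upwards [(trivializationAt ℝ L b).open_baseSet.mem_nhds hx] with y hy
    exact lineCoord_lineFrame L b y hy
  rw [h hx (smoothNear_lineFrame hx), dirDeriv_congr hone, dirDeriv_const,
    lineCoord_lineFrame L b x hx, zero_add, mul_one]

lemma HasLocalForm.transition (h : HasLocalForm X P w) {b b' x : M}
    (hx : x ∈ (trivializationAt ℝ L b).baseSet) (hx' : x ∈ (trivializationAt ℝ L b').baseSet) :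
    dirDeriv X (fun y => lineCoord L b' y (lineFrame L b y)) x +
      w b' x * lineCoord L b' x (lineFrame L b x) =
      w b x * lineCoord L b' x (lineFrame L b x) := by
  rw [← h hx' (smoothNear_lineFrame hx), lineCoord_eq_mul hx, h.lineCoord_apply_lineFrame hx,
    mul_comm]

/-- It is enough to know the local form at the centres of the trivializations, provided that the
`w b` transform correctly. -/
lemma hasLocalForm_of_center
    (h : ∀ ⦃x : M⦄ ⦃σ : ∀ x, L x⦄, SmoothNear E ℝ σ x → lineCoord L x x (P σ x) =
      dirDeriv X (fun y => lineCoord L x y (σ y)) x + w x x * lineCoord L x x (σ x))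
    (hw : ∀ ⦃b x : M⦄, x ∈ (trivializationAt ℝ L b).baseSet →
      dirDeriv X (fun y => lineCoord L x y (lineFrame L b y)) x +
        w x x * lineCoord L x x (lineFrame L b x) = w b x * lineCoord L x x (lineFrame L b x)) :
    HasLocalForm X P w := fun b x σ hx hσ => by
  have hx' : x ∈ (trivializationAt ℝ L x).baseSet := FiberBundle.mem_baseSet_trivializationAt ℝ L x
  have hcenter := h hσ
  have hchange : (fun y => lineCoord L x y (σ y)) =ᶠ[𝓝 x]
      fun y => lineCoord L x y (lineFrame L b y) * lineCoord L b y (σ y) := by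
    filter_upwards [(trivializationAt ℝ L b).open_baseSet.mem_nhds hx] with y hy
    exact lineCoord_eq_mul hy _
  rw [dirDeriv_congr hchange, dirDeriv_mul ((smoothNear_lineFrame hx).lineCoord hx')
    (hσ.lineCoord hx)] at hcenter
  refine mul_left_cancel₀ (lineCoord_lineFrame_ne_zero hx hx') ?_
  linear_combination hcenter - lineCoord_eq_mul (L := L) (b' := x) hx (P σ x) +
    w x x * lineCoord_eq_mul (L := L) (b' := x) hx (σ x) + lineCoord L b x (σ x) * hw hx

end LineBundles

section AssocBundles

variable {E : Type*} [NormedAddCommGroup E] [NormedSpace ℝ E]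
  {M : Type*} [TopologicalSpace M] [ChartedSpace E M]
  (χ : SmoothCharacter) (F : Type*) [NormedAddCommGroup F] [NormedSpace ℝ F]
  [FiniteDimensional ℝ F]
  (V : M → Type*) [TopologicalSpace (TotalSpace F V)] [∀ x, AddCommGroup (V x)]
  [∀ x, Module ℝ (V x)] [∀ x, TopologicalSpace (V x)] [FiberBundle F V] [VectorBundle ℝ F V]
  {b b' x : M}

lemma lineCoord_assocBundle (hx : x ∈ (trivializationAt F V b).baseSet) :
    lineCoord (AssocBundle χ F V) b x = AssocBundle.coord χ F V b x := by
  refine LinearMap.ext fun v => ?_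
  unfold lineCoord
  rw [Trivialization.coe_linearMapAt_of_mem (R := ℝ) _
    (show x ∈ (trivializationAt ℝ (AssocBundle χ F V) b).baseSet from hx)]
  rfl

lemma lineFrame_assocBundle (hx : x ∈ (trivializationAt F V b).baseSet) :
    lineFrame (AssocBundle χ F V) b x = AssocBundle.frame χ F V b x := by
  refine lineCoord_injective (b := b) (show x ∈ _ from hx) ?_
  rw [lineCoord_lineFrame _ b x hx, lineCoord_assocBundle χ F V hx]
  exact ((AssocBundle.lineFrames χ F V).coord_frame b x hx).symm

lemma lineCoord_lineFrame_assocBundle (hx : x ∈ (trivializationAt F V b).baseSet)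
    (hx' : x ∈ (trivializationAt F V b').baseSet) :
    lineCoord (AssocBundle χ F V) b' x (lineFrame (AssocBundle χ F V) b x) =
      χ.toHom (transitionMatrix (trivializationAt F V b) (trivializationAt F V b')
        (finBasis ℝ F) (finBasis ℝ F) x).det := by
  rw [lineCoord_assocBundle χ F V hx', lineFrame_assocBundle χ F V hx,
    AssocBundle.coord_frame' χ F V b b' x hx hx', det_transitionMatrix _ hx hx']

variable {F V} [ContMDiffVectorBundle ∞ F V 𝓘(ℝ, E)]
  {X : ∀ x : M, TangentSpace 𝓘(ℝ, E) x} {D : (∀ x, V x) → ∀ x, V x}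

/-- The logarithmic derivative of the transition function of `L_δ(V)` is `χ'(1)` times that of the
determinant, which is a trace by Jacobi's formula. -/
lemma dirDeriv_lineCoord_lineFrame_assocBundle (hD : IsDerivation F X D)
    (hx : x ∈ (trivializationAt F V b).baseSet) (hx' : x ∈ (trivializationAt F V b').baseSet) :
    dirDeriv X (fun y => lineCoord (AssocBundle χ F V) b' y
      (lineFrame (AssocBundle χ F V) b y)) x =
    χ.weight * (frameTrace F D b' x - frameTrace F D b x) *
      lineCoord (AssocBundle χ F V) b' x (lineFrame (AssocBundle χ F V) b x) := by
  let v := finBasis ℝ F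
  let g := transitionMatrix (trivializationAt F V b) (trivializationAt F V b') v v
  have hg : ∀ i j, SmoothFnNear E (fun y => g y i j) x := smoothFnNear_transitionMatrix v v hx hx'
  have hinv := transitionMatrix_mul_symm v v hx' hx
  have hdet : (g x).det ≠ 0 := (Matrix.isUnit_det_of_left_inverse hinv).ne_zero
  have htransition : (fun y => lineCoord (AssocBundle χ F V) b' y
      (lineFrame (AssocBundle χ F V) b y)) =ᶠ[𝓝 x] fun y => χ.toHom (g y).det := by
    filter_upwards [(trivializationAt F V b).open_baseSet.mem_nhds hx,
      (trivializationAt F V b').open_baseSet.mem_nhds hx'] with y hy hy'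
    exact lineCoord_lineFrame_assocBundle χ F V hy hy'
  rw [dirDeriv_congr htransition, dirDeriv_comp (smoothFnNear_det hg) (χ.hasDerivAt hdet),
    dirDeriv_det_of_mul_eq_one hg hinv, lineCoord_lineFrame_assocBundle χ F V hx hx', frameTrace,
    frameTrace, hD.trace_connectionMatrix_change v v hx hx']
  change _ = χ.weight * _ * χ.toHom (g x).det
  field_simp
  ring

lemma hasLocalForm_lieAssoc (hD : IsDerivation F X D) : HasLocalForm X (lieAssoc (F := F) χ X D)
    (fun b x => -(χ.weight * frameTrace F D b x)) := by
  refine hasLocalForm_of_center (fun x ξ _ => ?_) (fun b x hx => ?_)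
  · have hx : x ∈ (trivializationAt F V x).baseSet := FiberBundle.mem_baseSet_trivializationAt F V x
    have hframe : lineCoord (AssocBundle χ F V) x x (AssocBundle.frame χ F V x x) = 1 := by
      rw [← lineFrame_assocBundle χ F V hx, lineCoord_lineFrame _ x x hx]
    have hcoord : (fun y => AssocBundle.coord χ F V x y (ξ y)) =ᶠ[𝓝 x]
        fun y => lineCoord (AssocBundle χ F V) x y (ξ y) := by
      filter_upwards [(trivializationAt F V x).open_baseSet.mem_nhds hx] with y hy
      rw [lineCoord_assocBundle χ F V hy]
    rw [lieAssoc, map_smul, hframe, smul_eq_mul, mul_one, dirDeriv_congr hcoord,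
      ← lineCoord_assocBundle χ F V hx]
    exact (sub_eq_add_neg _ _).trans (congrArg _ (neg_mul _ _).symm)
  · have hx' : x ∈ (trivializationAt F V x).baseSet :=
      FiberBundle.mem_baseSet_trivializationAt F V x
    rw [dirDeriv_lineCoord_lineFrame_assocBundle χ hD hx hx']
    ring

end AssocBundles

section TensorBundles

variable {M : Type*} [TopologicalSpace M]
  (L₁ L₂ : M → Type*)
  [∀ x, AddCommGroup (L₁ x)] [∀ x, Module ℝ (L₁ x)]
  [∀ x, AddCommGroup (L₂ x)] [∀ x, Module ℝ (L₂ x)]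
  [∀ x, TopologicalSpace (L₁ x)] [TopologicalSpace (TotalSpace ℝ L₁)]
  [FiberBundle ℝ L₁] [VectorBundle ℝ ℝ L₁]
  [∀ x, TopologicalSpace (L₂ x)] [TopologicalSpace (TotalSpace ℝ L₂)]
  [FiberBundle ℝ L₂] [VectorBundle ℝ ℝ L₂]
  {b b' x : M}

lemma lineCoord_tensorBundle (hx : x ∈ (trivializationAt ℝ (TensorBundle L₁ L₂) b).baseSet) :
    lineCoord (TensorBundle L₁ L₂) b x = TensorBundle.coord L₁ L₂ b x := by
  refine LinearMap.ext fun v => ?_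
  unfold lineCoord
  rw [Trivialization.coe_linearMapAt_of_mem (R := ℝ) _ hx]
  rfl

lemma lineFrame_tensorBundle (hx : x ∈ (trivializationAt ℝ (TensorBundle L₁ L₂) b).baseSet) :
    lineFrame (TensorBundle L₁ L₂) b x =
      TensorBundle.tmul (lineFrame L₁ b x) (lineFrame L₂ b x) := by
  refine lineCoord_injective hx ?_
  rw [lineCoord_lineFrame _ b x hx, lineCoord_tensorBundle L₁ L₂ hx]
  exact ((TensorBundle.lineFrames L₁ L₂).coord_frame b x hx).symm

lemma lineCoord_lineFrame_tensorBundle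
    (hx : x ∈ (trivializationAt ℝ (TensorBundle L₁ L₂) b).baseSet)
    (hx' : x ∈ (trivializationAt ℝ (TensorBundle L₁ L₂) b').baseSet) :
    lineCoord (TensorBundle L₁ L₂) b' x (lineFrame (TensorBundle L₁ L₂) b x) =
      lineCoord L₁ b' x (lineFrame L₁ b x) * lineCoord L₂ b' x (lineFrame L₂ b x) := by
  rw [lineCoord_tensorBundle L₁ L₂ hx', lineFrame_tensorBundle L₁ L₂ hx, TensorBundle.coord_tmul]

end TensorBundles

namespace LieAlgebroid

section Tensor

variable {E : Type*} [NormedAddCommGroup E] [NormedSpace ℝ E]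
  {M : Type*} [TopologicalSpace M] [ChartedSpace E M] [IsManifold 𝓘(ℝ, E) ∞ M]
  {F : Type*} [NormedAddCommGroup F] [NormedSpace ℝ F]
  {A : M → Type*} [TopologicalSpace (TotalSpace F A)] [∀ x, AddCommGroup (A x)]
  [∀ x, Module ℝ (A x)] [∀ x, TopologicalSpace (A x)] [FiberBundle F A] [VectorBundle ℝ F A]
  (𝔸 : LieAlgebroid E F A)
  {L₁ L₂ : M → Type*}
  [∀ x, AddCommGroup (L₁ x)] [∀ x, Module ℝ (L₁ x)]
  [∀ x, AddCommGroup (L₂ x)] [∀ x, Module ℝ (L₂ x)]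
  [∀ x, TopologicalSpace (L₁ x)] [TopologicalSpace (TotalSpace ℝ L₁)]
  [FiberBundle ℝ L₁] [VectorBundle ℝ ℝ L₁] [ContMDiffVectorBundle ∞ ℝ L₁ 𝓘(ℝ, E)]
  [∀ x, TopologicalSpace (L₂ x)] [TopologicalSpace (TotalSpace ℝ L₂)]
  [FiberBundle ℝ L₂] [VectorBundle ℝ ℝ L₂] [ContMDiffVectorBundle ∞ ℝ L₂ 𝓘(ℝ, E)]

lemma hasLocalForm_tensorOp {D : 𝔸.Operation L₁} {D' : 𝔸.Operation L₂}
    {α : Cₛ^∞⟮𝓘(ℝ, E); F, A⟯} {w w' : M → M → ℝ} (h : HasLocalForm (𝔸.rho α) (D α) w)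
    (h' : HasLocalForm (𝔸.rho α) (D' α) w') :
    HasLocalForm (𝔸.rho α) (𝔸.tensorOp D D' α) (fun b x => w b x + w' b x) := by
  refine hasLocalForm_of_center (fun x ζ _ => ?_) (fun b x hx => ?_)
  · have hx := FiberBundle.mem_baseSet_trivializationAt ℝ (TensorBundle L₁ L₂) x
    have hx₁ := FiberBundle.mem_baseSet_trivializationAt ℝ L₁ x
    have hx₂ := FiberBundle.mem_baseSet_trivializationAt ℝ L₂ x
    rw [tensorOp, lineCoord_tensorBundle L₁ L₂ hx, map_add, map_smul, map_smul, map_add,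
      TensorBundle.coord_tmul, TensorBundle.coord_tmul, TensorBundle.coord_tmul,
      h.lineCoord_apply_lineFrame hx₁, h'.lineCoord_apply_lineFrame hx₂,
      lineCoord_lineFrame L₁ x x hx₁, lineCoord_lineFrame L₂ x x hx₂,
      dirDeriv_congr (g := fun y => lineCoord (TensorBundle L₁ L₂) x y (ζ y))]
    · simp only [smul_eq_mul]
      ring
    · filter_upwards [(trivializationAt ℝ (TensorBundle L₁ L₂) x).open_baseSet.mem_nhds hx]
        with y hy
      rw [lineCoord_tensorBundle L₁ L₂ hy]
  · have hx' := FiberBundle.mem_baseSet_trivializationAt ℝ (TensorBundle L₁ L₂) x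
    have hmul : (fun y => lineCoord (TensorBundle L₁ L₂) x y (lineFrame (TensorBundle L₁ L₂) b y))
        =ᶠ[𝓝 x] fun y =>
          lineCoord L₁ x y (lineFrame L₁ b y) * lineCoord L₂ x y (lineFrame L₂ b y) := by
      filter_upwards [(trivializationAt ℝ (TensorBundle L₁ L₂) b).open_baseSet.mem_nhds hx,
        (trivializationAt ℝ (TensorBundle L₁ L₂) x).open_baseSet.mem_nhds hx'] with y hy hy'
      exact lineCoord_lineFrame_tensorBundle L₁ L₂ hy hy'
    rw [dirDeriv_congr hmul, lineCoord_lineFrame_tensorBundle L₁ L₂ hx hx',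
      dirDeriv_mul ((smoothNear_lineFrame hx.1).lineCoord hx'.1)
        ((smoothNear_lineFrame hx.2).lineCoord hx'.2)]
    linear_combination lineCoord L₂ x x (lineFrame L₂ b x) * h.transition hx.1 hx'.1 +
      lineCoord L₁ x x (lineFrame L₁ b x) * h'.transition hx.2 hx'.2

end Tensor

end LieAlgebroid

/-! ### Commutators -/

section Commutator

variable {E : Type*} [NormedAddCommGroup E] [NormedSpace ℝ E]
  {M : Type*} [TopologicalSpace M] [ChartedSpace E M] [IsManifold 𝓘(ℝ, E) ∞ M]
  {X Y Z : ∀ x : M, TangentSpace 𝓘(ℝ, E) x} {f : M → ℝ} {x : M}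
  {F : Type*} [NormedAddCommGroup F] [NormedSpace ℝ F]
  {V : M → Type*} [TopologicalSpace (TotalSpace F V)]
  [∀ x, AddCommGroup (V x)] [∀ x, Module ℝ (V x)]
  [∀ x, TopologicalSpace (V x)] [FiberBundle F V] [VectorBundle ℝ F V]
  {D₁ D₂ D₃ : (∀ x, V x) → ∀ x, V x} {σ : ∀ x, V x}

lemma IsDerivation.comp_leibniz (h₁ : IsDerivation F X D₁) (h₂ : IsDerivation F Y D₂)
    (hs₂ : PreservesSmooth F E D₂) (hY : SmoothNear E E Y x) (hf : SmoothFnNear E f x)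
    (hσ : SmoothNear E F σ x) :
    D₁ (D₂ fun y => f y • σ y) x = f x • D₁ (D₂ σ) x + dirDeriv X f x • D₂ σ x +
      (dirDeriv Y f x • D₁ σ x + dirDeriv X (dirDeriv Y f) x • σ x) := by
  have hYf : SmoothFnNear E (dirDeriv Y f) x := smoothFnNear_dirDeriv hf hY
  rw [← h₁.leibniz hf (hs₂ hσ), ← h₁.leibniz hYf hσ,
    ← h₁.add (.smul hf (hs₂ hσ)) (.smul hYf hσ)]
  refine h₁.congr (SmoothNear.add (.smul hf (hs₂ hσ)) (.smul hYf hσ)) ?_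
  have hf' : ∀ᶠ y in 𝓝 x, SmoothFnNear E f y := hf.eventually_nhds
  have hσ' : ∀ᶠ y in 𝓝 x, SmoothNear E F σ y := hσ.eventually_nhds
  filter_upwards [hf', hσ'] with y hy hy' using h₂.leibniz hy hy'

lemma dirDeriv_commutator_smul (h₁ : IsDerivation F X D₁) (h₂ : IsDerivation F Y D₂)
    (h₃ : IsDerivation F Z D₃) (hs₁ : PreservesSmooth F E D₁) (hs₂ : PreservesSmooth F E D₂)
    (hX : SmoothNear E E X x) (hY : SmoothNear E E Y x)
    (h : ∀ {σ : ∀ x, V x}, SmoothNear E F σ x → D₃ σ x = D₁ (D₂ σ) x - D₂ (D₁ σ) x)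
    (hf : SmoothFnNear E f x) (hσ : SmoothNear E F σ x) :
    dirDeriv Z f x • σ x = (dirDeriv X (dirDeriv Y f) x - dirDeriv Y (dirDeriv X f) x) • σ x := by
  have hcomm := h (.smul hf hσ)
  rw [h₃.leibniz hf hσ, h₁.comp_leibniz h₂ hs₂ hY hf hσ, h₂.comp_leibniz h₁ hs₁ hX hf hσ,
    h hσ] at hcomm
  refine add_left_cancel (hcomm.trans ?_)
  rw [sub_smul, smul_sub]
  abel

/-- Apply `dirDeriv_commutator_smul` to the derivations `[X, ·]`, `[Y, ·]` and `[[X, Y], ·]`. -/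
lemma dirDeriv_mlieBracket [FiniteDimensional ℝ E] (hX : ∀ x, SmoothNear E E X x)
    (hY : ∀ x, SmoothNear E E Y x) (hf : SmoothFnNear E f x) :
    dirDeriv (VectorField.mlieBracket 𝓘(ℝ, E) X Y) f x =
      dirDeriv X (dirDeriv Y f) x - dirDeriv Y (dirDeriv X f) x := by
  rcases subsingleton_or_nontrivial E with hE | hE
  · have hzero (W : ∀ x : M, TangentSpace 𝓘(ℝ, E) x) (g : M → ℝ) : dirDeriv W g x = 0 := by
      exact (congrArg (mvfderiv 𝓘(ℝ, E) g x) (Subsingleton.elim (α := E) _ _)).trans (map_zero _)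
    rw [hzero, hzero, hzero, sub_zero]
  · obtain ⟨u, hu⟩ := exists_ne (0 : E)
    obtain ⟨σ, hσ, hσx⟩ := exists_smoothNear_apply_eq E E
      (V := fun x : M => TangentSpace 𝓘(ℝ, E) x) (x := x) u
    have hsmul := dirDeriv_commutator_smul isDerivation_mlieBracket isDerivation_mlieBracket
      isDerivation_mlieBracket (preservesSmooth_mlieBracket hX) (preservesSmooth_mlieBracket hY)
      (hX x) (hY x) (mlieBracket_mlieBracket hX hY) hf hσ
    refine smul_left_injective ℝ (fun h => ?_) hsmul
    exact hu (hσx.symm.trans h)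

end Commutator

section TraceRules

variable {E : Type*} [NormedAddCommGroup E] [NormedSpace ℝ E]
  {M : Type*} [TopologicalSpace M] [ChartedSpace E M]
  {F : Type*} [NormedAddCommGroup F] [NormedSpace ℝ F] [FiniteDimensional ℝ F]
  {V : M → Type*} [TopologicalSpace (TotalSpace F V)]
  [∀ x, AddCommGroup (V x)] [∀ x, Module ℝ (V x)]
  [∀ x, TopologicalSpace (V x)] [FiberBundle F V] [VectorBundle ℝ F V]
  [ContMDiffVectorBundle ∞ F V 𝓘(ℝ, E)]
  {D D₁ D₂ : (∀ x, V x) → ∀ x, V x} {b x : M}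

lemma frameTrace_add
    (h : ∀ {σ : ∀ x, V x}, SmoothNear E F σ x → D σ x = D₁ σ x + D₂ σ x)
    (hx : x ∈ (trivializationAt F V b).baseSet) :
    frameTrace F D b x = frameTrace F D₁ b x + frameTrace F D₂ b x := by
  rw [frameTrace, frameTrace, frameTrace, ← Matrix.trace_add]
  congr 1
  ext i j
  exact (congrArg (localCoframe (trivializationAt F V b) (finBasis ℝ F) i x)
    (h (smoothNear_localFrame (finBasis ℝ F) hx j))).trans (map_add _ _ _)

lemma frameTrace_smul_sub (c : ℝ) (ℓ : V x →ₗ[ℝ] ℝ) (v : V x)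
    (h : ∀ {σ : ∀ x, V x}, SmoothNear E F σ x → D σ x = c • D₁ σ x - ℓ (σ x) • v)
    (hx : x ∈ (trivializationAt F V b).baseSet) :
    frameTrace F D b x = c * frameTrace F D₁ b x - ℓ v := by
  have hrank_one : ℓ v = ∑ i, ℓ ((trivializationAt F V b).localFrame (finBasis ℝ F) i x) *
      localCoframe (trivializationAt F V b) (finBasis ℝ F) i x v := by
    conv_lhs => rw [← sum_localCoframe_smul_localFrame (finBasis ℝ F) hx v, map_sum]
    exact Finset.sum_congr rfl fun i _ => by rw [map_smul, smul_eq_mul, mul_comm]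
  rw [frameTrace, frameTrace, Matrix.trace, Matrix.trace, hrank_one, Finset.mul_sum,
    ← Finset.sum_sub_distrib]
  refine Finset.sum_congr rfl fun i _ => ?_
  simp only [Matrix.diag_apply, connectionMatrix, Matrix.of_apply,
    h (smoothNear_localFrame _ hx i), map_sub, map_smul, smul_eq_mul]

end TraceRules

namespace LieAlgebroid

section ClosedForms

variable {E : Type*} [NormedAddCommGroup E] [NormedSpace ℝ E]
  {M : Type*} [TopologicalSpace M] [ChartedSpace E M] [IsManifold 𝓘(ℝ, E) ∞ M]
  {F : Type*} [NormedAddCommGroup F] [NormedSpace ℝ F]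
  {A : M → Type*} [TopologicalSpace (TotalSpace F A)] [∀ x, AddCommGroup (A x)]
  [∀ x, Module ℝ (A x)] [∀ x, TopologicalSpace (A x)] [FiberBundle F A] [VectorBundle ℝ F A]

/-- A closed `A`-one-form on `U`, encoded by its values on the global sections of `A`. -/
structure IsClosedFormOn (𝔸 : LieAlgebroid E F A) (w : Cₛ^∞⟮𝓘(ℝ, E); F, A⟯ → M → ℝ)
    (U : Set M) : Prop where
  smooth : ∀ α, ∀ x ∈ U, SmoothFnNear E (w α) x
  map_add : ∀ α β, ∀ x ∈ U, w (α + β) x = w α x + w β x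
  map_smul : ∀ (f : C^∞⟮𝓘(ℝ, E), M; 𝓘(ℝ, ℝ), ℝ⟯) α, ∀ x ∈ U, w (smulSection f α) x = f x * w α x
  map_bracket : ∀ α β, ∀ x ∈ U, w (𝔸.bracket α β) x =
    dirDeriv (𝔸.rho α) (w β) x - dirDeriv (𝔸.rho β) (w α) x

variable {𝔸 : LieAlgebroid E F A} {w w' : Cₛ^∞⟮𝓘(ℝ, E); F, A⟯ → M → ℝ} {U : Set M}

lemma IsClosedFormOn.add (h : 𝔸.IsClosedFormOn w U)
    (h' : 𝔸.IsClosedFormOn w' U) : 𝔸.IsClosedFormOn (fun α x => w α x + w' α x) U where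
  smooth α x hx := (h.smooth α x hx).add (h'.smooth α x hx)
  map_add α β x hx := by rw [h.map_add α β x hx, h'.map_add α β x hx]; ring
  map_smul f α x hx := by rw [h.map_smul f α x hx, h'.map_smul f α x hx]; ring
  map_bracket α β x hx := by
    rw [h.map_bracket α β x hx, h'.map_bracket α β x hx,
      dirDeriv_add (h.smooth β x hx) (h'.smooth β x hx),
      dirDeriv_add (h.smooth α x hx) (h'.smooth α x hx)]
    ring

end ClosedForms

section Divergence

variable {E : Type*} [NormedAddCommGroup E] [NormedSpace ℝ E] [FiniteDimensional ℝ E]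
  {M : Type*} [TopologicalSpace M] [ChartedSpace E M] [IsManifold 𝓘(ℝ, E) ∞ M]
  {F : Type*} [NormedAddCommGroup F] [NormedSpace ℝ F] [FiniteDimensional ℝ F]
  {A : M → Type*} [TopologicalSpace (TotalSpace F A)] [∀ x, AddCommGroup (A x)]
  [∀ x, Module ℝ (A x)] [∀ x, TopologicalSpace (A x)] [FiberBundle F A] [VectorBundle ℝ F A]
  (𝔸 : LieAlgebroid E F A)

/-- The trace of `[α, ·]` minus the trace of `[ρ(α), ·]`, in the frames of `A` and `TM` around `b`:
the local connection form of the transverse representations. -/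
noncomputable def divergence (α : Cₛ^∞⟮𝓘(ℝ, E); F, A⟯) (b x : M) : ℝ :=
  frameTrace F (𝔸.localBracket α) b x -
    frameTrace E (VectorField.mlieBracket 𝓘(ℝ, E) (𝔸.rho α)) b x

/-- The common domain of the frames of `A` and `TM` around `b`. -/
def frameDomain (_ : LieAlgebroid E F A) (b : M) : Set M :=
  (trivializationAt F A b).baseSet ∩
    (trivializationAt E (fun x : M => TangentSpace 𝓘(ℝ, E) x) b).baseSet

lemma baseSet_transverseBundle (χ χ' : SmoothCharacter) (b : M) :
    (trivializationAt ℝ (TensorBundle (AssocBundle χ (F →L[ℝ] ℝ) (DualBundle A))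
      (AssocBundle χ' E fun x : M => TangentSpace 𝓘(ℝ, E) x)) b).baseSet = 𝔸.frameDomain b :=
  congrArg (· ∩ _) (baseSet_dualBundle F A b)

variable [T2Space M] [ContMDiffVectorBundle ∞ F A 𝓘(ℝ, E)]
  (α β : Cₛ^∞⟮𝓘(ℝ, E); F, A⟯) {b x : M}

lemma divergence_add (hx : x ∈ 𝔸.frameDomain b) :
    𝔸.divergence (α + β) b x = 𝔸.divergence α b x + 𝔸.divergence β b x := by
  have htangent := frameTrace_add (E := E) (fun {σ} _ =>
    (congrArg (fun X => VectorField.mlieBracket 𝓘(ℝ, E) X σ x) (𝔸.rho_add α β)).trans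
      (VectorField.mlieBracket_add_left (𝔸.smoothNear_rho α x).mdifferentiableAt
        (𝔸.smoothNear_rho β x).mdifferentiableAt)) hx.2
  rw [divergence, frameTrace_add (𝔸.localBracket_add_left α β) hx.1, htangent, divergence,
    divergence]
  ring

/-- The two traces are not `C^∞(M)`-linear in `α`, but both fail by `ρ(α)(f)`. -/
lemma divergence_smulSection (f : C^∞⟮𝓘(ℝ, E), M; 𝓘(ℝ, ℝ), ℝ⟯) (hx : x ∈ 𝔸.frameDomain b) :
    𝔸.divergence (smulSection f α) b x = f x * 𝔸.divergence α b x := by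
  have hf : SmoothFnNear E f x := .of_contMDiff f.contMDiff
  let df : TangentSpace 𝓘(ℝ, E) x →ₗ[ℝ] ℝ := (mvfderiv 𝓘(ℝ, E) f x).toLinearMap
  have hA := frameTrace_smul_sub (f x) (df ∘ₗ (𝔸.anchor x).toLinearMap) (α x)
    (fun hσ => 𝔸.localBracket_smul_left f α hσ) hx.1
  have htangent := frameTrace_smul_sub (E := E)
    (D := VectorField.mlieBracket 𝓘(ℝ, E) (𝔸.rho (smulSection f α)))
    (D₁ := VectorField.mlieBracket 𝓘(ℝ, E) (𝔸.rho α)) (f x) df (𝔸.rho α x)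
    (fun _ => by
      rw [𝔸.rho_smulSection]
      refine (VectorField.mlieBracket_smul_left hf.mdifferentiableAt
        (𝔸.smoothNear_rho α x).mdifferentiableAt).trans ?_
      rw [neg_smul, neg_add_eq_sub]
      rfl) hx.2
  have hdf : (df ∘ₗ (𝔸.anchor x).toLinearMap) (α x) = df (𝔸.rho α x) := rfl
  rw [divergence, hA, htangent, hdf, divergence]
  ring

lemma smoothFnNear_divergence (hx : x ∈ 𝔸.frameDomain b) :
    SmoothFnNear E (𝔸.divergence α b) x :=
  (smoothFnNear_frameTrace (𝔸.preservesSmooth_localBracket α) hx.1).sub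
    (smoothFnNear_frameTrace (preservesSmooth_mlieBracket (𝔸.smoothNear_rho α)) hx.2)

lemma dirDeriv_divergence (X : ∀ x : M, TangentSpace 𝓘(ℝ, E) x) (hx : x ∈ 𝔸.frameDomain b) :
    dirDeriv X (𝔸.divergence α b) x = dirDeriv X (frameTrace F (𝔸.localBracket α) b) x -
      dirDeriv X (frameTrace E (VectorField.mlieBracket 𝓘(ℝ, E) (𝔸.rho α)) b) x :=
  dirDeriv_sub (smoothFnNear_frameTrace (𝔸.preservesSmooth_localBracket α) hx.1)
    (smoothFnNear_frameTrace (preservesSmooth_mlieBracket (𝔸.smoothNear_rho α)) hx.2)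

lemma divergence_bracket (hx : x ∈ 𝔸.frameDomain b) : 𝔸.divergence (𝔸.bracket α β) b x =
    dirDeriv (𝔸.rho α) (𝔸.divergence β b) x - dirDeriv (𝔸.rho β) (𝔸.divergence α b) x := by
  have hA : frameTrace F (𝔸.localBracket (𝔸.bracket α β)) b x =
      dirDeriv (𝔸.rho α) (frameTrace F (𝔸.localBracket β) b) x -
        dirDeriv (𝔸.rho β) (frameTrace F (𝔸.localBracket α) b) x :=
    trace_connectionMatrix_commutator _ (𝔸.isDerivation_localBracket α)
      (𝔸.isDerivation_localBracket β) (𝔸.preservesSmooth_localBracket α)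
      (𝔸.preservesSmooth_localBracket β) (𝔸.localBracket_bracket α β) hx.1
  have htangent : frameTrace E (VectorField.mlieBracket 𝓘(ℝ, E) (𝔸.rho (𝔸.bracket α β))) b x =
      dirDeriv (𝔸.rho α) (frameTrace E (VectorField.mlieBracket 𝓘(ℝ, E) (𝔸.rho β)) b) x -
        dirDeriv (𝔸.rho β) (frameTrace E (VectorField.mlieBracket 𝓘(ℝ, E) (𝔸.rho α)) b) x := by
    rw [𝔸.rho_bracket]
    exact trace_connectionMatrix_commutator _ isDerivation_mlieBracket isDerivation_mlieBracket
      (preservesSmooth_mlieBracket (𝔸.smoothNear_rho α))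
      (preservesSmooth_mlieBracket (𝔸.smoothNear_rho β))
      (mlieBracket_mlieBracket (𝔸.smoothNear_rho α) (𝔸.smoothNear_rho β)) hx.2
  rw [𝔸.dirDeriv_divergence _ _ hx, 𝔸.dirDeriv_divergence _ _ hx, divergence, hA, htangent]
  ring

variable (b) in
lemma isClosedFormOn_divergence :
    𝔸.IsClosedFormOn (fun α => 𝔸.divergence α b) (𝔸.frameDomain b) where
  smooth α _ hx := 𝔸.smoothFnNear_divergence α hx
  map_add α β _ hx := 𝔸.divergence_add α β hx
  map_smul f α _ hx := 𝔸.divergence_smulSection α f hx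
  map_bracket α β _ hx := 𝔸.divergence_bracket α β hx

lemma hasLocalForm_transverseOp {χ χ' : SmoothCharacter}
    (hχ : ∀ t, χ.toHom t * χ.toHom t = t * t) (hχ' : ∀ t, χ'.toHom t * χ'.toHom t = t * t) :
    HasLocalForm (𝔸.rho α) (𝔸.transverseOp χ χ' α) (𝔸.divergence α) := fun b x σ hx hσ => by
  have hlocal := 𝔸.hasLocalForm_tensorOp
    (D := fun α => lieAssoc χ (𝔸.rho α) (𝔸.lieDual α))
    (D' := fun α => lieAssoc χ' (𝔸.rho α) (VectorField.mlieBracket 𝓘(ℝ, E) (𝔸.rho α)))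
    (hasLocalForm_lieAssoc χ (𝔸.isDualOperator_lieDual α).isDerivation)
    (hasLocalForm_lieAssoc χ' (isDerivation_mlieBracket (X := 𝔸.rho α)))
  have hxA : x ∈ (trivializationAt F A b).baseSet :=
    ((𝔸.baseSet_transverseBundle χ χ' b).subset hx).1
  refine (hlocal hx hσ).trans ?_
  beta_reduce
  rw [SmoothCharacter.weight_eq_one hχ, SmoothCharacter.weight_eq_one hχ',
    (𝔸.isDualOperator_lieDual α).frameTrace_eq hxA, divergence]
  ring

end Divergence

end LieAlgebroid

/-! ### Representations from local forms -/

section LocalForms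

variable {E : Type*} [NormedAddCommGroup E] [NormedSpace ℝ E]
  {M : Type*} [TopologicalSpace M] [ChartedSpace E M]
  {L : M → Type*} [∀ x, AddCommGroup (L x)] [∀ x, Module ℝ (L x)]
  [∀ x, TopologicalSpace (L x)] [TopologicalSpace (TotalSpace ℝ L)]
  [FiberBundle ℝ L] [VectorBundle ℝ ℝ L]
  {X Y : ∀ x : M, TangentSpace 𝓘(ℝ, E) x} {P Q : (∀ x, L x) → ∀ x, L x} {w w' : M → M → ℝ}
  {σ τ : ∀ x, L x} {f : M → ℝ} {b x : M}

namespace HasLocalForm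

lemma eventuallyEq (h : HasLocalForm X P w) (hx : x ∈ (trivializationAt ℝ L b).baseSet)
    (hσ : SmoothNear E ℝ σ x) : (fun y => lineCoord L b y (P σ y)) =ᶠ[𝓝 x] fun y =>
      dirDeriv X (fun z => lineCoord L b z (σ z)) y + w b y * lineCoord L b y (σ y) := by
  have hσ' : ∀ᶠ y in 𝓝 x, SmoothNear E ℝ σ y := hσ.eventually_nhds
  filter_upwards [hσ', (trivializationAt ℝ L b).open_baseSet.mem_nhds hx] with y hy hyb
  exact h hyb hy

variable [ContMDiffVectorBundle ∞ ℝ L 𝓘(ℝ, E)]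

lemma isDerivation (h : HasLocalForm X P w) : IsDerivation ℝ X P where
  add {σ τ x} hσ hτ := by
    have hx := FiberBundle.mem_baseSet_trivializationAt ℝ L x
    apply lineCoord_injective hx
    rw [map_add, h hx hσ, h hx hτ, h hx (hσ.add hτ)]
    simp only [Pi.add_apply, map_add]
    rw [dirDeriv_add (hσ.lineCoord hx) (hτ.lineCoord hx)]
    ring
  leibniz {f σ x} hf hσ := by
    have hx := FiberBundle.mem_baseSet_trivializationAt ℝ L x
    apply lineCoord_injective hx
    rw [map_add, map_smul, map_smul, h hx hσ, h hx (.smul hf hσ)]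
    simp only [map_smul, smul_eq_mul]
    rw [dirDeriv_mul hf (hσ.lineCoord hx)]
    ring

variable [IsManifold 𝓘(ℝ, E) ∞ M]

lemma smoothNear (h : HasLocalForm X P w) (hX : SmoothNear E E X x)
    (hx : x ∈ (trivializationAt ℝ L b).baseSet) (hw : SmoothFnNear E (w b) x)
    (hσ : SmoothNear E ℝ σ x) : SmoothNear E ℝ (P σ) x :=
  smoothNear_of_lineCoord hx <| SmoothFnNear.congr
    ((smoothFnNear_dirDeriv (hσ.lineCoord hx) hX).add (hw.mul (hσ.lineCoord hx)))
    (h.eventuallyEq hx hσ)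

lemma lineCoord_commutator (h : HasLocalForm X P w) (h' : HasLocalForm Y Q w')
    (hX : SmoothNear E E X x) (hY : SmoothNear E E Y x)
    (hx : x ∈ (trivializationAt ℝ L b).baseSet) (hw : SmoothFnNear E (w b) x)
    (hw' : SmoothFnNear E (w' b) x) (hσ : SmoothNear E ℝ σ x) :
    lineCoord L b x (P (Q σ) x - Q (P σ) x) =
      dirDeriv X (dirDeriv Y fun y => lineCoord L b y (σ y)) x -
        dirDeriv Y (dirDeriv X fun y => lineCoord L b y (σ y)) x +
        (dirDeriv X (w' b) x - dirDeriv Y (w b) x) * lineCoord L b x (σ x) := by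
  have hc := hσ.lineCoord hx
  rw [map_sub, h hx (h'.smoothNear hY hx hw' hσ), h' hx (h.smoothNear hX hx hw hσ),
    dirDeriv_congr (h'.eventuallyEq hx hσ), dirDeriv_congr (h.eventuallyEq hx hσ),
    dirDeriv_add (smoothFnNear_dirDeriv hc hY) (hw'.mul hc),
    dirDeriv_add (smoothFnNear_dirDeriv hc hX) (hw.mul hc), dirDeriv_mul hw' hc,
    dirDeriv_mul hw hc, h hx hσ, h' hx hσ]
  ring

end HasLocalForm

end LocalForms

namespace LieAlgebroid

section Representations

variable {E : Type*} [NormedAddCommGroup E] [NormedSpace ℝ E]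
  {M : Type*} [TopologicalSpace M] [ChartedSpace E M] [IsManifold 𝓘(ℝ, E) ∞ M]
  {F : Type*} [NormedAddCommGroup F] [NormedSpace ℝ F]
  {A : M → Type*} [TopologicalSpace (TotalSpace F A)] [∀ x, AddCommGroup (A x)]
  [∀ x, Module ℝ (A x)] [∀ x, TopologicalSpace (A x)] [FiberBundle F A] [VectorBundle ℝ F A]
  (𝔸 : LieAlgebroid E F A)
  {L : M → Type*} [∀ x, AddCommGroup (L x)] [∀ x, Module ℝ (L x)]
  [∀ x, TopologicalSpace (L x)] [TopologicalSpace (TotalSpace ℝ L)]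
  [FiberBundle ℝ L] [VectorBundle ℝ ℝ L] [ContMDiffVectorBundle ∞ ℝ L 𝓘(ℝ, E)]

lemma dirDeriv_rho_add (α β : Cₛ^∞⟮𝓘(ℝ, E); F, A⟯) (f : M → ℝ) (x : M) :
    dirDeriv (𝔸.rho (α + β)) f x = dirDeriv (𝔸.rho α) f x + dirDeriv (𝔸.rho β) f x := by
  rw [𝔸.rho_add]
  exact map_add (mvfderiv _ f x) _ _

lemma dirDeriv_rho_smulSection (g : C^∞⟮𝓘(ℝ, E), M; 𝓘(ℝ, ℝ), ℝ⟯) (α : Cₛ^∞⟮𝓘(ℝ, E); F, A⟯)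
    (f : M → ℝ) (x : M) :
    dirDeriv (𝔸.rho (smulSection g α)) f x = g x * dirDeriv (𝔸.rho α) f x := by
  rw [𝔸.rho_smulSection]
  exact map_smul (mvfderiv _ f x) _ _

variable [FiniteDimensional ℝ E]

lemma dirDeriv_rho_bracket (α β : Cₛ^∞⟮𝓘(ℝ, E); F, A⟯) {f : M → ℝ} {x : M}
    (hf : SmoothFnNear E f x) : dirDeriv (𝔸.rho (𝔸.bracket α β)) f x =
      dirDeriv (𝔸.rho α) (dirDeriv (𝔸.rho β) f) x -
        dirDeriv (𝔸.rho β) (dirDeriv (𝔸.rho α) f) x := by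
  rw [𝔸.rho_bracket, dirDeriv_mlieBracket (𝔸.smoothNear_rho α) (𝔸.smoothNear_rho β) hf]

theorem isRepresentation_of_hasLocalForm {nabla : 𝔸.Operation L}
    {w : Cₛ^∞⟮𝓘(ℝ, E); F, A⟯ → M → M → ℝ} (h : ∀ α, HasLocalForm (𝔸.rho α) (nabla α) (w α))
    (hw : ∀ b, 𝔸.IsClosedFormOn (fun α => w α b) (trivializationAt ℝ L b).baseSet) :
    𝔸.IsRepresentation nabla := by
  have hx : ∀ x, x ∈ (trivializationAt ℝ L x).baseSet :=
    FiberBundle.mem_baseSet_trivializationAt ℝ L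
  constructor
  · intro α σ U hU hσ
    refine smoothSectionOn_of_smoothNear fun x hxU => ?_
    exact (h α).smoothNear (𝔸.smoothNear_rho α x) (hx x) ((hw x).smooth α x (hx x))
      (.of_smoothSectionOn hU hσ hxU)
  · intro α β σ U hU hσ x hxU
    have hσx := SmoothNear.of_smoothSectionOn hU hσ hxU
    apply lineCoord_injective (hx x)
    rw [map_add, h _ (hx x) hσx, h _ (hx x) hσx, h _ (hx x) hσx, (hw x).map_add _ _ x (hx x),
      𝔸.dirDeriv_rho_add]
    ring
  · intro f α σ U hU hσ x hxU
    have hσx := SmoothNear.of_smoothSectionOn hU hσ hxU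
    apply lineCoord_injective (hx x)
    rw [map_smul, h _ (hx x) hσx, h _ (hx x) hσx, (hw x).map_smul _ _ x (hx x),
      𝔸.dirDeriv_rho_smulSection, smul_eq_mul]
    ring
  · intro α σ τ U hU hσ hτ x hxU
    exact (h α).isDerivation.add (.of_smoothSectionOn hU hσ hxU) (.of_smoothSectionOn hU hτ hxU)
  · intro α σ f U hU hσ hf x hxU
    exact (h α).isDerivation.leibniz (.of_contMDiffOn hU hf hxU) (.of_smoothSectionOn hU hσ hxU)
  · intro α β σ U hU hσ x hxU
    have hσx := SmoothNear.of_smoothSectionOn hU hσ hxU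
    apply lineCoord_injective (hx x)
    rw [(h α).lineCoord_commutator (h β) (𝔸.smoothNear_rho α x) (𝔸.smoothNear_rho β x) (hx x)
      ((hw x).smooth α x (hx x)) ((hw x).smooth β x (hx x)) hσx, h _ (hx x) hσx,
      𝔸.dirDeriv_rho_bracket α β (hσx.lineCoord (hx x)), (hw x).map_bracket _ _ x (hx x)]

end Representations

end LieAlgebroid

/-! ### One-forms from tensorial functionals -/

section Tensoriality

variable {E : Type*} [NormedAddCommGroup E] [NormedSpace ℝ E]
  {M : Type*} [TopologicalSpace M] [ChartedSpace E M]
  {F : Type*} [NormedAddCommGroup F] [NormedSpace ℝ F]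
  {A : M → Type*} [TopologicalSpace (TotalSpace F A)] [∀ x, AddCommGroup (A x)]
  [∀ x, Module ℝ (A x)] [∀ x, TopologicalSpace (A x)] [FiberBundle F A] [VectorBundle ℝ F A]

/-- A `C^∞(M)`-linear map from sections of `A` to functions on `M`. -/
structure IsTensorial (Φ : Cₛ^∞⟮𝓘(ℝ, E); F, A⟯ → M → ℝ) : Prop where
  map_add : ∀ α β x, Φ (α + β) x = Φ α x + Φ β x
  map_smul : ∀ (f : C^∞⟮𝓘(ℝ, E), M; 𝓘(ℝ, ℝ), ℝ⟯) α x, Φ (smulSection f α) x = f x * Φ α x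

variable [FiniteDimensional ℝ E] [IsManifold 𝓘(ℝ, E) ∞ M] [T2Space M]

variable (F) in
lemma exists_section_apply_eq [FiniteDimensional ℝ F] [ContMDiffVectorBundle ∞ F A 𝓘(ℝ, E)]
    {x : M} (u : A x) : ∃ α : Cₛ^∞⟮𝓘(ℝ, E); F, A⟯, α x = u := by
  obtain ⟨s, hs, rfl⟩ := exists_smoothNear_apply_eq F E u
  obtain ⟨α, hα⟩ := hs.exists_section
  exact ⟨α, hα.self_of_nhds⟩

namespace IsTensorial

variable {Φ : Cₛ^∞⟮𝓘(ℝ, E); F, A⟯ → M → ℝ} {α β : Cₛ^∞⟮𝓘(ℝ, E); F, A⟯} {x : M}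

lemma congr (h : IsTensorial Φ) (hαβ : ∀ᶠ y in 𝓝 x, α y = β y) : Φ α x = Φ β x := by
  obtain ⟨f, hf, hf1⟩ := exists_smooth_bump (E := E) hαβ
  have heq : smulSection f α = smulSection f β := by
    ext y
    change f y • α y = f y • β y
    by_cases hy : y ∈ tsupport f
    · rw [show α y = β y from hf hy]
    · rw [image_eq_zero_of_notMem_tsupport hy, zero_smul, zero_smul]
  calc Φ α x = f x * Φ α x := by rw [hf1.self_of_nhds, one_mul]
    _ = f x * Φ β x := by rw [← h.map_smul, heq, h.map_smul]
    _ = Φ β x := by rw [hf1.self_of_nhds, one_mul]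

variable [FiniteDimensional ℝ F] [ContMDiffVectorBundle ∞ F A 𝓘(ℝ, E)]

lemma apply_eq_sum (h : IsTensorial Φ) {e : Trivialization F (π F A)} [MemTrivializationAtlas e]
    (hx : x ∈ e.baseSet) {ι : Type*} [Fintype ι] (v : Basis ι ℝ F)
    {s : ι → Cₛ^∞⟮𝓘(ℝ, E); F, A⟯} (hs : ∀ i, ∀ᶠ y in 𝓝 x, s i y = e.localFrame v i y) (α) :
    Φ α x = ∑ i, Φ (s i) x * localCoframe e v i x (α x) := by
  have hcoord (i) : ∃ g : C^∞⟮𝓘(ℝ, E), M; 𝓘(ℝ, ℝ), ℝ⟯,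
      ∀ᶠ y in 𝓝 x, g y = localCoframe e v i y (α y) :=
    ((SmoothNear.of_section α).localCoframe v hx i).exists_contMDiff
  choose g hg using hcoord
  have hexpand : ∀ᶠ y in 𝓝 x, α y = (∑ i, smulSection (g i) (s i)) y := by
    filter_upwards [eventually_all.2 hg, eventually_all.2 hs, e.open_baseSet.mem_nhds hx]
      with y hgy hsy hy
    have hsum : (∑ i, smulSection (g i) (s i) : Cₛ^∞⟮𝓘(ℝ, E); F, A⟯) y = ∑ i, g i y • s i y :=
      (congrFun (map_sum (ContMDiffSection.coeAddHom 𝓘(ℝ, E) F ∞ A) _ _) y).trans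
        (Finset.sum_apply _ _ _)
    simp only [hsum, hgy, hsy, sum_localCoframe_smul_localFrame v hy]
  calc Φ α x = Φ (∑ i, smulSection (g i) (s i)) x := h.congr hexpand
    _ = ∑ i, Φ (smulSection (g i) (s i)) x :=
      map_sum (AddMonoidHom.mk' (Φ · x) fun α β => h.map_add α β x) _ _
    _ = ∑ i, Φ (s i) x * localCoframe e v i x (α x) :=
      Finset.sum_congr rfl fun i _ => by rw [h.map_smul, (hg i).self_of_nhds, mul_comm]

theorem exists_form (h : IsTensorial Φ) (hs : ∀ α x, SmoothFnNear E (Φ α) x) :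
    ∃ c : Cₛ^∞⟮𝓘(ℝ, E); F →L[ℝ] ℝ, DualBundle A⟯, ∀ α x, (c x (α x) : ℝ) = Φ α x := by
  classical
  let v := finBasis ℝ F
  let v' : Basis _ ℝ (F →L[ℝ] ℝ) := v.dualBasis.map LinearMap.toContinuousLinearMap
  let dualFrame (b : M) := (trivializationAt (F →L[ℝ] ℝ) (DualBundle A) b).localFrame v'
  have hmem (x) : x ∈ (trivializationAt F A x).baseSet :=
    FiberBundle.mem_baseSet_trivializationAt F A x
  have hframe (b : M) (i) : ∃ s : Cₛ^∞⟮𝓘(ℝ, E); F, A⟯,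
      ∀ᶠ y in 𝓝 b, s y = (trivializationAt F A b).localFrame v i y :=
    (smoothNear_localFrame v (hmem b) i).exists_section
  choose s hsframe using hframe
  have heval {b y : M} (hy : y ∈ (trivializationAt F A b).baseSet)
      (hsy : ∀ i, ∀ᶠ z in 𝓝 y, s b i z = (trivializationAt F A b).localFrame v i z) (α) :
      ((∑ i, Φ (s b i) y • dualFrame b i y) (α y) : ℝ) = Φ α y := by
    refine (_root_.sum_apply _ _ (α y)).trans ((Finset.sum_congr rfl fun i _ => ?_).trans
      (h.apply_eq_sum hy v hsy α).symm)
    exact congrArg (Φ (s b i) y * ·) (localFrame_dualBundle v hy i (α y))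
  let c (x : M) : DualBundle A x := ∑ i, Φ (s x i) x • dualFrame x i x
  have hc (α x) : (c x (α x) : ℝ) = Φ α x := heval (hmem x) (hsframe x) α
  have hsmooth (x) : SmoothNear E (F →L[ℝ] ℝ) c x := by
    have hx' : x ∈ (trivializationAt (F →L[ℝ] ℝ) (DualBundle A) x).baseSet :=
      FiberBundle.mem_baseSet_trivializationAt _ _ x
    refine SmoothNear.congr (.sum Finset.univ fun i _ =>
      .smul (hs (s x i) x) (smoothNear_localFrame v' hx' i)) ?_
    filter_upwards [(trivializationAt F A x).open_baseSet.mem_nhds (hmem x),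
      eventually_all.2 fun i => (hsframe x i).eventually_nhds] with y hy hsy
    refine ContinuousLinearMap.ext fun u => ?_
    obtain ⟨α, rfl⟩ := exists_section_apply_eq (E := E) F u
    exact (hc α y).trans (heval hy hsy α).symm
  exact ⟨⟨c, fun x => (hsmooth x).contMDiffAt⟩, hc⟩

end IsTensorial

end Tensoriality

/-! ### Connection forms and characteristic classes -/

section LineSections

variable {E : Type*} [NormedAddCommGroup E] [NormedSpace ℝ E]
  {M : Type*} [TopologicalSpace M] [ChartedSpace E M]
  {L : M → Type*} [∀ x, AddCommGroup (L x)] [∀ x, Module ℝ (L x)]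
  [∀ x, TopologicalSpace (L x)] [TopologicalSpace (TotalSpace ℝ L)]
  [FiberBundle ℝ L] [VectorBundle ℝ ℝ L]

lemma exists_eq_smul_of_ne_zero {σ : ∀ x, L x} (hσ : ∀ x, σ x ≠ 0) (τ : ∀ x, L x) :
    ∃ f : M → ℝ, ∀ y, τ y = f y • σ y := by
  refine ⟨fun y => lineCoord L y y (τ y) / lineCoord L y y (σ y), fun y => ?_⟩
  have hy := FiberBundle.mem_baseSet_trivializationAt ℝ L y
  have hne := lineCoord_ne_zero hy (hσ y)
  apply lineCoord_injective hy
  rw [map_smul, smul_eq_mul, div_mul_cancel₀ _ hne]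

lemma SmoothFnNear.of_smul [ContMDiffVectorBundle ∞ ℝ L 𝓘(ℝ, E)] {f : M → ℝ} {σ : ∀ x, L x} {x : M}
    (hfσ : SmoothNear E ℝ (fun y => f y • σ y) x) (hσ : SmoothNear E ℝ σ x) (hne : σ x ≠ 0) :
    SmoothFnNear E f x := by
  have hx := FiberBundle.mem_baseSet_trivializationAt ℝ L x
  have hcoord := hσ.lineCoord hx
  have hcoord_ne := lineCoord_ne_zero hx hne
  refine SmoothFnNear.congr ((hfσ.lineCoord hx).mul (hcoord.inv hcoord_ne)) ?_
  filter_upwards [hcoord.contMDiffAt.continuousAt.eventually_ne hcoord_ne] with y hy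
  rw [map_smul, smul_eq_mul, mul_inv_cancel_right₀ hy]

variable {L' : M → Type*} [∀ x, AddCommGroup (L' x)] [∀ x, Module ℝ (L' x)]
  [∀ x, TopologicalSpace (L' x)] [TopologicalSpace (TotalSpace ℝ L')]
  [FiberBundle ℝ L'] [VectorBundle ℝ ℝ L']
  [ContMDiffVectorBundle ∞ ℝ L 𝓘(ℝ, E)] [ContMDiffVectorBundle ∞ ℝ L' 𝓘(ℝ, E)]

lemma exists_section_lineCoord_eq
    (htr : ∀ ⦃b b' x⦄, x ∈ (trivializationAt ℝ L b).baseSet →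
      x ∈ (trivializationAt ℝ L b').baseSet →
      lineCoord L b' x (lineFrame L b x) = lineCoord L' b' x (lineFrame L' b x))
    (σ : Cₛ^∞⟮𝓘(ℝ, E); ℝ, L⟯) : ∃ τ : Cₛ^∞⟮𝓘(ℝ, E); ℝ, L'⟯,
      ∀ b, ∀ x ∈ (trivializationAt ℝ L b).baseSet,
        lineCoord L' b x (τ x) = lineCoord L b x (σ x) := by
  have hmem (x) : x ∈ (trivializationAt ℝ L x).baseSet :=
    FiberBundle.mem_baseSet_trivializationAt ℝ L x
  let τ (x : M) : L' x := lineCoord L x x (σ x) • lineFrame L' x x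
  have hτ (b x) (hx : x ∈ (trivializationAt ℝ L b).baseSet) :
      lineCoord L' b x (τ x) = lineCoord L b x (σ x) := by
    rw [lineCoord_eq_mul (b' := b) (hmem x) (σ x), htr (hmem x) hx, map_smul, smul_eq_mul, mul_comm]
  have hsmooth (x) : SmoothNear E ℝ τ x := by
    have hσ : SmoothNear E ℝ σ x := .of_section σ
    refine smoothNear_of_lineCoord (FiberBundle.mem_baseSet_trivializationAt ℝ L' x)
      ((hσ.lineCoord (hmem x)).congr ?_)
    filter_upwards [(trivializationAt ℝ L x).open_baseSet.mem_nhds (hmem x)] with y hy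
      using hτ x y hy
  exact ⟨⟨τ, fun x => (hsmooth x).contMDiffAt⟩, hτ⟩

end LineSections

namespace LieAlgebroid

section Transport

variable {E : Type*} [NormedAddCommGroup E] [NormedSpace ℝ E]
  {M : Type*} [TopologicalSpace M] [ChartedSpace E M] [IsManifold 𝓘(ℝ, E) ∞ M]
  {F : Type*} [NormedAddCommGroup F] [NormedSpace ℝ F]
  {A : M → Type*} [TopologicalSpace (TotalSpace F A)] [∀ x, AddCommGroup (A x)]
  [∀ x, Module ℝ (A x)] [∀ x, TopologicalSpace (A x)] [FiberBundle F A] [VectorBundle ℝ F A]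
  {𝔸 : LieAlgebroid E F A}
  {L : M → Type*} [∀ x, AddCommGroup (L x)] [∀ x, Module ℝ (L x)]
  [∀ x, TopologicalSpace (L x)] [TopologicalSpace (TotalSpace ℝ L)]
  [FiberBundle ℝ L] [VectorBundle ℝ ℝ L]
  {L' : M → Type*} [∀ x, AddCommGroup (L' x)] [∀ x, Module ℝ (L' x)]
  [∀ x, TopologicalSpace (L' x)] [TopologicalSpace (TotalSpace ℝ L')]
  [FiberBundle ℝ L'] [VectorBundle ℝ ℝ L']
  {nabla : 𝔸.Operation L} {nabla' : 𝔸.Operation L'} {w : Cₛ^∞⟮𝓘(ℝ, E); F, A⟯ → M → M → ℝ}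

lemma IsConnectionForm.of_lineCoord_eq {σ : Cₛ^∞⟮𝓘(ℝ, E); ℝ, L⟯} {τ : Cₛ^∞⟮𝓘(ℝ, E); ℝ, L'⟯}
    {c : 𝔸.Form1} (hc : 𝔸.IsConnectionForm nabla σ c)
    (hw : ∀ α, HasLocalForm (𝔸.rho α) (nabla α) (w α))
    (hw' : ∀ α, HasLocalForm (𝔸.rho α) (nabla' α) (w α))
    (hτ : ∀ b, ∀ x ∈ (trivializationAt ℝ L b).baseSet,
      lineCoord L' b x (τ x) = lineCoord L b x (σ x)) :
    𝔸.IsConnectionForm nabla' τ c := fun α x => by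
  have hx := FiberBundle.mem_baseSet_trivializationAt ℝ L x
  have hx' := FiberBundle.mem_baseSet_trivializationAt ℝ L' x
  have hcoord : (fun y => lineCoord L' x y (τ y)) =ᶠ[𝓝 x] fun y => lineCoord L x y (σ y) := by
    filter_upwards [(trivializationAt ℝ L x).open_baseSet.mem_nhds hx] with y hy using hτ x y hy
  apply lineCoord_injective hx'
  calc lineCoord L' x x (nabla' α τ x)
      = dirDeriv (𝔸.rho α) (fun y => lineCoord L' x y (τ y)) x +
          w α x x * lineCoord L' x x (τ x) := hw' α hx' (.of_section τ)
    _ = dirDeriv (𝔸.rho α) (fun y => lineCoord L x y (σ y)) x +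
          w α x x * lineCoord L x x (σ x) := by rw [dirDeriv_congr hcoord, hτ x x hx]
    _ = lineCoord L x x (nabla α σ x) := (hw α hx (.of_section σ)).symm
    _ = (c x (α x) : ℝ) * lineCoord L' x x (τ x) := by
      rw [hc α x, hτ x x hx]
      exact map_smul _ _ _
    _ = lineCoord L' x x ((c x (α x) : ℝ) • τ x) := by
      symm
      exact map_smul _ _ _

variable [ContMDiffVectorBundle ∞ ℝ L 𝓘(ℝ, E)] [ContMDiffVectorBundle ∞ ℝ L' 𝓘(ℝ, E)]

theorem IsTrivializedClass.eq_of_lineCoord_lineFrame_eq {θ θ' : 𝔸.H1}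
    (h : 𝔸.IsTrivializedClass nabla θ) (h' : 𝔸.IsTrivializedClass nabla' θ')
    (hw : ∀ α, HasLocalForm (𝔸.rho α) (nabla α) (w α))
    (hw' : ∀ α, HasLocalForm (𝔸.rho α) (nabla' α) (w α))
    (htr : ∀ ⦃b b' x⦄, x ∈ (trivializationAt ℝ L b).baseSet →
      x ∈ (trivializationAt ℝ L b').baseSet →
      lineCoord L b' x (lineFrame L b x) = lineCoord L' b' x (lineFrame L' b x)) : θ = θ' := by
  obtain ⟨⟨σ, hσ⟩, hθ⟩ := h
  obtain ⟨⟨c, hc⟩, hcθ⟩ := hθ σ hσ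
  obtain ⟨τ, hτ⟩ := exists_section_lineCoord_eq htr σ
  have hτ0 (x) : τ x ≠ 0 := fun h0 => by
    have hx := FiberBundle.mem_baseSet_trivializationAt ℝ L x
    exact lineCoord_ne_zero hx (hσ x) (by rw [← hτ x x hx, h0, map_zero])
  rw [← hcθ c hc, ← (h'.2 τ hτ0).2 c (hc.of_lineCoord_eq hw hw' hτ)]

end Transport

section Classes

variable {E : Type*} [NormedAddCommGroup E] [NormedSpace ℝ E]
  {M : Type*} [TopologicalSpace M] [ChartedSpace E M] [IsManifold 𝓘(ℝ, E) ∞ M]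
  {F : Type*} [NormedAddCommGroup F] [NormedSpace ℝ F]
  {A : M → Type*} [TopologicalSpace (TotalSpace F A)] [∀ x, AddCommGroup (A x)]
  [∀ x, Module ℝ (A x)] [∀ x, TopologicalSpace (A x)] [FiberBundle F A] [VectorBundle ℝ F A]
  {𝔸 : LieAlgebroid E F A}
  {L : M → Type*} [∀ x, AddCommGroup (L x)] [∀ x, Module ℝ (L x)]
  [∀ x, TopologicalSpace (L x)] [TopologicalSpace (TotalSpace ℝ L)]
  [FiberBundle ℝ L] [VectorBundle ℝ ℝ L] [ContMDiffVectorBundle ∞ ℝ L 𝓘(ℝ, E)]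
  {nabla : 𝔸.Operation L} {σ τ : Cₛ^∞⟮𝓘(ℝ, E); ℝ, L⟯}

lemma IsRepresentation.isClosedFormOn_of_eq_smul (h : 𝔸.IsRepresentation nabla) (hσ : ∀ x, σ x ≠ 0)
    {w : Cₛ^∞⟮𝓘(ℝ, E); F, A⟯ → M → ℝ} (hw : ∀ α x, nabla α σ x = w α x • σ x) :
    𝔸.IsClosedFormOn w univ := by
  have hσs : SmoothSectionOn E ℝ σ univ := σ.contMDiff.contMDiffOn
  have hnabla (α) : nabla α σ = fun y => w α y • σ y := funext (hw α)
  have hsmooth (α x) : SmoothFnNear E (w α) x := by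
    refine .of_smul ?_ (.of_section σ) (hσ x)
    rw [← hnabla]
    exact .of_smoothSectionOn isOpen_univ (h.smooth α σ univ isOpen_univ hσs) (mem_univ x)
  have hnabla₂ (α β x) :
      nabla α (nabla β σ) x = (w β x * w α x + dirDeriv (𝔸.rho α) (w β) x) • σ x := by
    rw [hnabla β, h.leibniz α σ (w β) univ isOpen_univ hσs
      (fun y _ => (hsmooth β y).contMDiffAt.contMDiffWithinAt) x (mem_univ x), hw, smul_smul,
      add_smul]
  refine ⟨fun α x _ => hsmooth α x, fun α β x hx => ?_, fun f α x hx => ?_, fun α β x hx => ?_⟩ <;>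
    apply smul_left_injective ℝ (hσ x) <;> beta_reduce
  · rw [← hw, h.add_left α β σ univ isOpen_univ hσs x hx, hw, hw, add_smul]
  · rw [← hw, h.smul_left f α σ univ isOpen_univ hσs x hx, hw, mul_smul]
  · rw [← hw, h.flat α β σ univ isOpen_univ hσs x hx, hnabla₂, hnabla₂, ← sub_smul]
    ring_nf

variable [FiniteDimensional ℝ E] [T2Space M] [FiniteDimensional ℝ F]
  [ContMDiffVectorBundle ∞ F A 𝓘(ℝ, E)]

lemma IsClosedFormOn.exists_closedForm {w : Cₛ^∞⟮𝓘(ℝ, E); F, A⟯ → M → ℝ}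
    (h : 𝔸.IsClosedFormOn w univ) :
    ∃ c : 𝔸.closedForms, ∀ α x, ((c : 𝔸.Form1) x (α x) : ℝ) = w α x := by
  have htensorial : IsTensorial w :=
    ⟨fun α β x => h.map_add α β x (mem_univ x), fun f α x => h.map_smul f α x (mem_univ x)⟩
  obtain ⟨c, hc⟩ := htensorial.exists_form fun α x => h.smooth α x (mem_univ x)
  refine ⟨⟨c, fun α β x => ?_⟩, hc⟩
  simp only [hc]
  rw [h.map_bracket α β x (mem_univ x), sub_self]

namespace IsRepresentation

lemma exists_isConnectionForm (h : 𝔸.IsRepresentation nabla) (hσ : ∀ x, σ x ≠ 0) :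
    ∃ c : 𝔸.closedForms, 𝔸.IsConnectionForm nabla σ c := by
  choose w hw using fun α => exists_eq_smul_of_ne_zero hσ (nabla α σ)
  obtain ⟨c, hc⟩ := (h.isClosedFormOn_of_eq_smul hσ hw).exists_closedForm
  refine ⟨c, fun α x => ?_⟩
  rw [hc, hw]

/-- If `τ = f σ` then the two connection forms differ by `d_A log |f|`. -/
lemma sub_mem_exactForms (h : 𝔸.IsRepresentation nabla) (hσ : ∀ x, σ x ≠ 0) (hτ : ∀ x, τ x ≠ 0)
    {c d : 𝔸.Form1} (hc : 𝔸.IsConnectionForm nabla σ c) (hd : 𝔸.IsConnectionForm nabla τ d) :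
    d - c ∈ 𝔸.exactForms := by
  obtain ⟨f, hf⟩ := exists_eq_smul_of_ne_zero hσ τ
  have hτf : ⇑τ = fun y => f y • σ y := funext hf
  have hfs (x) : SmoothFnNear E f x :=
    .of_smul (hτf ▸ .of_section τ) (.of_section σ) (hσ x)
  have hf0 (x) : f x ≠ 0 := fun h0 => hτ x (by rw [hf, h0, zero_smul])
  have hlog (x) : SmoothFnNear E (fun y => Real.log (f y)) x :=
    (hfs x).comp_of_contDiffOn isOpen_compl_singleton
      (fun t ht => (Real.contDiffAt_log.2 ht).contDiffWithinAt) (hf0 x)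
  refine ⟨⟨_, fun x => (hlog x).contMDiffAt⟩, fun x u => ?_⟩
  obtain ⟨α, rfl⟩ := exists_section_apply_eq (E := E) F u
  have hleibniz : (d x (α x) : ℝ) * f x = f x * (c x (α x) : ℝ) + dirDeriv (𝔸.rho α) f x := by
    apply smul_left_injective ℝ (hσ x)
    have hnabla := h.leibniz α σ f univ isOpen_univ σ.contMDiff.contMDiffOn
      (fun y _ => (hfs y).contMDiffAt.contMDiffWithinAt) x (mem_univ x)
    rwa [← hτf, hd α x, hc α x, hf x, smul_smul, smul_smul, ← add_smul] at hnabla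
  have hdlog : dirDeriv (𝔸.rho α) (fun y => Real.log (f y)) x = d x (α x) - c x (α x) := by
    rw [dirDeriv_comp (hfs x) (Real.hasDerivAt_log (hf0 x)), inv_mul_eq_iff_eq_mul₀ (hf0 x)]
    linear_combination -hleibniz
  exact hdlog.symm

lemma exists_isTrivializedClass (h : 𝔸.IsRepresentation nabla)
    (hL : ∃ σ : Cₛ^∞⟮𝓘(ℝ, E); ℝ, L⟯, ∀ x, σ x ≠ 0) : ∃ θ, 𝔸.IsTrivializedClass nabla θ := by
  obtain ⟨σ, hσ⟩ := hL
  obtain ⟨c, hc⟩ := h.exists_isConnectionForm hσ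
  exact ⟨Submodule.Quotient.mk c, ⟨σ, hσ⟩, fun τ hτ => ⟨h.exists_isConnectionForm hτ,
    fun d hd => (Submodule.Quotient.eq _).2 (h.sub_mem_exactForms hσ hτ hc hd)⟩⟩

end IsRepresentation

end Classes

end LieAlgebroid

/-! ### Squares of line bundles -/

lemma exists_nowhere_vanishing_section_tensor_self
    {E : Type*} [NormedAddCommGroup E] [NormedSpace ℝ E] [FiniteDimensional ℝ E]
    {M : Type*} [TopologicalSpace M] [ChartedSpace E M] [IsManifold 𝓘(ℝ, E) ∞ M] [T2Space M]
    [SigmaCompactSpace M]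
    (L : M → Type*) [∀ x, AddCommGroup (L x)] [∀ x, Module ℝ (L x)]
    [∀ x, TopologicalSpace (L x)] [TopologicalSpace (TotalSpace ℝ L)]
    [FiberBundle ℝ L] [VectorBundle ℝ ℝ L] [ContMDiffVectorBundle ∞ ℝ L 𝓘(ℝ, E)] :
    ∃ σ : Cₛ^∞⟮𝓘(ℝ, E); ℝ, TensorBundle L L⟯, ∀ x, σ x ≠ 0 := by
  have hmem (x) : x ∈ (trivializationAt ℝ (TensorBundle L L) x).baseSet :=
    FiberBundle.mem_baseSet_trivializationAt ℝ (TensorBundle L L) x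
  have hframe {b y : M} (hy : y ∈ (trivializationAt ℝ (TensorBundle L L) b).baseSet) :
      0 < lineCoord (TensorBundle L L) y y (lineFrame (TensorBundle L L) b y) := by
    rw [lineCoord_lineFrame_tensorBundle L L hy (hmem y)]
    exact mul_self_pos.2 (lineCoord_lineFrame_ne_zero hy.1 (hmem y).1)
  obtain ⟨σ, hσ⟩ := exists_contMDiffSection_forall_mem_convex_of_local 𝓘(ℝ, E) (n := ⊤)
    (F_fiber := ℝ) (TensorBundle L L) (fun x => {v | 0 < lineCoord (TensorBundle L L) x x v})
    (fun x => convex_halfSpace_gt (lineCoord (TensorBundle L L) x x).isLinear 0)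
    (fun b => ⟨_, (trivializationAt ℝ (TensorBundle L L) b).open_baseSet.mem_nhds (hmem b),
      lineFrame (TensorBundle L L) b,
      fun y hy => (smoothNear_lineFrame (E := E) hy).contMDiffAt.contMDiffWithinAt,
      fun y hy => hframe hy⟩)
  refine ⟨σ, fun x h0 => ?_⟩
  have hpos : 0 < lineCoord (TensorBundle L L) x x (σ x) := hσ x
  rw [h0, map_zero] at hpos
  exact hpos.false

namespace LieAlgebroid

section Squares

variable {E : Type*} [NormedAddCommGroup E] [NormedSpace ℝ E]
  {M : Type*} [TopologicalSpace M] [ChartedSpace E M] [IsManifold 𝓘(ℝ, E) ∞ M]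
  {F : Type*} [NormedAddCommGroup F] [NormedSpace ℝ F]
  {A : M → Type*} [TopologicalSpace (TotalSpace F A)] [∀ x, AddCommGroup (A x)]
  [∀ x, Module ℝ (A x)] [∀ x, TopologicalSpace (A x)] [FiberBundle F A] [VectorBundle ℝ F A]
  {𝔸 : LieAlgebroid E F A}
  {L : M → Type*} [∀ x, AddCommGroup (L x)] [∀ x, Module ℝ (L x)]
  [∀ x, TopologicalSpace (L x)] [TopologicalSpace (TotalSpace ℝ L)]
  [FiberBundle ℝ L] [VectorBundle ℝ ℝ L] [ContMDiffVectorBundle ∞ ℝ L 𝓘(ℝ, E)]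
  {L' : M → Type*} [∀ x, AddCommGroup (L' x)] [∀ x, Module ℝ (L' x)]
  [∀ x, TopologicalSpace (L' x)] [TopologicalSpace (TotalSpace ℝ L')]
  [FiberBundle ℝ L'] [VectorBundle ℝ ℝ L'] [ContMDiffVectorBundle ∞ ℝ L' 𝓘(ℝ, E)]
  {nabla : 𝔸.Operation L} {nabla' : 𝔸.Operation L'}
  {w : Cₛ^∞⟮𝓘(ℝ, E); F, A⟯ → M → M → ℝ}

theorem IsCharClass.eq_of_sq_lineCoord_lineFrame_eq {θ θ' : 𝔸.H1}
    (h : 𝔸.IsCharClass nabla θ) (h' : 𝔸.IsCharClass nabla' θ')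
    (hw : ∀ α, HasLocalForm (𝔸.rho α) (nabla α) (w α))
    (hw' : ∀ α, HasLocalForm (𝔸.rho α) (nabla' α) (w α))
    (hbase : ∀ b, (trivializationAt ℝ L b).baseSet = (trivializationAt ℝ L' b).baseSet)
    (hsq : ∀ ⦃b b' x⦄, x ∈ (trivializationAt ℝ L b).baseSet →
      x ∈ (trivializationAt ℝ L b').baseSet →
      lineCoord L b' x (lineFrame L b x) ^ 2 = lineCoord L' b' x (lineFrame L' b x) ^ 2) :
    θ = θ' := by
  obtain ⟨η, hη, rfl⟩ := h
  obtain ⟨η', hη', rfl⟩ := h'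
  have hbase_sq {b x} (hx : x ∈ (trivializationAt ℝ (TensorBundle L L) b).baseSet) :
      x ∈ (trivializationAt ℝ (TensorBundle L' L') b).baseSet :=
    ⟨(hbase b).subset hx.1, (hbase b).subset hx.2⟩
  congr 1
  refine hη.eq_of_lineCoord_lineFrame_eq hη' (fun α => 𝔸.hasLocalForm_tensorOp (hw α) (hw α))
    (fun α => 𝔸.hasLocalForm_tensorOp (hw' α) (hw' α)) fun b b' x hx hx' => ?_
  rw [lineCoord_lineFrame_tensorBundle L L hx hx',
    lineCoord_lineFrame_tensorBundle L' L' (hbase_sq hx) (hbase_sq hx'), ← pow_two, ← pow_two,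
    hsq hx.1 hx'.1]

theorem exists_isCharClass_of_hasLocalForm [FiniteDimensional ℝ E] [T2Space M]
    [SigmaCompactSpace M] [FiniteDimensional ℝ F] [ContMDiffVectorBundle ∞ F A 𝓘(ℝ, E)]
    (h : ∀ α, HasLocalForm (𝔸.rho α) (nabla α) (w α))
    (hw : ∀ b, 𝔸.IsClosedFormOn (fun α => w α b) (trivializationAt ℝ L b).baseSet) :
    ∃ θ, 𝔸.IsCharClass nabla θ := by
  have hrep : 𝔸.IsRepresentation (𝔸.tensorOp nabla nabla) := by
    refine 𝔸.isRepresentation_of_hasLocalForm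
      (fun α => 𝔸.hasLocalForm_tensorOp (h α) (h α)) fun b => ?_
    rw [show (trivializationAt ℝ (TensorBundle L L) b).baseSet =
      (trivializationAt ℝ L b).baseSet from inter_self _]
    exact (hw b).add (hw b)
  obtain ⟨θ, hθ⟩ := hrep.exists_isTrivializedClass (exists_nowhere_vanishing_section_tensor_self L)
  exact ⟨_, θ, hθ, rfl⟩

end Squares

/-! ### The transverse representations -/

section Transverse

variable {E : Type*} [NormedAddCommGroup E] [NormedSpace ℝ E] [FiniteDimensional ℝ E]
  {M : Type*} [TopologicalSpace M] [ChartedSpace E M] [IsManifold 𝓘(ℝ, E) ∞ M]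
  {F : Type*} [NormedAddCommGroup F] [NormedSpace ℝ F] [FiniteDimensional ℝ F]
  {A : M → Type*} [TopologicalSpace (TotalSpace F A)] [∀ x, AddCommGroup (A x)]
  [∀ x, Module ℝ (A x)] [∀ x, TopologicalSpace (A x)] [FiberBundle F A] [VectorBundle ℝ F A]
  (𝔸 : LieAlgebroid E F A) {χ χ' : SmoothCharacter}

lemma sq_lineCoord_lineFrame_transverseBundle (hχ : ∀ t, χ.toHom t * χ.toHom t = t * t)
    (hχ' : ∀ t, χ'.toHom t * χ'.toHom t = t * t) {b b' x : M} (hx : x ∈ 𝔸.frameDomain b)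
    (hx' : x ∈ 𝔸.frameDomain b') :
    lineCoord (𝔸.TransverseBundle χ χ') b' x (lineFrame (𝔸.TransverseBundle χ χ') b x) ^ 2 =
      (transitionMatrix (trivializationAt (F →L[ℝ] ℝ) (DualBundle A) b)
        (trivializationAt (F →L[ℝ] ℝ) (DualBundle A) b')
        (finBasis ℝ (F →L[ℝ] ℝ)) (finBasis ℝ (F →L[ℝ] ℝ)) x).det ^ 2 *
      (transitionMatrix (trivializationAt E (fun x : M => TangentSpace 𝓘(ℝ, E) x) b)
        (trivializationAt E (fun x : M => TangentSpace 𝓘(ℝ, E) x) b')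
        (finBasis ℝ E) (finBasis ℝ E) x).det ^ 2 := by
  have hmem {b} (hx : x ∈ 𝔸.frameDomain b) :
      x ∈ (trivializationAt ℝ (𝔸.TransverseBundle χ χ') b).baseSet :=
    (𝔸.baseSet_transverseBundle χ χ' b).superset hx
  rw [lineCoord_lineFrame_tensorBundle _ _ (hmem hx) (hmem hx'),
    lineCoord_lineFrame_assocBundle χ (F →L[ℝ] ℝ) (DualBundle A) (hmem hx).1 (hmem hx').1,
    lineCoord_lineFrame_assocBundle χ' _ _ hx.2 hx'.2, mul_pow, pow_two, hχ, pow_two, hχ',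
    ← pow_two, ← pow_two]

variable [T2Space M] [ContMDiffVectorBundle ∞ F A 𝓘(ℝ, E)]

lemma isClosedFormOn_divergence_baseSet (χ χ' : SmoothCharacter) (b : M) :
    𝔸.IsClosedFormOn (fun α => 𝔸.divergence α b)
      (trivializationAt ℝ (𝔸.TransverseBundle χ χ') b).baseSet := by
  rw [baseSet_transverseBundle]
  exact 𝔸.isClosedFormOn_divergence b

theorem isRepresentation_transverseOp (hχ : ∀ t, χ.toHom t * χ.toHom t = t * t)
    (hχ' : ∀ t, χ'.toHom t * χ'.toHom t = t * t) :
    𝔸.IsRepresentation (𝔸.transverseOp χ χ') :=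
  𝔸.isRepresentation_of_hasLocalForm (fun α => 𝔸.hasLocalForm_transverseOp α hχ hχ')
    (𝔸.isClosedFormOn_divergence_baseSet χ χ')

theorem isCharClass_transverseOp [SigmaCompactSpace M]
    (hχ : ∀ t, χ.toHom t * χ.toHom t = t * t) (hχ' : ∀ t, χ'.toHom t * χ'.toHom t = t * t) :
    𝔸.IsCharClass (𝔸.transverseOp χ χ') 𝔸.modularClass := by
  have hd := densChar_mul_self
  obtain ⟨θ, hθ⟩ := exists_isCharClass_of_hasLocalForm
    (fun α => 𝔸.hasLocalForm_transverseOp α hχ hχ') (𝔸.isClosedFormOn_divergence_baseSet χ χ')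
  obtain ⟨μ, hμ⟩ := exists_isCharClass_of_hasLocalForm
    (fun α => 𝔸.hasLocalForm_transverseOp α hd hd)
    (𝔸.isClosedFormOn_divergence_baseSet densChar densChar)
  have hmod : 𝔸.modularClass = μ := hμ.charClass_eq
  have hθμ : θ = μ := by
    refine hθ.eq_of_sq_lineCoord_lineFrame_eq hμ
      (fun α => 𝔸.hasLocalForm_transverseOp α hχ hχ')
      (fun α => 𝔸.hasLocalForm_transverseOp α hd hd)
      (fun b => (𝔸.baseSet_transverseBundle χ χ' b).trans
        (𝔸.baseSet_transverseBundle densChar densChar b).symm) fun b b' x hx hx' => ?_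
    rw [baseSet_transverseBundle] at hx hx'
    rw [𝔸.sq_lineCoord_lineFrame_transverseBundle hχ hχ' hx hx',
      𝔸.sq_lineCoord_lineFrame_transverseBundle hd hd hx hx']
  rwa [hmod, ← hθμ]

end Transverse

end LieAlgebroid

theorem mainTheorem5
    {E : Type*} [NormedAddCommGroup E] [NormedSpace ℝ E] [FiniteDimensional ℝ E]
    {M : Type*} [TopologicalSpace M] [ChartedSpace E M] [IsManifold 𝓘(ℝ, E) ∞ M]
    [T2Space M] [SecondCountableTopology M]
    {F : Type*} [NormedAddCommGroup F] [NormedSpace ℝ F] [FiniteDimensional ℝ F]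
    {A : M → Type*} [TopologicalSpace (TotalSpace F A)] [∀ x, AddCommGroup (A x)]
    [∀ x, Module ℝ (A x)] [∀ x, TopologicalSpace (A x)] [FiberBundle F A] [VectorBundle ℝ F A]
    [ContMDiffVectorBundle ∞ F A 𝓘(ℝ, E)]
    (𝔸 : LieAlgebroid E F A) :
    (𝔸.IsRepresentation 𝔸.canOp ∧ 𝔸.IsRepresentation 𝔸.densOp ∧ 𝔸.IsRepresentation 𝔸.volOp) ∧
    (𝔸.IsCharClass 𝔸.canOp 𝔸.modularClass ∧ 𝔸.IsCharClass 𝔸.densOp 𝔸.modularClass ∧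
      𝔸.IsCharClass 𝔸.volOp 𝔸.modularClass) ∧
    𝔸.charClass 𝔸.canOp = 𝔸.modularClass ∧ 𝔸.charClass 𝔸.densOp = 𝔸.modularClass ∧
      𝔸.charClass 𝔸.volOp = 𝔸.modularClass := by
  have : LocallyCompactSpace M := ChartedSpace.locallyCompactSpace E M
  have hv := volChar_mul_self
  have hd := densChar_mul_self
  have hcan : 𝔸.IsCharClass 𝔸.canOp 𝔸.modularClass := 𝔸.isCharClass_transverseOp hv hd
  have hdens : 𝔸.IsCharClass 𝔸.densOp 𝔸.modularClass := 𝔸.isCharClass_transverseOp hd hd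
  have hvol : 𝔸.IsCharClass 𝔸.volOp 𝔸.modularClass := 𝔸.isCharClass_transverseOp hv hv
  exact ⟨⟨𝔸.isRepresentation_transverseOp hv hd, 𝔸.isRepresentation_transverseOp hd hd,
    𝔸.isRepresentation_transverseOp hv hv⟩, ⟨hcan, hdens, hvol⟩, hcan.charClass_eq,
    hdens.charClass_eq, hvol.charClass_eq⟩
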